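/- **Setting.** There are $n$ clocks, with valuations $v$ assigning a non-negative real to each clock. A transition $t=(g,R)$ consists of a guard $g$, a finite conjunction of constraints $x\sim c$ with $\sim\in\{<,\le,=,\ge,>\}$, $c\in\mathbb N$, and a set $R$ of clocks to be reset. We write $v\xrightarrow{t}v'$ if for some delay $\delta\ge 0$ the valuation $v+\delta$ satisfies $g$ and $v'$ is obtained from $v+\delta$ by setting the clocks of $R$ to $0$. For a finite sequence $\sigma=t_1\cdots t_m$, $\xrightarrow{\sigma}$ is the composition of the $\xrightarrow{t_i}$. The sequence $\sigma$ is *$\omega$-iterable from $v_0$* if there is an infinite sequence $v_0\xrightarrow{\sigma}v_1\xrightarrow{\sigma}v_2\cdots$, and *$\omega$-iterable* if it is so from some $v_0$. We write $\preccurlyeq$ for $<$ or $\le$ and $\succcurlyeq$ for $>$ or $\ge$; a constraint $x=c$ counts as both $x\le c$ and $x\ge c$. Let $X_0$ be the set of clocks that are reset on $\sigma$. **Graphs.** Let $X$ be the set of clocks together with a reference clock $x_0$ of constant value $0$. A transformation graph has vertex set $\{0,\dots,k\}\times X$ (columns $0,\dots,k$) and edges weighted by $(\le,d)$ or $(<,d)$,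 $d\in\mathbb Z$; weights are added by adding the numbers, the sum being strict if a summand is, and are ordered by tightness. The graph $G_t$ of $t=(g,R)$ has columns $0,1,2$ and the edges, of weight $(\le,0)$ unless stated otherwise: $(0,x_0)\to(1,x_0)$; $(0,x)\leftrightarrow(1,x)$ for $x\ne x_0$; $(1,x_0)\to(1,x)$ of weight $(\preccurlyeq,c)$ for each $x\preccurlyeq c$ in $g$; $(1,x)\to(1,x_0)$ of weight $(\preccurlyeq,-c)$ for each $x\succcurlyeq c$ in $g$ (strict iff the constraint is); $(1,x)\leftrightarrow(2,x)$ for $x\notin R$ (including $x_0$); $(1,x)\to(2,x)$ and $(2,x)\leftrightarrow(2,x_0)$ for $x\in R$. The composition $G\odot H$ places the columns of $H$ after those of $G$ and joins the last column of $G$ to the first of $H$ by edges $(\le,0)$ in both directions between copies of the same clock. If $G$ has no negative cycle (a cycle of weight smaller than $(\le,0)$), its canonical form replaces each edge weight by the shortest path weight, and $|G|$ is the restriction of the canonical form to the leftmost and rightmost columns; otherwise $|G|$ is undefined (the graph defines the empty relation). Put $G\cdot H=|G\odot H|$, $G_\sigma=|G_{t_1}\odot\cdots\odot G_{t_m}|$,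 and let $\mathrm{left}(G)$, $\mathrm{right}(G)$ be the restrictions to the leftmost and rightmost variables; $\mathrm{left}(G)$ describes the zone of all valuations $v$ such that $v(y)-v(x)\preccurlyeq d$ for each edge $x\to y$ of weight $(\preccurlyeq,d)$ in it, where $v(x_0)=0$. Write $G\asymp H$ if $\mathrm{left}(G)=\mathrm{left}(H)$ and $\mathrm{right}(G)=\mathrm{right}(H)$. **The procedure.** 1. Report that $\sigma$ is not $\omega$-iterable if one of the following holds: (a) some clock $y\notin X_0$ has guards $y\preccurlyeq d$ and $y\succcurlyeq c$ in $\sigma$ with $d<c$, or with $d=c$ and at least one of the two strict; (b) there are guards $y\preccurlyeq d$ with $y\notin X_0$ and $x\succcurlyeq c$ with $x\in X_0$, $c>0$; (c) there is a guard $x>0$ with $x\in X_0$, and there are guards $y\le c$ and $y\ge c$ for some $y\notin X_0$. 2. Otherwise, if no clock of $X_0$ has a guard $x\succcurlyeq c$ with $c>0$, report that $\sigma$ is $\omega$-iterable. Else let $\sigma'$ be $\sigma$ with all guards on clocks outside $X_0$ removed. 3. Compute $G^1=G_{\sigma'}$; if it is undefined, report that $\sigma$ is not $\omega$-iterable. 4.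 For $k=0,1,2,\dots$ compute $G^{2^{k+1}}=G^{2^k}\cdot G^{2^k}$. If it is undefined, report that $\sigma$ is not $\omega$-iterable. If $G^{2^{k+1}}\asymp G^{2^k}$, stop with the result $\mathrm{left}(G^{2^k})$. Otherwise, if $2^k>n^2$, report that $\sigma$ is not $\omega$-iterable. Otherwise continue with $k+1$. **Theorem.** Let $\sigma$ be a finite sequence of transitions over $n$ clocks. * If (a), (b) or (c) holds, then $\sigma$ is not $\omega$-iterable. * If none of them holds and no clock of $X_0$ has a guard $x\succcurlyeq c$ with $c>0$, then $\sigma$ is $\omega$-iterable, provided that $\sigma$ has no guard $z<0$ and, in case it has a guard $x>0$ with $x\in X_0$, no guard $z\le 0$ (or $z=0$) either. * If none of them holds and some clock of $X_0$ has a guard $x\succcurlyeq c$ with $c>0$, then $\sigma$ is $\omega$-iterable if and only if $\sigma'$ is; and for every $k\ge 0$: if $G^{2^k}$ is undefined, then $\sigma$ is not $\omega$-iterable; if $G^{2^{k+1}}$ is defined, $G^{2^{k+1}}\not\asymp G^{2^k}$ and $2^k>n^2$, then $\sigma$ is not $\omega$-iterable; if $G^{2^{k+1}}$ is defined and $G^{2^{k+1}}\asymp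 G^{2^k}$, then $\sigma$ is $\omega$-iterable and $\mathrm{left}(G^{2^k})$ describes exactly the set of valuations from which $\sigma'$ is $\omega$-iterable. Consequently the answers of the procedure are correct (the answer "iterable" of step 2 under the proviso above). Moreover, there is an implementation (with Floyd–Warshall's algorithm for canonical forms and incremental composition for $G_{\sigma'}$) which, counting each operation on weights, numbers and array entries as one step, and for $n\ge 1$ and non-empty $\sigma$, takes $O\bigl((|\sigma|+\log n)\cdot n^3\bigr)$ steps, plus a number of steps linear in the total number of atomic constraints in the guards (for reading them); here $|\sigma|$ is the number of transitions of $\sigma$ and the implied constants are absolute. -/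

import Mathlib

open scoped NNReal

namespace TimedIteration

/-! ### Timed transitions and iterability

The clocks are `Fin n`. The reference clock `x₀` (whose value is constantly `0`) is added below,
where the vertices of graphs are built. -/

/-- The comparison symbols `<, ≤, =, ≥, >`. -/
inductive Rel
  | lt | le | eq | ge | gt

namespace Rel

/-- `r.holds a c` is the comparison `a r c`. -/
def holds : Rel → ℝ → ℝ → Prop
  | lt, a, c => a < c
  | le, a, c => a ≤ c
  | eq, a, c => a = c
  | ge, a, c => a ≥ c
  | gt, a, c => a > c

/-- The symbol imposes an upper bound; an equality is both an upper and a lower bound. -/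
def isUpper : Rel → Bool
  | lt | le | eq => true
  | ge | gt => false

/-- The symbol imposes a lower bound. -/
def isLower : Rel → Bool
  | ge | gt | eq => true
  | lt | le => false

/-- The symbol is strict. -/
def isStrict : Rel → Bool
  | lt | gt => true
  | le | eq | ge => false

end Rel

/-- An atomic constraint `x ∼ c` with `c ∈ ℕ`. -/
structure Atom (n : ℕ) where
  clock : Fin n
  rel : Rel
  const : ℕ

/-- A transition: a guard (the conjunction of a finite list of atomic constraints) and a set of
clocks to be reset. -/
structure Transition (n : ℕ) where
  guard : List (Atom n)
  reset : Finset (Fin n)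

/-- Valuations of the clocks in `ℝ≥0`. -/
abbrev Valuation (n : ℕ) := Fin n → ℝ≥0

/-- `v` satisfies the guard `g`. -/
def Sat {n : ℕ} (v : Valuation n) (g : List (Atom n)) : Prop :=
  ∀ a ∈ g, a.rel.holds (v a.clock) a.const

/-- `v --t,δ--> v'`: let `δ` time units elapse, check the guard, reset. -/
def Step {n : ℕ} (t : Transition n) (v : Valuation n) (δ : ℝ≥0) (v' : Valuation n) : Prop :=
  Sat (fun x => v x + δ) t.guard ∧ v' = fun x => if x ∈ t.reset then 0 else v x + δ

/-- `v --σ,δ--> v'`, where `δ` is the total delay. -/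
inductive Exec {n : ℕ} : List (Transition n) → Valuation n → ℝ≥0 → Valuation n → Prop
  | nil (v : Valuation n) : Exec [] v 0 v
  | cons {t : Transition n} {σ : List (Transition n)} {v₀ v₁ v₂ : Valuation n} {δ ε : ℝ≥0} :
      Step t v₀ δ v₁ → Exec σ v₁ ε v₂ → Exec (t :: σ) v₀ (δ + ε) v₂

/-- `σ` is `ω`-iterable from `v`. -/
def OmegaIterableFrom {n : ℕ} (σ : List (Transition n)) (v : Valuation n) : Prop :=
  ∃ (w : ℕ → Valuation n) (δ : ℕ → ℝ≥0), w 0 = v ∧ ∀ i, Exec σ (w i) (δ i) (w (i + 1))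

/-- `σ` is `ω`-iterable. -/
def OmegaIterable {n : ℕ} (σ : List (Transition n)) : Prop :=
  ∃ v, OmegaIterableFrom σ v

/-! ### Preprocessing conditions -/

/-- The clocks that are reset on `σ`. -/
def resetClocks {n : ℕ} : List (Transition n) → Finset (Fin n)
  | [] => ∅
  | t :: σ => t.reset ∪ resetClocks σ

/-- The atomic constraint `a` occurs in a guard of `σ`. -/
def Occurs {n : ℕ} (σ : List (Transition n)) (a : Atom n) : Prop :=
  ∃ t ∈ σ, a ∈ t.guard

/-- Some clock `y` that is not reset has guards `y ≼ d` and `y ≽ c` with `d < c`, or with `d = c`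
and at least one of the two strict. -/
def ContradictoryBounds {n : ℕ} (σ : List (Transition n)) : Prop :=
  ∃ a b, Occurs σ a ∧ Occurs σ b ∧ a.clock = b.clock ∧ a.clock ∉ resetClocks σ ∧
    a.rel.isUpper ∧ b.rel.isLower ∧
    (a.const < b.const ∨ (a.const = b.const ∧ (a.rel.isStrict ∨ b.rel.isStrict)))

/-- There are guards `y ≼ d` on a clock that is not reset and `x ≽ c` with `c > 0` on a clock that
is reset. -/
def BoundedTotalTime {n : ℕ} (σ : List (Transition n)) : Prop :=
  ∃ a b, Occurs σ a ∧ Occurs σ b ∧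
    a.clock ∈ resetClocks σ ∧ a.rel.isLower ∧ 0 < a.const ∧
    b.clock ∉ resetClocks σ ∧ b.rel.isUpper

/-- There is a guard `x > 0` on a clock that is reset, and there are guards `y ≤ c` and `y ≥ c` on a
clock `y` that is not reset. -/
def FrozenTime {n : ℕ} (σ : List (Transition n)) : Prop :=
  (∃ a, Occurs σ a ∧ a.clock ∈ resetClocks σ ∧ a.rel = Rel.gt ∧ a.const = 0) ∧
  (∃ a b, Occurs σ a ∧ Occurs σ b ∧ a.clock = b.clock ∧ a.clock ∉ resetClocks σ ∧
    a.rel.isUpper ∧ ¬ a.rel.isStrict ∧ b.rel.isLower ∧ ¬ b.rel.isStrict ∧ a.const = b.const)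

/-- One of the three conditions that exclude `ω`-iterability at once. -/
def NonIterCondition {n : ℕ} (σ : List (Transition n)) : Prop :=
  ContradictoryBounds σ ∨ BoundedTotalTime σ ∨ FrozenTime σ

/-- Some clock is both reset and checked for `≽ c` with `c > 0`. -/
def HasPositiveLower {n : ℕ} (σ : List (Transition n)) : Prop :=
  ∃ a, Occurs σ a ∧ a.clock ∈ resetClocks σ ∧ a.rel.isLower ∧ 0 < a.const

/-- `σ` has no guard `z < 0`; and if it has a guard `x > 0` on a clock that is reset, then it has no
guard `z ≤ 0` (or `z = 0`) either. -/
def NoDegenerateUpper {n : ℕ} (σ : List (Transition n)) : Prop :=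
  (∀ a, Occurs σ a → a.rel = Rel.lt → 0 < a.const) ∧
  ((∃ a, Occurs σ a ∧ a.clock ∈ resetClocks σ ∧ a.rel = Rel.gt ∧ a.const = 0) →
    ∀ a, Occurs σ a → a.rel.isUpper → 0 < a.const)

/-- Remove from `σ` all guards on clocks that are not reset on `σ`. -/
def removeUnreset {n : ℕ} (σ : List (Transition n)) : List (Transition n) :=
  σ.map fun t => ⟨t.guard.filter fun a => decide (a.clock ∈ resetClocks σ), t.reset⟩

/-! ### Weights -/

/-- Weights of edges: `(d, true)` is `(≤, d)`, `(d, false)` is `(<, d)`, and `⊤` stands for an absent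
edge. The lexicographic order compares weights by tightness: `(<, d)` is smaller than `(≤, d)`. -/
abbrev Weight := WithTop (ℤ ×ₗ Bool)

/-- The weight `(≤, d)`. -/
def wle (d : ℤ) : Weight := ((toLex (d, true) : ℤ ×ₗ Bool) : Weight)

/-- The weight `(<, d)`. -/
def wlt (d : ℤ) : Weight := ((toLex (d, false) : ℤ ×ₗ Bool) : Weight)

/-- Sum of weights: the numbers are added, and the sum is strict if one of the summands is. -/
def wadd : Weight → Weight → Weight :=
  WithTop.map₂ fun a b => toLex ((ofLex a).1 + (ofLex b).1, (ofLex a).2 && (ofLex b).2)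

/-- The test `a < b` for weights. -/
def wless : Weight → Weight → Bool
  | some a, some b => decide ((ofLex a).1 < (ofLex b).1) ||
      (decide ((ofLex a).1 = (ofLex b).1) && !(ofLex a).2 && (ofLex b).2)
  | some _, none => true
  | none, _ => false

theorem wless_iff (a b : Weight) : wless a b = true ↔ a < b := by
  induction a using WithTop.recTopCoe with
  | top => simp only [not_top_lt, iff_false]; exact Bool.false_ne_true
  | coe a =>
    induction b using WithTop.recTopCoe with
    | top => simp only [WithTop.coe_lt_top, iff_true]; rfl
    | coe b =>
      rw [WithTop.coe_lt_coe, Prod.Lex.lt_iff]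
      change (decide ((ofLex a).1 < (ofLex b).1) ||
        (decide ((ofLex a).1 = (ofLex b).1) && !(ofLex a).2 && (ofLex b).2)) = true ↔ _
      cases (ofLex a).2 <;> cases (ofLex b).2 <;> simp

/-- The real number `r` satisfies the constraint `≼ d`. -/
def wsat (r : ℝ) : Weight → Prop
  | none => True
  | some a => if (ofLex a).2 then r ≤ (ofLex a).1 else r < (ofLex a).1

/-- The upper bound imposed by an atomic constraint. -/
def Atom.upper {n : ℕ} (a : Atom n) : Weight :=
  match a.rel with
  | Rel.lt => wlt a.const
  | Rel.le | Rel.eq => wle a.const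
  | Rel.ge | Rel.gt => ⊤

/-- The lower bound `x ≽ c` imposed by an atomic constraint, as the upper bound `≼ -c` on `-x`. -/
def Atom.lower {n : ℕ} (a : Atom n) : Weight :=
  match a.rel with
  | Rel.gt => wlt (-a.const)
  | Rel.ge | Rel.eq => wle (-a.const)
  | Rel.lt | Rel.le => ⊤

/-- The tightest upper bound on the clock `x` in a guard. -/
def guardUpper {n : ℕ} (x : Fin n) : List (Atom n) → Weight
  | [] => ⊤
  | a :: g => if a.clock = x then min a.upper (guardUpper x g) else guardUpper x g

/-- The tightest lower bound on the clock `x` in a guard. -/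
def guardLower {n : ℕ} (x : Fin n) : List (Atom n) → Weight
  | [] => ⊤
  | a :: g => if a.clock = x then min a.lower (guardLower x g) else guardLower x g

/-! ### Transformation graphs -/

/-- The set `X` of clocks including the reference clock `x₀ = 0`; the clock `i : Fin n` is
`i.succ`. -/
abbrev X (n : ℕ) := Fin (n + 1)

/-- Vertices of a graph with columns `0, …, k`. -/
abbrev Vertex (n k : ℕ) := Fin (k + 1) × X n

/-- Transformation graphs with columns `0, …, k`; of parallel edges only the tightest is kept, and
`⊤` means that there is no edge. -/
abbrev TGraph (n k : ℕ) := Vertex n k → Vertex n k → Weight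

/-- Edges of `G_t` inside the middle column: `x₀ → x` of weight `≼ c` for a constraint `x ≼ c` of
the guard, and `x → x₀` of weight `≼ -c` for a constraint `x ≽ c`. -/
def guardEdge {n : ℕ} (g : List (Atom n)) (x y : X n) : Weight :=
  Fin.cases (Fin.cases ⊤ (fun j => guardUpper j g) y)
    (fun i => Fin.cases (guardLower i g) (fun _ => ⊤) y) x

/-- `x` is a clock of the set `R` (so `x ≠ x₀`). -/
def inReset {n : ℕ} (R : Finset (Fin n)) (x : X n) : Bool :=
  Fin.cases false (fun i => decide (i ∈ R)) x

/-- The three-column transformation graph of a transition, from the tightest bounds `gu` between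
vertices of the middle column and the reset set `R`. -/
def transGraphOf {n : ℕ} (gu : X n → X n → Weight) (R : Finset (Fin n)) : TGraph n 2 :=
  fun u v =>
    match u.1, v.1 with
    | 0, 1 => if u.2 = v.2 then wle 0 else ⊤
    | 1, 0 => if u.2 = v.2 ∧ u.2 ≠ 0 then wle 0 else ⊤
    | 1, 1 => gu u.2 v.2
    | 1, 2 => if u.2 = v.2 then wle 0 else ⊤
    | 2, 1 => if u.2 = v.2 ∧ inReset R u.2 = false then wle 0 else ⊤
    | 2, 2 => if (u.2 = 0 ∧ inReset R v.2 = true) ∨ (inReset R u.2 = true ∧ v.2 = 0) then wle 0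
        else ⊤
    | _, _ => ⊤

/-- The transformation graph `G_t` of a transition. -/
def transGraph {n : ℕ} (t : Transition n) : TGraph n 2 :=
  transGraphOf (guardEdge t.guard) t.reset

/-- The composition `G ⊙ H`: the columns of `G` followed by those of `H`, where the last column of
`G` and the first column of `H` are joined by edges `(≤, 0)` in both directions. -/
def comp {n k l : ℕ} (G : TGraph n k) (H : TGraph n l) : TGraph n (k + 1 + l) :=
  fun u v =>
    Fin.addCases (m := k + 1) (n := l + 1) (motive := fun _ => Weight)
      (fun i =>
        Fin.addCases (m := k + 1) (n := l + 1) (motive := fun _ => Weight)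
          (fun j => G (i, u.2) (j, v.2))
          (fun j => if i = Fin.last k ∧ j = 0 ∧ u.2 = v.2 then wle 0 else ⊤) v.1)
      (fun i =>
        Fin.addCases (m := k + 1) (n := l + 1) (motive := fun _ => Weight)
          (fun j => if i = 0 ∧ j = Fin.last k ∧ u.2 = v.2 then wle 0 else ⊤)
          (fun j => H (i, u.2) (j, v.2)) v.1)
      u.1

/-- The index of the last column of `G_σ` for a sequence `t :: σ`. -/
def lastColumn {n : ℕ} : List (Transition n) → ℕ
  | [] => 2
  | _ :: σ => 2 + 1 + lastColumn σ

/-- The transformation graph `G_{t₁} ⊙ ⋯ ⊙ G_{tₖ}` of a nonempty sequence `t :: σ`. -/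
def seqGraph {n : ℕ} : (t : Transition n) → (σ : List (Transition n)) → TGraph n (lastColumn σ)
  | t, [] => transGraph t
  | t, s :: σ => comp (transGraph t) (seqGraph s σ)

/-- The weight of the walk `u → w₁ → ⋯ → wₘ → v`. -/
def walkWeight {V : Type} (G : V → V → Weight) : V → List V → V → Weight
  | u, [], v => G u v
  | u, w :: l, v => wadd (G u w) (walkWeight G w l v)

/-- `G` has a cycle of negative weight, that is, of weight smaller than `(≤, 0)`. -/
def HasNegativeCycle {V : Type} (G : V → V → Weight) : Prop :=
  ∃ u l, walkWeight G u l u < wle 0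

/-- The weights of all paths from `u` to `v`, including the empty path if `u = v`. -/
def pathWeights {V : Type} (G : V → V → Weight) (u v : V) : Set Weight :=
  {w | (u = v ∧ w = wle 0) ∨ ∃ l, w = walkWeight G u l v}

open Classical in
/-- The canonical form of a graph without negative cycles: every edge is a shortest path. -/
noncomputable def canon {V : Type} (G : V → V → Weight) (u v : V) : Weight :=
  if h : ∃ w, IsLeast (pathWeights G u v) w then h.choose else ⊤

/-- The restriction of a graph to its leftmost and its rightmost column. -/
def outer {n k : ℕ} (G : TGraph n k) : TGraph n 1 :=
  fun u v => G (if u.1 = 0 then 0 else Fin.last k, u.2) (if v.1 = 0 then 0 else Fin.last k, v.2)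

open Classical in
/-- The short transformation graph `|G|`; `none` if it is not defined. -/
noncomputable def short {n k : ℕ} (G : TGraph n k) : Option (TGraph n 1) :=
  if HasNegativeCycle G then none else some (outer (canon G))

/-- `G^{2^k}` for `G = |G_σ|`, by repeated squaring `G ↦ G · G = |G ⊙ G|`; `none` if it is not
defined. (The graph of the empty sequence is never used.) -/
noncomputable def power {n : ℕ} (σ : List (Transition n)) : ℕ → Option (TGraph n 1)
  | 0 =>
    match σ with
    | [] => none
    | t :: σ' => short (seqGraph t σ')
  | k + 1 => (power σ k).bind fun G => short (comp G G)

/-- Difference bounds `y - x ≼ Z x y` between the variables in `X`. -/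
abbrev DBM (n : ℕ) := X n → X n → Weight

/-- The valuation extended by the value `0` of the reference clock. -/
def extend {n : ℕ} (v : Valuation n) : X n → ℝ :=
  Fin.cases 0 fun i => (v i : ℝ)

/-- The zone described by a matrix of difference bounds. -/
def DBM.zone {n : ℕ} (Z : DBM n) : Set (Valuation n) :=
  {v | ∀ x y, wsat (extend v y - extend v x) (Z x y)}

/-- The restriction of a two-column graph to the leftmost variables. -/
def left {n : ℕ} (G : TGraph n 1) : DBM n := fun x y => G (0, x) (0, y)

/-- The restriction of a two-column graph to the rightmost variables. -/
def right {n : ℕ} (G : TGraph n 1) : DBM n := fun x y => G (1, x) (1, y)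

/-- `G ≍ H`. -/
def Similar {n : ℕ} (G H : TGraph n 1) : Prop := left G = left H ∧ right G = right H

/-! ### The procedure -/

/-- Possible answers of the procedure. -/
inductive Verdict (n : ℕ)
  | notIterable
  | iterable
  | zone (Z : DBM n)

open Classical in
/-- The squaring loop, started with the exponent `2^k`. The first argument only bounds the number of
rounds. -/
noncomputable def squaring {n : ℕ} (σ : List (Transition n)) : ℕ → ℕ → Verdict n
  | 0, _ => Verdict.notIterable
  | fuel + 1, k =>
    match power σ k, power σ (k + 1) with
    | some G, some G' =>
      if Similar G' G then Verdict.zone (left G)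
      else if n ^ 2 < 2 ^ k then Verdict.notIterable
      else squaring σ fuel (k + 1)
    | _, _ => Verdict.notIterable

open Classical in
/-- The procedure. The bound `n ^ 2 + 1` on the number of rounds is never exhausted, because the
loop stops as soon as `n ^ 2 < 2 ^ k`. -/
noncomputable def procedure {n : ℕ} (σ : List (Transition n)) : Verdict n :=
  if NonIterCondition σ then Verdict.notIterable
  else if ¬ HasPositiveLower σ then Verdict.iterable
  else squaring (removeUnreset σ) (n ^ 2 + 1) 0

/-! ### An implementation with a step count

Programs return a value and the number of elementary steps that were performed. Adding or comparing
two weights (or two numbers), reading or writing an entry of an array, and testing whether a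
transition resets a clock are elementary steps. -/

/-- A value with the number of steps used to compute it. -/
structure Timed (α : Type) where
  val : α
  cost : ℕ

instance : Monad Timed where
  pure a := ⟨a, 0⟩
  bind m f := ⟨(f m.val).val, m.cost + (f m.val).cost⟩

/-- An elementary step that returns `a`. -/
def step {α : Type} (a : α) : Timed α := ⟨a, 1⟩

/-- Compute all entries of an array and store them; storing an entry is one step. -/
def tabulate {ι α : Type} [Fintype ι] (f : ι → Timed α) : Timed (ι → α) :=
  ⟨fun i => (f i).val, ∑ i, ((f i).cost + 1)⟩

/-- Run through a list; every round has one step of overhead. -/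
def loop {α β : Type} (f : β → α → Timed β) : β → List α → Timed β
  | b, [] => step b
  | b, a :: l => do
    let b' ← step b
    let b'' ← f b' a
    loop f b'' l

/-- Test whether some entry of a list satisfies `p`. -/
def anyT {α : Type} (p : α → Timed Bool) (l : List α) : Timed Bool :=
  loop (fun b a => do
    let c ← p a
    step (b || c)) false l

/-- Run through the vertices of a graph. -/
def vertices (n k : ℕ) : List (Vertex n k) :=
  (List.finRange (k + 1)).product (List.finRange (n + 1))

/-- Floyd–Warshall's algorithm. -/
def floydWarshall {n k : ℕ} (G : TGraph n k) : Timed (TGraph n k) := do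
  let D ← tabulate fun u => tabulate fun v => step (if u = v then min (G u v) (wle 0) else G u v)
  loop (fun D w => tabulate fun u => tabulate fun v => do
    let s ← step (wadd (D u w) (D w v))
    step (min (D u v) s)) D (vertices n k)

/-- Computes `|G|`. -/
def shortT {n k : ℕ} (G : TGraph n k) : Timed (Option (TGraph n 1)) := do
  let D ← floydWarshall G
  let neg ← anyT (fun u => step (wless (D u u) (wle 0))) (vertices n k)
  if neg then
    step none
  else do
    let S ← tabulate fun u => tabulate fun v => step (outer D u v)
    step (some S)

/-- Computes `G · H`. -/
def mulT {n : ℕ} (G H : TGraph n 1) : Timed (Option (TGraph n 1)) := do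
  let K ← tabulate fun u => tabulate fun v => step (comp G H u v)
  shortT K

/-- Tightens the arrays of upper and lower bounds by the constraints in a list. -/
def boundsT {n : ℕ} (b : (Fin n → Weight) × (Fin n → Weight)) (g : List (Atom n)) :
    Timed ((Fin n → Weight) × (Fin n → Weight)) :=
  loop (fun b a => do
    let u ← step (min a.upper (b.1 a.clock))
    let l ← step (min a.lower (b.2 a.clock))
    let U ← step (Function.update b.1 a.clock u)
    let L ← step (Function.update b.2 a.clock l)
    step (U, L)) b g

/-- Arrays without bounds. -/
def noBoundsT (n : ℕ) : Timed ((Fin n → Weight) × (Fin n → Weight)) := do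
  let U ← tabulate fun _ => step ⊤
  let L ← tabulate fun _ => step ⊤
  step (U, L)

/-- Computes `|G_t|`. -/
def transGraphT {n : ℕ} (t : Transition n) : Timed (Option (TGraph n 1)) := do
  let e ← noBoundsT n
  let b ← boundsT e t.guard
  let gu ← tabulate fun x => tabulate fun y =>
    step (Fin.cases (motive := fun _ => Weight) (Fin.cases ⊤ (fun j => b.1 j) y)
      (fun i => Fin.cases (b.2 i) (fun _ => ⊤) y) x)
  let G ← tabulate fun u => tabulate fun v => step (transGraphOf gu t.reset u v)
  shortT G

/-- Computes `|G_σ|` by incremental composition. -/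
def seqGraphT {n : ℕ} : List (Transition n) → Timed (Option (TGraph n 1))
  | [] => step none
  | [t] => transGraphT t
  | t :: s :: σ => do
    let G ← transGraphT t
    let H ← seqGraphT (s :: σ)
    match G, H with
    | some G, some H => mulT G H
    | _, _ => step none

/-- Tests `G ≍ H`. -/
def similarT {n : ℕ} (G H : TGraph n 1) : Timed Bool := do
  let b ← anyT (fun x => anyT (fun y => do
    let l ← step (decide (G (0, x) (0, y) ≠ H (0, x) (0, y)))
    let r ← step (decide (G (1, x) (1, y) ≠ H (1, x) (1, y)))
    step (l || r)) (List.finRange (n + 1))) (List.finRange (n + 1))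
  step (!b)

/-- The squaring loop, started with a graph `G` and the exponent `p`. -/
def squaringT {n : ℕ} : ℕ → ℕ → TGraph n 1 → Timed (Verdict n)
  | 0, _, _ => step Verdict.notIterable
  | fuel + 1, p, G => do
    let H ← mulT G G
    match H with
    | none => step Verdict.notIterable
    | some G' => do
      let s ← similarT G' G
      if s then do
        let Z ← tabulate fun x => tabulate fun y => step (G (0, x) (0, y))
        step (Verdict.zone Z)
      else do
        let big ← step (decide (n * n < p))
        if big then
          step Verdict.notIterable
        else do
          let p' ← step (p + p)
          squaringT fuel p' G'

/-- Computes the set of clocks that are reset. -/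
def resetT {n : ℕ} (σ : List (Transition n)) : Timed (Fin n → Bool) := do
  let e ← tabulate fun _ => step false
  loop (fun r t => tabulate fun x => step (r x || decide (x ∈ t.reset))) e σ

/-- What the preprocessing needs to know about the guards. -/
structure Summary (n : ℕ) where
  /-- there is a guard `x ≽ c` with `c > 0` on a clock that is reset -/
  posLower : Bool
  /-- there is a guard `x > 0` on a clock that is reset -/
  gtZero : Bool
  /-- there is a guard `y ≼ d` on a clock that is not reset -/
  upperUnreset : Bool
  /-- tightest upper and lower bounds -/
  bounds : (Fin n → Weight) × (Fin n → Weight)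

/-- Reads all guards. -/
def summaryT {n : ℕ} (r : Fin n → Bool) (σ : List (Transition n)) : Timed (Summary n) := do
  let e ← noBoundsT n
  loop (fun s t => do
    let s' ← loop (fun (s : Summary n) a => do
      let isReset ← step (r a.clock)
      let p ← step (s.posLower || (isReset && a.rel.isLower && decide (0 < a.const)))
      let q ← step (s.gtZero ||
        (isReset && a.rel.isLower && a.rel.isStrict && decide (a.const = 0)))
      let u ← step (s.upperUnreset || (!isReset && a.rel.isUpper))
      step ⟨p, q, u, s.bounds⟩) s t.guard
    let b ← boundsT s'.bounds t.guard
    step ⟨s'.posLower, s'.gtZero, s'.upperUnreset, b⟩) ⟨false, false, false, e⟩ σ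

/-- Tests the three conditions that exclude `ω`-iterability at once. -/
def nonIterT {n : ℕ} (r : Fin n → Bool) (s : Summary n) : Timed Bool := do
  let c₁ ← anyT (fun y => do
    let w ← step (wadd (s.bounds.1 y) (s.bounds.2 y))
    step (!(r y) && wless w (wle 0))) (List.finRange n)
  let c₂ ← step (s.posLower && s.upperUnreset)
  let c₃ ← anyT (fun y => do
    let w ← step (wadd (s.bounds.1 y) (s.bounds.2 y))
    step (!(r y) && !wless (wle 0) w)) (List.finRange n)
  step (c₁ || c₂ || (s.gtZero && c₃))

/-- Removes the guards on clocks that are not reset. -/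
def removeUnresetT {n : ℕ} (r : Fin n → Bool) :
    List (Transition n) → Timed (List (Transition n))
  | [] => step []
  | t :: σ => do
    let g ← loop (fun g a => do
      let isReset ← step (r a.clock)
      if isReset then step (a :: g) else step g) [] t.guard
    let g' ← loop (fun g a => step (a :: g)) [] g
    let σ' ← removeUnresetT r σ
    step (⟨g', t.reset⟩ :: σ')

/-- The implementation of the procedure. -/
def iterTest {n : ℕ} (σ : List (Transition n)) : Timed (Verdict n) := do
  let r ← resetT σ
  let s ← summaryT r σ
  let c ← nonIterT r s
  if c then
    step Verdict.notIterable
  else if !s.posLower then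
    step Verdict.iterable
  else do
    let σ' ← removeUnresetT r σ
    let G ← seqGraphT σ'
    match G with
    | none => step Verdict.notIterable
    | some G => squaringT (n ^ 2 + 1) 1 G

/-- The total number of atomic constraints in the guards of `σ`. -/
def atomCount {n : ℕ} (σ : List (Transition n)) : ℕ :=
  (σ.map fun t => t.guard.length).sum

end TimedIteration

/-!
A run of `σ` is described by difference variables: for a clock `x`, its value minus the elapsed
time, and for the reference clock, minus the elapsed time. A delay only changes the reference
variable, and a reset copies it. In these variables a transformation graph is a system of difference
constraints between its columns, and `G^{2^k}` describes the `2^k`-fold iteration of `σ`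
(`power_spec`). Since a closed matrix is determined by its solutions (`Closed.eq_of_sol_eq`),
`G ≍ H` says that the two relations have the same domain and the same image (`similar_iff`).

If the domain of the `K`-fold iteration equals that of the `2 K`-fold one, then infinite runs start
at each of its points (`exists_run_of_dom`, `zone_of_similar`). Conversely, suppose that an infinite
run exists. Delays beyond the largest constant can be shortened, so that the periods of the run have
bounded duration (`exists_bounded_run`). Domains and images are then stable after
`N ^ 2 + 2` iterations, where `N` is the number of clocks that are reset (`Cut.stable`), and
`2 ^ k > n ^ 2` implies `2 ^ k ≥ N ^ 2 + 2`, except that for `N = 1` two iterations suffice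
(`roundBound_add_two_le`).

For this bound, cut the sequence at a position where some clock `z` has just been reset. There, the
reference variable equals that of `z`, so that states at the cut are described by `N` variables, and
domains and images of the powers correspond to iterated preimages of a zone under a zone relation on
`ℝ ^ N`, or under the converse relation. Intersected with the image of the relation, these
preimages have canonical matrices `M 0, M 1, …`, where `M (t + 1)` arises from shortest paths that
stay in one column or make excursions through `M t` (`LayerRec`). The matrices decrease, and the
bounded run keeps them from decreasing for ever. The heart of the matter is that they are
constant from the index `N ^ 2` on (`LayerRec.stage_le_sq`).

An entry that improves from `t` to `t + 1` does so through an excursion whose entry improved one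
round before. If the last improvement of an entry could always be traced back in this way through
last improvements, the entries on the way would be distinct pairs of distinct vertices, and there
are only `N ^ 2 - N` of these. The tracing does work for the numerical parts of the weights. For the
weights themselves, it may stop at an excursion whose number has become final, but not its
strictness, because the new entry is strict already on the way to or from this excursion. Then
either the entries traced so far are distinct from those whose numbers enter into this excursion,
and the counting still works, or they form a loop with a strict step. Along such a loop, the way out
and the way back can be shifted against each other without loss (`retiming`); hence the strict step
is reached by a way out that visits every vertex at most once, which costs `N` further rounds
(`eq_of_strict_loop`).

The remaining parts are elementary. A sequence without positive lower bounds on clocks that are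
reset is iterated without delays or, in the presence of a guard `x > 0`, with ever shorter ones. The
implementation computes the values of the procedure because Floyd–Warshall's matrix is closed unless
it has a negative entry on the diagonal. The squaring loop ends after `O(log n)` rounds, each of
which costs `O(n ^ 3)`.
-/

namespace TimedIteration

/-! ### Weights as an ordered monoid -/

/-- The sum of weights; it shadows the componentwise addition of `WithTop (ℤ ×ₗ Bool)`. -/
instance instAddWeight : Add Weight := ⟨wadd⟩

/-- The neutral weight is `(≤, 0)`. -/
instance instZeroWeight : Zero Weight := ⟨wle 0⟩

theorem wadd_eq_add (a b : Weight) : wadd a b = a + b := rfl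

theorem wle_zero_eq : wle 0 = (0 : Weight) := rfl

/-- The finite weight with number `d` that is non-strict iff `s` holds. -/
def wmk (d : ℤ) (s : Bool) : Weight := ((toLex (d, s) : ℤ ×ₗ Bool) : Weight)

theorem wle_eq_wmk (d : ℤ) : wle d = wmk d true := rfl

theorem wlt_eq_wmk (d : ℤ) : wlt d = wmk d false := rfl

theorem weight_cases (a : Weight) : a = ⊤ ∨ ∃ d s, a = wmk d s := by
  induction a using WithTop.recTopCoe with
  | top => exact Or.inl rfl
  | coe a => exact Or.inr ⟨(ofLex a).1, (ofLex a).2, rfl⟩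

theorem wmk_ne_top (d : ℤ) (s : Bool) : wmk d s ≠ ⊤ := WithTop.coe_ne_top

theorem top_add_weight (a : Weight) : (⊤ : Weight) + a = ⊤ := rfl

theorem add_top_weight (a : Weight) : a + (⊤ : Weight) = ⊤ := by
  rcases weight_cases a with rfl | ⟨d, s, rfl⟩ <;> rfl

theorem wmk_add (d e : ℤ) (s r : Bool) : wmk d s + wmk e r = wmk (d + e) (s && r) := rfl

theorem wmk_le_wmk {d e : ℤ} {s r : Bool} :
    wmk d s ≤ wmk e r ↔ d < e ∨ d = e ∧ (s = true → r = true) := by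
  rw [wmk, wmk, WithTop.coe_le_coe, Prod.Lex.le_iff]
  cases s <;> cases r <;> simp

theorem wmk_lt_wmk {d e : ℤ} {s r : Bool} :
    wmk d s < wmk e r ↔ d < e ∨ d = e ∧ (s = false ∧ r = true) := by
  rw [wmk, wmk, WithTop.coe_lt_coe, Prod.Lex.lt_iff]
  cases s <;> cases r <;> simp

theorem wmk_inj {d e : ℤ} {s r : Bool} : wmk d s = wmk e r ↔ d = e ∧ s = r := by
  rw [wmk, wmk, WithTop.coe_eq_coe, toLex_inj, Prod.mk.injEq]

instance instAddCommMonoidWeight : AddCommMonoid Weight where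
  add := (· + ·)
  zero := 0
  nsmul := nsmulRec
  add_assoc a b c := by
    rcases weight_cases a with rfl | ⟨d, s, rfl⟩ <;>
      rcases weight_cases b with rfl | ⟨e, r, rfl⟩ <;>
      rcases weight_cases c with rfl | ⟨f, q, rfl⟩ <;>
      simp only [top_add_weight, add_top_weight, wmk_add, add_assoc, Bool.and_assoc]
  zero_add a := by
    change wmk 0 true + a = a
    rcases weight_cases a with rfl | ⟨d, s, rfl⟩
    · rfl
    · rw [wmk_add, zero_add, Bool.true_and]
  add_zero a := by
    change a + wmk 0 true = a
    rcases weight_cases a with rfl | ⟨d, s, rfl⟩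
    · rfl
    · rw [wmk_add, add_zero, Bool.and_true]
  add_comm a b := by
    rcases weight_cases a with rfl | ⟨d, s, rfl⟩ <;>
      rcases weight_cases b with rfl | ⟨e, r, rfl⟩ <;>
      simp only [top_add_weight, add_top_weight, wmk_add, add_comm, Bool.and_comm]

-- The weaker structures are declared separately, since instance search would otherwise find those
-- of the componentwise addition of `WithTop` first.
instance instAddSemigroupWeight : AddSemigroup Weight := instAddCommMonoidWeight.toAddSemigroup

instance instAddCommSemigroupWeight : AddCommSemigroup Weight :=
  instAddCommMonoidWeight.toAddCommSemigroup

instance instAddCommMagmaWeight : AddCommMagma Weight := instAddCommSemigroupWeight.toAddCommMagma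

instance instAddMonoidWeight : AddMonoid Weight := instAddCommMonoidWeight.toAddMonoid

instance instAddZeroClassWeight : AddZeroClass Weight := instAddMonoidWeight.toAddZeroClass

instance instIsOrderedAddMonoidWeight : IsOrderedAddMonoid Weight where
  add_le_add_left a b h c := by
    rcases weight_cases c with rfl | ⟨d, s, rfl⟩
    · simp only [add_top_weight, le_refl]
    rcases weight_cases b with rfl | ⟨e, r, rfl⟩
    · simp only [top_add_weight, le_top]
    rcases weight_cases a with rfl | ⟨f, q, rfl⟩
    · exact absurd (top_le_iff.1 h) (wmk_ne_top _ _)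
    rw [wmk_add, wmk_add, wmk_le_wmk]
    rw [wmk_le_wmk] at h
    rcases h with h | ⟨rfl, h⟩
    · left; omega
    · right; refine ⟨rfl, ?_⟩
      cases s <;> simp_all

/-- The numerical part of a weight. -/
def num : Weight → WithTop ℤ := WithTop.map fun a => (ofLex a).1

theorem num_top : num ⊤ = ⊤ := rfl

theorem num_wmk (d : ℤ) (s : Bool) : num (wmk d s) = (d : WithTop ℤ) := rfl

theorem num_zero : num 0 = 0 := rfl

theorem num_add (a b : Weight) : num (a + b) = num a + num b := by
  rcases weight_cases a with rfl | ⟨d, s, rfl⟩ <;> rcases weight_cases b with rfl | ⟨e, r, rfl⟩ <;>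
    simp only [top_add_weight, add_top_weight, wmk_add, num_top, num_wmk, WithTop.coe_add] <;> rfl

theorem num_mono {a b : Weight} (h : a ≤ b) : num a ≤ num b := by
  rcases weight_cases b with rfl | ⟨e, r, rfl⟩
  · exact le_top
  rcases weight_cases a with rfl | ⟨d, s, rfl⟩
  · exact absurd (top_le_iff.1 h) (wmk_ne_top _ _)
  rw [num_wmk, num_wmk, WithTop.coe_le_coe]
  rw [wmk_le_wmk] at h
  omega

theorem num_eq_top {a : Weight} : num a = ⊤ ↔ a = ⊤ := by
  rcases weight_cases a with rfl | ⟨d, s, rfl⟩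
  · exact iff_of_true rfl rfl
  · exact iff_of_false WithTop.coe_ne_top (wmk_ne_top _ _)

/-- The weight is of the form `(<, d)`. -/
def IsStrict (a : Weight) : Prop := ∃ d, a = wmk d false

theorem isStrict_wmk {d : ℤ} {s : Bool} : IsStrict (wmk d s) ↔ s = false := by
  constructor
  · rintro ⟨e, h⟩
    exact (wmk_inj.1 h).2
  · rintro rfl
    exact ⟨d, rfl⟩

theorem isStrict_add {a b : Weight} (ha : a ≠ ⊤) (hb : b ≠ ⊤) :
    IsStrict (a + b) ↔ IsStrict a ∨ IsStrict b := by
  rcases weight_cases a with rfl | ⟨d, s, rfl⟩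
  · exact absurd rfl ha
  rcases weight_cases b with rfl | ⟨e, r, rfl⟩
  · exact absurd rfl hb
  rw [wmk_add, isStrict_wmk, isStrict_wmk, isStrict_wmk]
  cases s <;> cases r <;> simp

/-- A weight is determined by its number and its strictness; the strict one is the smaller. -/
theorem eq_of_le_of_num_eq {a b : Weight} (h : a ≤ b) (hn : num a = num b)
    (hs : IsStrict a → IsStrict b) : a = b := by
  rcases weight_cases a with rfl | ⟨d, s, rfl⟩
  · exact (top_le_iff.1 h).symm
  rcases weight_cases b with rfl | ⟨e, r, rfl⟩
  · exact absurd hn WithTop.coe_ne_top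
  rw [num_wmk, num_wmk, WithTop.coe_eq_coe] at hn
  subst hn
  rw [isStrict_wmk, isStrict_wmk] at hs
  rw [wmk_le_wmk] at h
  rw [wmk_inj]
  cases s <;> cases r <;> simp_all

/-- Tightening a strict weight without changing its number keeps it strict. -/
theorem isStrict_of_le {a b : Weight} (h : a ≤ b) (hn : num a = num b) (hb : IsStrict b) :
    IsStrict a := by
  obtain ⟨e, rfl⟩ := hb
  rcases weight_cases a with rfl | ⟨d, s, rfl⟩
  · exact absurd hn.symm WithTop.coe_ne_top
  rw [num_wmk, num_wmk, WithTop.coe_eq_coe] at hn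
  rw [wmk_le_wmk] at h
  rw [isStrict_wmk]
  cases s <;> simp_all

/-- With equal numbers, the smaller weight is the strict one. -/
theorem isStrict_of_lt {a b : Weight} (h : a < b) (hn : num a = num b) :
    IsStrict a ∧ ¬ IsStrict b := by
  rcases weight_cases a with rfl | ⟨d, s, rfl⟩
  · exact absurd h not_top_lt
  rcases weight_cases b with rfl | ⟨e, r, rfl⟩
  · exact absurd hn WithTop.coe_ne_top
  rw [num_wmk, num_wmk, WithTop.coe_eq_coe] at hn
  rw [wmk_lt_wmk] at h
  rw [isStrict_wmk, isStrict_wmk]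
  cases s <;> cases r <;> simp_all

theorem num_lt_of_lt_of_not_isStrict {a b : Weight} (h : a < b) (hs : ¬ IsStrict a) :
    num a < num b :=
  lt_of_le_of_ne (num_mono h.le) fun hn => hs (isStrict_of_lt h hn).1

/-! ### Satisfaction of difference constraints -/

theorem wsat_top (r : ℝ) : wsat r ⊤ := trivial

theorem wsat_wmk {r : ℝ} {d : ℤ} {s : Bool} :
    wsat r (wmk d s) ↔ if s then r ≤ d else r < d := Iff.rfl

theorem wsat_wle {r : ℝ} {d : ℤ} : wsat r (wle d) ↔ r ≤ d := by simp [wle_eq_wmk, wsat_wmk]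

theorem wsat_wlt {r : ℝ} {d : ℤ} : wsat r (wlt d) ↔ r < d := by simp [wlt_eq_wmk, wsat_wmk]

theorem wsat_zero {r : ℝ} : wsat r 0 ↔ r ≤ 0 := by
  rw [← wle_zero_eq, wsat_wle, Int.cast_zero]

theorem wsat_mono {r : ℝ} {a b : Weight} (h : a ≤ b) (hr : wsat r a) : wsat r b := by
  rcases weight_cases b with rfl | ⟨e, q, rfl⟩
  · trivial
  rcases weight_cases a with rfl | ⟨d, s, rfl⟩
  · exact absurd (top_le_iff.1 h) (wmk_ne_top _ _)
  rw [wmk_le_wmk] at h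
  rw [wsat_wmk] at *
  rcases h with h | ⟨rfl, h⟩
  · have : (d : ℝ) < e := by exact_mod_cast h
    cases s <;> cases q <;>
      simp only [Bool.false_eq_true, if_true, if_false] at hr ⊢ <;> linarith
  · cases s <;> cases q <;>
      simp only [Bool.false_eq_true, if_true, if_false] at hr h ⊢ <;> first | linarith | simp at h

theorem wsat_add {r q : ℝ} {a b : Weight} (hr : wsat r a) (hq : wsat q b) :
    wsat (r + q) (a + b) := by
  rcases weight_cases a with rfl | ⟨d, s, rfl⟩
  · trivial
  rcases weight_cases b with rfl | ⟨e, t, rfl⟩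
  · rw [add_top_weight]; trivial
  rw [wmk_add]
  rw [wsat_wmk] at *
  push_cast
  cases s <;> cases t <;> simp at * <;> linarith

theorem wsat_min {r : ℝ} {a b : Weight} : wsat r (min a b) ↔ wsat r a ∧ wsat r b := by
  constructor
  · intro h
    exact ⟨wsat_mono (min_le_left _ _) h, wsat_mono (min_le_right _ _) h⟩
  · rintro ⟨h, h'⟩
    rcases min_choice a b with e | e <;> rw [e] <;> assumption

/-- A weight is at least `(≤, 0)` as soon as it is satisfied by `0`. -/
theorem zero_le_of_wsat {a : Weight} (h : wsat 0 a) : 0 ≤ a := by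
  rcases weight_cases a with rfl | ⟨d, s, rfl⟩
  · exact le_top
  change wmk 0 true ≤ _
  rw [wmk_le_wmk]
  rw [wsat_wmk] at h
  cases s
  · left; simpa using h
  · have : (0 : ℤ) ≤ d := by simpa using h
    rcases this.lt_or_eq with h | h
    · exact Or.inl h
    · exact Or.inr ⟨h, fun h => h⟩

/-- If every difference between `-b` and `a` satisfies `a'`, then `a ≤ a'`. -/
theorem le_of_forall_wsat {a b a' : Weight} (hab : 0 ≤ a + b)
    (h : ∀ r, wsat r a → wsat (-r) b → wsat r a') : a ≤ a' := by
  rcases weight_cases a' with rfl | ⟨d', s', rfl⟩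
  · exact le_top
  by_contra hlt
  rw [not_le] at hlt
  rcases weight_cases b with rfl | ⟨e, t, rfl⟩
  · -- without a lower bound, a large value (at most `a`) violates `a'`
    rcases weight_cases a with rfl | ⟨d, s, rfl⟩
    · have := h (d' + 1) trivial trivial
      rw [wsat_wmk] at this
      cases s' <;> simp at this <;> linarith
    · rw [wmk_lt_wmk] at hlt
      rcases hlt with hlt | ⟨rfl, rfl, rfl⟩
      · have hlt' : (d' : ℝ) < d := by exact_mod_cast hlt
        have := h ((d' + d) / 2) (by rw [wsat_wmk]; cases s <;> simp <;> linarith) trivial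
        rw [wsat_wmk] at this
        cases s' <;> simp at this <;> linarith
      · have := h d' (by rw [wsat_wmk]; simp) trivial
        rw [wsat_wmk] at this
        simp at this
  · rcases weight_cases a with rfl | ⟨d, s, rfl⟩
    · have := h (max (d' + 1) (-e + 1)) trivial (by
        rw [wsat_wmk]
        have := le_max_right (d' + 1 : ℝ) (-e + 1)
        cases t <;> simp only [Bool.false_eq_true, if_true, if_false] <;> linarith)
      rw [wsat_wmk] at this
      have h1 := le_max_left (d' + 1 : ℝ) (-e + 1)
      cases s' <;> simp only [Bool.false_eq_true, if_true, if_false] at this <;> linarith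
    · change wmk 0 true ≤ _ at hab
      rw [wmk_add, wmk_le_wmk] at hab
      rw [wmk_lt_wmk] at hlt
      rcases hlt with hlt | ⟨rfl, rfl, rfl⟩
      · have hlt' : (d' : ℝ) < d := by exact_mod_cast hlt
        rcases hab with hab | ⟨hab, hst⟩
        · have hab' : (0 : ℝ) < d + e := by exact_mod_cast hab
          have := h ((max (d' : ℝ) (-e) + d) / 2) (by
            have : max (d' : ℝ) (-e) < d := max_lt hlt' (by linarith)
            rw [wsat_wmk]
            cases s <;> simp only [Bool.false_eq_true, if_true, if_false] <;> linarith) (by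
            have h1 := le_max_right (d' : ℝ) (-e)
            rw [wsat_wmk]
            cases t <;> simp only [Bool.false_eq_true, if_true, if_false] <;> linarith)
          have h1 := le_max_left (d' : ℝ) (-e)
          rw [wsat_wmk] at this
          cases s' <;> simp only [Bool.false_eq_true, if_true, if_false] at this <;> linarith
        · have hab' : (0 : ℝ) = d + e := by exact_mod_cast hab
          have hst' := hst rfl
          rw [Bool.and_eq_true] at hst'
          obtain ⟨rfl, rfl⟩ := hst'
          have := h d (by rw [wsat_wmk]; simp) (by rw [wsat_wmk]; simp; linarith)
          rw [wsat_wmk] at this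
          cases s' <;> simp only [Bool.false_eq_true, if_true, if_false] at this <;> linarith
      · rcases hab with hab | ⟨hab, hst⟩
        · have hab' : (0 : ℝ) < d' + e := by exact_mod_cast hab
          have := h d' (by rw [wsat_wmk]; simp) (by
            rw [wsat_wmk]
            cases t <;> simp only [Bool.false_eq_true, if_true, if_false] <;> linarith)
          rw [wsat_wmk] at this
          simp at this
        · have hab' : (0 : ℝ) = d' + e := by exact_mod_cast hab
          have hst' := hst rfl
          rw [Bool.true_and] at hst'
          subst hst'
          have := h d' (by rw [wsat_wmk]; simp) (by rw [wsat_wmk]; simp; linarith)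
          rw [wsat_wmk] at this
          simp at this

/-! ### Shortest paths -/

/-- A matrix that equals its own shortest path matrix. -/
structure Closed {V α : Type} [AddCommMonoid α] [LE α] (W : V → V → α) : Prop where
  diag : ∀ u, W u u = 0
  tri : ∀ u v w, W u w ≤ W u v + W v w

theorem Closed.comap {V U α : Type} [AddCommMonoid α] [LE α] {W : V → V → α} (h : Closed W)
    (f : U → V) : Closed fun a b => W (f a) (f b) :=
  ⟨fun _ => h.diag _, fun _ _ _ => h.tri _ _ _⟩

theorem Closed.le_walkWeight {V : Type} {W G : V → V → Weight} (h : Closed W)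
    (hG : ∀ u v, W u v ≤ G u v) (l : List V) (u v : V) : W u v ≤ walkWeight G u l v := by
  induction l generalizing u with
  | nil => exact hG u v
  | cons w l ih => exact (h.tri u w v).trans (add_le_add (hG u w) (ih w))

theorem walkWeight_append {V : Type} (G : V → V → Weight) (l l' : List V) (u v w : V) :
    walkWeight G u (l ++ v :: l') w = walkWeight G u l v + walkWeight G v l' w := by
  induction l generalizing u with
  | nil => rfl
  | cons x l ih =>
    change G u x + walkWeight G x (l ++ v :: l') w = (G u x + walkWeight G x l v) + _
    rw [ih, add_assoc]

theorem pathWeights_add {V : Type} {G : V → V → Weight} {u v w : V} {a b : Weight}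
    (ha : a ∈ pathWeights G u v) (hb : b ∈ pathWeights G v w) : a + b ∈ pathWeights G u w := by
  rcases ha with ⟨rfl, rfl⟩ | ⟨l, rfl⟩
  · rwa [wle_zero_eq, zero_add]
  rcases hb with ⟨rfl, rfl⟩ | ⟨l', rfl⟩
  · rw [wle_zero_eq, add_zero]
    exact Or.inr ⟨l, rfl⟩
  · exact Or.inr ⟨_, (walkWeight_append G l l' u v w).symm⟩

/-- One round of Floyd–Warshall's algorithm: paths through the vertex `k`. -/
def relax {V : Type} (D : V → V → Weight) (k : V) : V → V → Weight :=
  fun u v => min (D u v) (D u k + D k v)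

/-- The initial matrix of Floyd–Warshall's algorithm. -/
def withDiag {V : Type} [DecidableEq V] (G : V → V → Weight) : V → V → Weight :=
  fun u v => if u = v then min (G u v) 0 else G u v

theorem foldl_relax_le {V : Type} (l : List V) (D : V → V → Weight) (u v : V) :
    l.foldl relax D u v ≤ D u v := by
  induction l generalizing D with
  | nil => exact le_rfl
  | cons k l ih => exact (ih _).trans (min_le_left _ _)

/-- Every entry of the matrices of Floyd–Warshall's algorithm is the weight of some path. -/
theorem foldl_relax_mem_pathWeights {V : Type} {G : V → V → Weight} (l : List V)
    {D : V → V → Weight} (hD : ∀ u v, D u v ∈ pathWeights G u v) (u v : V) :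
    l.foldl relax D u v ∈ pathWeights G u v := by
  induction l generalizing D with
  | nil => exact hD u v
  | cons k l ih =>
    refine ih fun u v => ?_
    rcases min_choice (D u v) (D u k + D k v) with e | e
    · rw [relax, e]; exact hD u v
    · rw [relax, e]; exact pathWeights_add (hD u k) (hD k v)

theorem withDiag_mem_pathWeights {V : Type} [DecidableEq V] (G : V → V → Weight) (u v : V) :
    withDiag G u v ∈ pathWeights G u v := by
  rw [withDiag]
  split_ifs with h
  · rcases min_choice (G u v) 0 with e | e
    · rw [e]; exact Or.inr ⟨[], rfl⟩
    · rw [e]; exact Or.inl ⟨h, rfl⟩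
  · exact Or.inr ⟨[], rfl⟩

/-- If the final diagonal is nonnegative, then after the rounds for the vertices in `l` the triangle
inequality holds for all intermediate vertices in `l` (and those in `S` treated before). -/
theorem foldl_relax_tri {V : Type} (l : List V) {D : V → V → Weight} {S : Set V}
    (hS : ∀ w ∈ S, ∀ u v, D u v ≤ D u w + D w v)
    (hpos : ∀ u, 0 ≤ l.foldl relax D u u) (w : V) (hw : w ∈ S ∨ w ∈ l) (u v : V) :
    l.foldl relax D u v ≤ l.foldl relax D u w + l.foldl relax D w v := by
  induction l generalizing D S with
  | nil => exact hS w (by simpa using hw) u v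
  | cons k l ih =>
    have hk : 0 ≤ D k k := (hpos k).trans (foldl_relax_le (k :: l) D k k)
    refine ih (D := relax D k) (S := insert k S) ?_ hpos ?_
    · have huk : ∀ u, relax D k u k = D u k := fun u =>
        min_eq_left (le_add_of_nonneg_right hk)
      have hkv : ∀ v, relax D k k v = D k v := fun v =>
        min_eq_left (le_add_of_nonneg_left hk)
      rintro w (rfl | hw) u v
      · rw [huk, hkv]
        exact min_le_right _ _
      · have h1 := hS w hw u v
        have h2 := hS w hw u k
        have h3 := hS w hw k v
        have h4 := hS w hw k k
        rcases min_choice (D u w) (D u k + D k w) with e | e <;>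
          rcases min_choice (D w v) (D w k + D k v) with e' | e' <;>
          rw [relax, relax, relax, e, e']
        · exact (min_le_left _ _).trans h1
        · refine (min_le_right _ _).trans ?_
          rw [← add_assoc]
          exact add_le_add h2 le_rfl
        · refine (min_le_right _ _).trans ?_
          rw [add_assoc]
          exact add_le_add le_rfl h3
        · refine (min_le_right _ _).trans ?_
          calc D u k + D k v ≤ D u k + D k v + D k k := le_add_of_nonneg_right hk
            _ ≤ D u k + D k v + (D k w + D w k) := add_le_add le_rfl h4
            _ = _ := by abel
    · rcases hw with hw | hw
      · exact Or.inl (Or.inr hw)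
      · rcases List.mem_cons.1 hw with rfl | hw
        · exact Or.inl (Or.inl rfl)
        · exact Or.inr hw

/-- A negative entry on the final diagonal of Floyd–Warshall's algorithm reveals a negative
cycle. -/
theorem hasNegativeCycle_of_foldl_relax {V : Type} [DecidableEq V] {G : V → V → Weight}
    {l : List V} {u : V} (h : l.foldl relax (withDiag G) u u < 0) : HasNegativeCycle G := by
  rcases foldl_relax_mem_pathWeights l (withDiag_mem_pathWeights G) u u with ⟨-, e⟩ | ⟨l', e⟩
  · rw [e] at h
    exact absurd h (lt_irrefl _)
  · exact ⟨u, l', e ▸ h⟩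

/-- Floyd–Warshall's algorithm computes shortest paths unless it detects a negative cycle. -/
theorem closed_foldl_relax {V : Type} [DecidableEq V] {G : V → V → Weight}
    {l : List V} (hl : ∀ u, u ∈ l) (hpos : ∀ u, 0 ≤ l.foldl relax (withDiag G) u u) :
    Closed (l.foldl relax (withDiag G)) where
  diag u := le_antisymm ((foldl_relax_le l _ u u).trans (by rw [withDiag, if_pos rfl]; simp))
    (hpos u)
  tri u v w := foldl_relax_tri l (S := ∅) (by simp) hpos v (Or.inr (hl v)) u w

theorem foldl_relax_withDiag_le {V : Type} [DecidableEq V] (G : V → V → Weight) (l : List V)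
    (u v : V) : l.foldl relax (withDiag G) u v ≤ G u v :=
  (foldl_relax_le l _ u v).trans (by rw [withDiag]; split_ifs <;> simp)

theorem isLeast_pathWeights {V : Type} {G W : V → V → Weight} (hW : Closed W)
    (hG : ∀ u v, W u v ≤ G u v) (hm : ∀ u v, W u v ∈ pathWeights G u v) (u v : V) :
    IsLeast (pathWeights G u v) (W u v) := by
  refine ⟨hm u v, ?_⟩
  rintro w (⟨rfl, rfl⟩ | ⟨l, rfl⟩)
  · rw [hW.diag]; exact le_rfl
  · exact hW.le_walkWeight hG l u v

theorem canon_eq_of_closed {V : Type} {G W : V → V → Weight} (hW : Closed W)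
    (hG : ∀ u v, W u v ≤ G u v) (hm : ∀ u v, W u v ∈ pathWeights G u v) : canon G = W := by
  funext u v
  have h := isLeast_pathWeights hW hG hm u v
  have hex : ∃ w, IsLeast (pathWeights G u v) w := ⟨_, h⟩
  rw [canon, dif_pos hex]
  exact hex.choose_spec.unique h

theorem not_hasNegativeCycle_of_closed {V : Type} {G W : V → V → Weight} (hW : Closed W)
    (hG : ∀ u v, W u v ≤ G u v) : ¬ HasNegativeCycle G := by
  rintro ⟨u, l, h⟩
  have := hW.le_walkWeight hG l u u
  rw [hW.diag] at this
  exact absurd (this.trans_lt h) (lt_irrefl _)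

theorem canon_eq_foldl_relax {V : Type} [DecidableEq V] {G : V → V → Weight}
    {l : List V} (hl : ∀ u, u ∈ l) (hpos : ∀ u, 0 ≤ l.foldl relax (withDiag G) u u) :
    canon G = l.foldl relax (withDiag G) :=
  canon_eq_of_closed (closed_foldl_relax hl hpos) (foldl_relax_withDiag_le G l)
    (foldl_relax_mem_pathWeights l (withDiag_mem_pathWeights G))

theorem hasNegativeCycle_iff {V : Type} [DecidableEq V] {G : V → V → Weight}
    {l : List V} (hl : ∀ u, u ∈ l) :
    HasNegativeCycle G ↔ ∃ u, l.foldl relax (withDiag G) u u < 0 := by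
  refine ⟨fun h => ?_, fun ⟨u, h⟩ => hasNegativeCycle_of_foldl_relax h⟩
  by_contra hn
  push Not at hn
  exact not_hasNegativeCycle_of_closed (closed_foldl_relax hl hn) (foldl_relax_withDiag_le G l) h

/-- In a finite graph without negative cycles, the canonical form is closed, and its entries are
weights of paths. -/
theorem canon_spec {V : Type} [Fintype V] {G : V → V → Weight} (h : ¬ HasNegativeCycle G) :
    Closed (canon G) ∧ (∀ u v, canon G u v ≤ G u v) ∧
      ∀ u v, canon G u v ∈ pathWeights G u v := by
  classical
  have hl : ∀ u : V, u ∈ Finset.univ.toList := fun u => by simp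
  rw [hasNegativeCycle_iff hl] at h
  push Not at h
  rw [canon_eq_foldl_relax hl h]
  exact ⟨closed_foldl_relax hl h, foldl_relax_withDiag_le G _,
    foldl_relax_mem_pathWeights _ (withDiag_mem_pathWeights G)⟩

/-! ### Solutions of difference constraints -/

/-- The real vectors that satisfy all difference constraints of a graph. -/
def Sol {V : Type} (G : V → V → Weight) : Set (V → ℝ) :=
  {p | ∀ u v, wsat (p v - p u) (G u v)}

theorem wsat_walkWeight {V : Type} {G : V → V → Weight} {p : V → ℝ} (hp : p ∈ Sol G)
    (l : List V) (u v : V) : wsat (p v - p u) (walkWeight G u l v) := by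
  induction l generalizing u with
  | nil => exact hp u v
  | cons w l ih =>
    have := wsat_add (hp u w) (ih w)
    rwa [show p w - p u + (p v - p w) = p v - p u by ring] at this

theorem not_hasNegativeCycle_of_mem_sol {V : Type} {G : V → V → Weight} {p : V → ℝ}
    (hp : p ∈ Sol G) : ¬ HasNegativeCycle G := by
  rintro ⟨u, l, h⟩
  have := wsat_walkWeight hp l u u
  rw [sub_self] at this
  exact absurd (zero_le_of_wsat this) (not_le.2 h)

/-- Shortest paths only add consequences of the constraints. -/
theorem sol_canon {V : Type} [Fintype V] {G : V → V → Weight} (h : ¬ HasNegativeCycle G) :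
    Sol (canon G) = Sol G := by
  obtain ⟨-, hG, hm⟩ := canon_spec h
  refine Set.Subset.antisymm (fun p hp u v => wsat_mono (hG u v) (hp u v)) fun p hp u v => ?_
  rcases hm u v with ⟨rfl, e⟩ | ⟨l, e⟩
  · rw [e, sub_self, wsat_wle]
    simp
  · rw [e]
    exact wsat_walkWeight hp l u v

theorem convex_wsat (a : Weight) : Convex ℝ {r | wsat r a} := by
  rcases weight_cases a with rfl | ⟨d, s, rfl⟩
  · exact convex_univ
  · cases s
    · have e : {r | wsat r (wmk d false)} = Set.Iio (d : ℝ) := by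
        ext r
        simp only [wsat_wmk, Bool.false_eq_true, if_false, Set.mem_Iio]
        rfl
      rw [e]
      exact convex_Iio (d : ℝ)
    · have e : {r | wsat r (wmk d true)} = Set.Iic (d : ℝ) := by
        ext r
        simp only [wsat_wmk, if_true, Set.mem_Iic]
        rfl
      rw [e]
      exact convex_Iic (d : ℝ)

/-- A constraint on a difference is met by all sufficiently small numbers. -/
theorem exists_wsat (a : Weight) : ∃ r₀ : ℝ, ∀ r ≤ r₀, wsat r a := by
  rcases weight_cases a with rfl | ⟨d, s, rfl⟩
  · exact ⟨0, fun _ _ => trivial⟩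
  · refine ⟨d - 1, fun r hr => ?_⟩
    rw [wsat_wmk]
    cases s <;> simp only [Bool.false_eq_true, if_true, if_false] <;> linarith

/-- A solution on a set of vertices of a closed matrix extends to one more vertex. By Helly's
theorem on the line, only pairs of constraints on the new value have to be compatible. -/
theorem Closed.exists_extension {V : Type} {W : V → V → Weight} (hW : Closed W)
    (s : Finset V) {p : V → ℝ} (hp : ∀ u ∈ s, ∀ v ∈ s, wsat (p v - p u) (W u v)) (x : V) :
    ∃ r, ∀ u ∈ s, wsat (r - p u) (W u x) ∧ wsat (p u - r) (W x u) := by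
  classical
  let F : V × Bool → Set ℝ := fun i =>
    if i.2 then {r | wsat (r - p i.1) (W i.1 x)} else {r | wsat (p i.1 - r) (W x i.1)}
  have hconv : ∀ i ∈ s ×ˢ (Finset.univ : Finset Bool), Convex ℝ (F i) := by
    rintro ⟨u, b⟩ -
    cases b
    · have := (convex_wsat (W x u)).affine_preimage
        (AffineMap.const ℝ ℝ (p u) - AffineMap.id ℝ ℝ)
      simpa [F] using this
    · have := (convex_wsat (W u x)).affine_preimage
        (AffineMap.id ℝ ℝ - AffineMap.const ℝ ℝ (p u))
      simpa [F] using this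
  have hlow : ∀ i, i ∈ s ×ˢ (Finset.univ : Finset Bool) → ∀ j,
      j ∈ s ×ˢ (Finset.univ : Finset Bool) → (F i ∩ F j).Nonempty := by
    rintro ⟨u, b⟩ hu ⟨v, c⟩ hv
    have hu' : u ∈ s := by simpa using hu
    have hv' : v ∈ s := by simpa using hv
    have key : ∀ u ∈ s, ∀ v ∈ s, ∃ r, wsat (r - p u) (W u x) ∧ wsat (p v - r) (W x v) := by
      intro u hu v hv
      by_contra hn
      push Not at hn
      rcases weight_cases (W u x) with e | ⟨d, q, e⟩
      · obtain ⟨r₀, hr₀⟩ := exists_wsat (W x v)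
        exact hn (p v - r₀) (by rw [e]; trivial) (hr₀ _ (by linarith))
      rcases weight_cases (W x v) with e' | ⟨d', q', e'⟩
      · obtain ⟨r₀, hr₀⟩ := exists_wsat (W u x)
        exact hn (p u + r₀) (hr₀ _ (by linarith)) (by rw [e']; trivial)
      have h1 := wsat_mono (hW.tri u x v) (hp u hu v hv)
      rw [e, e', wmk_add, wsat_wmk] at h1
      push_cast at h1
      simp only [e, e', wsat_wmk] at hn
      have h2 := hn (p u + d)
      have h3 := hn (p v - d')
      have h4 := hn ((p u + d + (p v - d')) / 2)
      cases q <;> cases q' <;>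
        simp only [Bool.false_eq_true, if_true, if_false, Bool.and_true, Bool.and_false]
          at h1 h2 h3 h4
      · exact h4 (by linarith) (by linarith)
      · exact h3 (by linarith) (by linarith)
      · exact h2 (by linarith) (by linarith)
      · exact h2 (by linarith) (by linarith)
    cases b <;> cases c
    · obtain ⟨r₁, h₁⟩ := exists_wsat (W x u)
      obtain ⟨r₂, h₂⟩ := exists_wsat (W x v)
      refine ⟨max (p u - r₁) (p v - r₂), ?_, ?_⟩
      · exact h₁ _ (by linarith [le_max_left (p u - r₁) (p v - r₂)])
      · exact h₂ _ (by linarith [le_max_right (p u - r₁) (p v - r₂)])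
    · obtain ⟨r, h₁, h₂⟩ := key v hv' u hu'
      exact ⟨r, h₂, h₁⟩
    · obtain ⟨r, h₁, h₂⟩ := key u hu' v hv'
      exact ⟨r, h₁, h₂⟩
    · obtain ⟨r₁, h₁⟩ := exists_wsat (W u x)
      obtain ⟨r₂, h₂⟩ := exists_wsat (W v x)
      refine ⟨min (p u + r₁) (p v + r₂), ?_, ?_⟩
      · exact h₁ _ (by linarith [min_le_left (p u + r₁) (p v + r₂)])
      · exact h₂ _ (by linarith [min_le_right (p u + r₁) (p v + r₂)])
  obtain ⟨r, hr⟩ := Convex.helly_theorem' (𝕜 := ℝ) hconv (by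
    intro I hI hc
    rw [Module.finrank_self] at hc
    obtain h | h | h : I.card = 0 ∨ I.card = 1 ∨ I.card = 2 := by omega
    · rw [Finset.card_eq_zero] at h
      simp [h]
    · obtain ⟨i, rfl⟩ := Finset.card_eq_one.1 h
      obtain ⟨r, h1, -⟩ := hlow i (hI (by simp)) i (hI (by simp))
      exact ⟨r, by simpa using h1⟩
    · obtain ⟨i, j, -, rfl⟩ := Finset.card_eq_two.1 h
      obtain ⟨r, h1, h2⟩ := hlow i (hI (by simp)) j (hI (by simp))
      exact ⟨r, by simp [h1, h2]⟩)
  refine ⟨r, fun u hu => ?_⟩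
  have hr' := Set.mem_iInter₂.1 hr
  have h1 := hr' (u, true) (by simpa using hu)
  have h2 := hr' (u, false) (by simpa using hu)
  exact ⟨h1, h2⟩

/-- A partial solution of a closed matrix extends to a solution, vertex by vertex. -/
theorem Closed.exists_sol_extension {V : Type} [Fintype V] {W : V → V → Weight} (hW : Closed W)
    (s : Finset V) {p : V → ℝ} (hp : ∀ u ∈ s, ∀ v ∈ s, wsat (p v - p u) (W u v)) :
    ∃ q ∈ Sol W, ∀ u ∈ s, q u = p u := by
  classical
  suffices h : ∀ t : Finset V, ∃ q : V → ℝ, (∀ u ∈ s ∪ t, ∀ v ∈ s ∪ t, wsat (q v - q u) (W u v)) ∧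
      ∀ u ∈ s, q u = p u by
    obtain ⟨q, h1, h2⟩ := h Finset.univ
    exact ⟨q, fun u v => h1 u (by simp) v (by simp), h2⟩
  intro t
  induction t using Finset.induction_on with
  | empty => exact ⟨p, by simpa using hp, fun _ _ => rfl⟩
  | insert x t hx ih =>
    obtain ⟨q, h1, h2⟩ := ih
    by_cases hxs : x ∈ s
    · exact ⟨q, by rwa [Finset.union_insert, Finset.insert_eq_of_mem (by simp [hxs])], h2⟩
    obtain ⟨r, hr⟩ := hW.exists_extension (s ∪ t) h1 x
    refine ⟨Function.update q x r, ?_, fun u hu => ?_⟩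
    · have hx' : x ∉ s ∪ t := by simp [hx, hxs]
      intro u hu v hv
      rw [Finset.union_insert, Finset.mem_insert] at hu hv
      rcases hu with rfl | hu <;> rcases hv with rfl | hv
      · rw [hW.diag, sub_self, wsat_zero]
      · rw [Function.update_self, Function.update_of_ne (ne_of_mem_of_not_mem hv hx')]
        exact (hr v hv).2
      · rw [Function.update_self, Function.update_of_ne (ne_of_mem_of_not_mem hu hx')]
        exact (hr u hu).1
      · rw [Function.update_of_ne (ne_of_mem_of_not_mem hu hx'),
          Function.update_of_ne (ne_of_mem_of_not_mem hv hx')]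
        exact h1 u hu v hv
    · rw [Function.update_of_ne (ne_of_mem_of_not_mem hu hxs), h2 u hu]

/-- The entries of a closed matrix are the tightest difference bounds of its solutions. -/
theorem Closed.le_of_sol_subset {V : Type} [Fintype V] {W W' : V → V → Weight} (hW : Closed W)
    (hW' : ∀ u, 0 ≤ W' u u) (h : Sol W ⊆ Sol W') (u v : V) : W u v ≤ W' u v := by
  classical
  by_cases huv : u = v
  · subst huv
    rw [hW.diag]
    exact hW' u
  refine le_of_forall_wsat (b := W v u) (by rw [← hW.diag u]; exact hW.tri u v u)
    fun r hr hr' => ?_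
  obtain ⟨q, hq, hqe⟩ := hW.exists_sol_extension {u, v} (p := fun x => if x = u then 0 else r) (by
    intro a ha b hb
    simp only [Finset.mem_insert, Finset.mem_singleton] at ha hb
    rcases ha with rfl | rfl <;> rcases hb with rfl | rfl
    · rw [hW.diag, sub_self, wsat_zero]
    · simpa [Ne.symm huv] using hr
    · simpa [Ne.symm huv] using hr'
    · rw [hW.diag, sub_self, wsat_zero])
  have := h hq u v
  rw [hqe u (by simp), hqe v (by simp)] at this
  simpa [Ne.symm huv] using this

/-- A closed matrix is determined by its solutions. -/
theorem Closed.eq_of_sol_eq {V : Type} [Fintype V] {W W' : V → V → Weight} (hW : Closed W)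
    (hW' : Closed W') (h : Sol W = Sol W') : W = W' := by
  funext u v
  exact le_antisymm (hW.le_of_sol_subset (fun u => (hW'.diag u).ge) h.subset u v)
    (hW'.le_of_sol_subset (fun u => (hW.diag u).ge) h.superset u v)

theorem Closed.sol_nonempty {V : Type} [Fintype V] {W : V → V → Weight} (hW : Closed W) :
    (Sol W).Nonempty :=
  let ⟨q, hq, _⟩ := hW.exists_sol_extension ∅ (p := fun _ => 0) (by simp)
  ⟨q, hq⟩

theorem hasNegativeCycle_iff_sol_eq_empty {V : Type} [Fintype V] {G : V → V → Weight} :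
    HasNegativeCycle G ↔ Sol G = ∅ := by
  constructor
  · intro h
    rw [Set.eq_empty_iff_forall_notMem]
    exact fun p hp => not_hasNegativeCycle_of_mem_sol hp h
  · intro h
    by_contra hn
    have := (canon_spec hn).1.sol_nonempty
    rw [sol_canon hn, h] at this
    exact Set.not_nonempty_empty this

/-- The solutions of a pullback of a closed matrix are the restrictions of its solutions. -/
theorem Closed.sol_comap {V U : Type} [Fintype V] [Fintype U] {W : V → V → Weight}
    (hW : Closed W) (f : U → V) :
    Sol (fun a b => W (f a) (f b)) = {p | ∃ q ∈ Sol W, ∀ a, p a = q (f a)} := by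
  classical
  ext p
  constructor
  · intro hp
    -- vertices with the same image have the same value, so `p` factors through `f`
    have hfac : ∀ a b, f a = f b → p a = p b := by
      intro a b hab
      have h1 := hp a b
      have h2 := hp b a
      beta_reduce at h1 h2
      rw [hab, hW.diag, wsat_zero] at h1 h2
      linarith
    let p' : V → ℝ := fun v => if h : ∃ a, f a = v then p h.choose else 0
    have hp' : ∀ a, p' (f a) = p a := by
      intro a
      have h : ∃ b, f b = f a := ⟨a, rfl⟩
      simp only [p', dif_pos h]
      exact hfac _ _ h.choose_spec
    obtain ⟨q, hq, he⟩ := hW.exists_sol_extension (Finset.univ.image f) (p := p') (by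
      intro u hu v hv
      obtain ⟨a, -, rfl⟩ := Finset.mem_image.1 hu
      obtain ⟨b, -, rfl⟩ := Finset.mem_image.1 hv
      rw [hp', hp']
      exact hp a b)
    exact ⟨q, hq, fun a => by rw [he _ (by simp), hp']⟩
  · rintro ⟨q, hq, he⟩ a b
    rw [he, he]
    exact hq _ _

/-- A nonempty projection of a set of solutions is described by a closed matrix. -/
theorem exists_closed_of_projection {V U : Type} [Fintype V] [Fintype U] {G : V → V → Weight}
    (hG : (Sol G).Nonempty) (f : U → V) :
    Closed (fun a b => canon G (f a) (f b)) ∧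
      Sol (fun a b => canon G (f a) (f b)) = {p | ∃ q ∈ Sol G, ∀ a, p a = q (f a)} := by
  obtain ⟨q, hq⟩ := hG
  have hn := not_hasNegativeCycle_of_mem_sol hq
  refine ⟨(canon_spec hn).1.comap f, ?_⟩
  rw [(canon_spec hn).1.sol_comap f, sol_canon hn]

/-! ### Excursions in a periodic graph -/

section Layers

variable {V α : Type}

/-- `Der K F B M a b w`: there is a walk of weight `w` from `a` to `b` that consists of edges of `K`
and of excursions, which go to the next column by an edge of `F`, use an edge of `M` there, and
come back by an edge of `B`. -/
inductive Der [AddCommMonoid α] (K F B M : V → V → α) : V → V → α → Prop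
  | nil (a : V) : Der K F B M a a 0
  | stat {a b : V} {w : α} (c : V) : Der K F B M a b w → Der K F B M a c (w + K b c)
  | exc {a b : V} {w : α} (c d e : V) :
      Der K F B M a b w → Der K F B M a e (w + (F b c + M c d + B d e))

/-- The shortest path matrices `M t` of a column with `t` further periods to its right: `M (t + 1)`
is obtained from the edges `K` within the column and from excursions through `M t`. -/
structure LayerRec [AddCommMonoid α] [LinearOrder α] (K F B : V → V → α) (M : ℕ → V → V → α) :
    Prop where
  closed : ∀ t, Closed (M t)
  anti : ∀ t a b, M (t + 1) a b ≤ M t a b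
  stat : ∀ t a b, M (t + 1) a b ≤ K a b
  exc : ∀ t a c d b, M (t + 1) a b ≤ F a c + M t c d + B d b
  attained : ∀ t a b, Der K F B (M t) a b (M (t + 1) a b)

variable [AddCommMonoid α] [LinearOrder α] [IsOrderedAddMonoid α]
  {K F B : V → V → α} {M : ℕ → V → V → α}

theorem LayerRec.le_of_der (h : LayerRec K F B M) {t : ℕ} {a b : V} {w : α}
    (hw : Der K F B (M t) a b w) : M (t + 1) a b ≤ w := by
  induction hw with
  | nil => exact ((h.closed _).diag _).le
  | stat c _ ih => exact ((h.closed _).tri _ _ _).trans (add_le_add ih (h.stat _ _ _))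
  | exc c d e _ ih => exact ((h.closed _).tri _ _ _).trans (add_le_add ih (h.exc _ _ _ _ _))

/-- A path through an excursion bounds the entry between its ends. -/
theorem LayerRec.exc_le (h : LayerRec K F B M) (t : ℕ) (a a' c d b' b : V) :
    M (t + 1) a b ≤ M (t + 1) a a' + (F a' c + M t c d + B d b') + M (t + 1) b' b :=
  ((h.closed _).tri a b' b).trans
    (add_le_add (((h.closed _).tri a a' b').trans (add_le_add le_rfl (h.exc _ _ _ _ _))) le_rfl)

/-- An entry that improves does so through an excursion whose entry improved one round before. -/
theorem LayerRec.exists_improved (h : LayerRec K F B M) {t : ℕ} {a b : V}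
    (hlt : M (t + 2) a b < M (t + 1) a b) :
    ∃ a' c d b', M (t + 1) c d < M t c d ∧
      M (t + 2) a b = M (t + 2) a a' + (F a' c + M (t + 1) c d + B d b') + M (t + 2) b' b := by
  -- a walk whose excursions all use entries that did not improve was available one round before
  have key : ∀ {b : V} {w : α}, Der K F B (M (t + 1)) a b w → M (t + 1) a b ≤ w ∨
      ∃ a' c d b', M (t + 1) c d < M t c d ∧
        M (t + 2) a a' + (F a' c + M (t + 1) c d + B d b') + M (t + 2) b' b ≤ w := by
    intro b w hw
    induction hw with
    | nil => exact Or.inl ((h.closed _).diag _).le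
    | @stat b w c _ ih =>
      rcases ih with ih | ⟨a', e, d, b', h1, h2⟩
      · exact Or.inl (((h.closed _).tri _ _ _).trans (add_le_add ih (h.stat _ _ _)))
      · refine Or.inr ⟨a', e, d, b', h1, ?_⟩
        refine (add_le_add le_rfl ((h.closed (t + 2)).tri b' b c)).trans ?_
        rw [← add_assoc]
        exact add_le_add h2 (h.stat _ _ _)
    | @exc b w c d e hd ih =>
      rcases ih with ih | ⟨a', e', d', b', h1, h2⟩
      · by_cases hcd : M (t + 1) c d < M t c d
        · refine Or.inr ⟨b, c, d, e, hcd, ?_⟩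
          rw [(h.closed _).diag, add_zero]
          exact add_le_add (h.le_of_der hd) le_rfl
        · rw [not_lt] at hcd
          refine Or.inl (((h.closed _).tri _ _ _).trans
            (add_le_add ih ((h.exc t b c d e).trans ?_)))
          exact add_le_add (add_le_add le_rfl hcd) le_rfl
      · refine Or.inr ⟨a', e', d', b', h1, ?_⟩
        refine (add_le_add le_rfl ((h.closed (t + 2)).tri b' b e)).trans ?_
        rw [← add_assoc]
        exact add_le_add h2 (h.exc _ _ _ _ _)
  rcases key (h.attained (t + 1) a b) with h1 | ⟨a', c, d, b', h1, h2⟩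
  · exact absurd hlt (not_lt.2 h1)
  · exact ⟨a', c, d, b', h1, le_antisymm (h.exc_le _ _ _ _ _ _ _) h2⟩

end Layers

/-! ### Stages at which entries become final -/

section Stages

variable {V α : Type} {M : ℕ → V → V → α}

/-- The first index at which the entry for `P` has the value that it has at `T`. -/
noncomputable def stage (M : ℕ → V → V → α) (T : ℕ) (P : V × V) : ℕ :=
  sInf {t | M t P.1 P.2 = M T P.1 P.2}

theorem stage_le {T t : ℕ} {P : V × V} (h : M t P.1 P.2 = M T P.1 P.2) : stage M T P ≤ t :=
  Nat.sInf_le h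

variable [LinearOrder α]

/-- The matrices decrease and do not change any more after the index `T`. -/
structure Settles (M : ℕ → V → V → α) (T : ℕ) : Prop where
  anti : ∀ t a b, M (t + 1) a b ≤ M t a b
  final : ∀ t, T ≤ t → M t = M T

theorem Settles.antitone {T : ℕ} (h : Settles M T) {s t : ℕ} (hst : s ≤ t) (a b : V) :
    M t a b ≤ M s a b :=
  antitone_nat_of_succ_le (f := fun t => M t a b) (fun t => h.anti t a b) hst

theorem Settles.final_le {T : ℕ} (h : Settles M T) (t : ℕ) (a b : V) : M T a b ≤ M t a b := by
  rw [← h.final (max t T) (le_max_right _ _)]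
  exact h.antitone (le_max_left _ _) a b

theorem Settles.eq_of_stage_le {T : ℕ} (h : Settles M T) {t : ℕ} {P : V × V}
    (ht : stage M T P ≤ t) : M t P.1 P.2 = M T P.1 P.2 := by
  have h0 : M (stage M T P) P.1 P.2 = M T P.1 P.2 :=
    Nat.sInf_mem (s := {t | M t P.1 P.2 = M T P.1 P.2}) ⟨T, rfl⟩
  exact le_antisymm ((h.antitone ht _ _).trans h0.le) (h.final_le _ _ _)

theorem Settles.lt_of_lt_stage {T : ℕ} (h : Settles M T) {t : ℕ} {P : V × V}
    (ht : t < stage M T P) : M T P.1 P.2 < M t P.1 P.2 :=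
  lt_of_le_of_ne (h.final_le _ _ _) fun e => absurd (stage_le e.symm) (not_le.2 ht)

theorem Settles.stage_eq {T : ℕ} (h : Settles M T) {t : ℕ} {P : V × V}
    (h1 : M (t + 1) P.1 P.2 = M T P.1 P.2) (h2 : M (t + 1) P.1 P.2 < M t P.1 P.2) :
    stage M T P = t + 1 := by
  refine le_antisymm (stage_le h1) ?_
  by_contra hlt
  rw [not_le] at hlt
  have := h.eq_of_stage_le (Nat.lt_succ_iff.1 hlt)
  rw [this, h1] at h2
  exact lt_irrefl _ h2

variable [AddCommMonoid α] {K F B : V → V → α}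

theorem stage_diag {T : ℕ} (hc : ∀ t, Closed (M t)) (a : V) : stage M T (a, a) = 0 :=
  Nat.le_zero.1 (stage_le (by rw [(hc _).diag, (hc _).diag]))

theorem ne_of_stage_pos {T : ℕ} (hc : ∀ t, Closed (M t)) {P : V × V} (h : 0 < stage M T P) :
    P.1 ≠ P.2 := by
  obtain ⟨a, b⟩ := P
  rintro (rfl : a = b)
  rw [stage_diag hc] at h
  exact lt_irrefl _ h

theorem LayerRec.final_le [IsOrderedAddMonoid α] (h : LayerRec K F B M) {T : ℕ} (hT : Settles M T)
    (a a' c d b' b : V) :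
    M T a b ≤ M T a a' + (F a' c + M T c d + B d b') + M T b' b := by
  have := h.exc_le T a a' c d b' b
  rwa [hT.final (T + 1) (Nat.le_succ T)] at this

end Stages

/-- If a finite sum is not larger than the sum of smaller terms, then these terms are equal. -/
theorem WithTop.eq_of_add_eq {x x' y y' q q' f g s : WithTop ℤ} (hs : s ≠ ⊤)
    (h : s = x + (f + q + g) + y) (h' : s ≤ x' + (f + q' + g) + y') (hx : x' ≤ x) (hq : q' ≤ q)
    (hy : y' ≤ y) : x' = x ∧ q' = q ∧ y' = y := by
  have hx1 : x ≠ ⊤ := by rintro rfl; simp at h; exact hs h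
  have hy1 : y ≠ ⊤ := by rintro rfl; simp at h; exact hs h
  have hq1 : q ≠ ⊤ := by rintro rfl; simp at h; exact hs h
  have hf1 : f ≠ ⊤ := by rintro rfl; simp at h; exact hs h
  have hg1 : g ≠ ⊤ := by rintro rfl; simp at h; exact hs h
  have hx2 := ne_top_of_le_ne_top hx1 hx
  have hy2 := ne_top_of_le_ne_top hy1 hy
  have hq2 := ne_top_of_le_ne_top hq1 hq
  lift x to ℤ using hx1
  lift y to ℤ using hy1
  lift q to ℤ using hq1
  lift f to ℤ using hf1
  lift g to ℤ using hg1
  lift x' to ℤ using hx2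
  lift y' to ℤ using hy2
  lift q' to ℤ using hq2
  subst h
  norm_cast at *
  omega

/-- The numerical part of a matrix of weights. -/
def nmat {V : Type} (W : V → V → Weight) : V → V → WithTop ℤ := fun a b => num (W a b)

theorem closed_nmat {V : Type} {W : V → V → Weight} (h : Closed W) : Closed (nmat W) where
  diag u := by rw [nmat, h.diag, num_zero]
  tri u v w := by
    rw [nmat, nmat, nmat, ← num_add]
    exact num_mono (h.tri u v w)

/-- The numerical parts of the weights satisfy the same recursion. -/
theorem LayerRec.num_part {V : Type} {K F B : V → V → Weight} {M : ℕ → V → V → Weight}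
    (h : LayerRec K F B M) :
    LayerRec (nmat K) (nmat F) (nmat B) fun t => nmat (M t) where
  closed t := closed_nmat (h.closed t)
  anti t a b := num_mono (h.anti t a b)
  stat t a b := num_mono (h.stat t a b)
  exc t a c d b := by
    have := num_mono (h.exc t a c d b)
    rwa [num_add, num_add] at this
  attained t a b := by
    have key : ∀ {b w}, Der K F B (M t) a b w →
        Der (nmat K) (nmat F) (nmat B)
          (nmat (M t)) a b (num w) := by
      intro b w hw
      induction hw with
      | nil => rw [num_zero]; exact Der.nil _
      | stat c _ ih => rw [num_add]; exact Der.stat c ih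
      | exc c d e _ ih => rw [num_add, num_add, num_add]; exact Der.exc c d e ih
    exact key (h.attained t a b)

theorem Settles.num_part {V : Type} {M : ℕ → V → V → Weight} {T : ℕ} (h : Settles M T) :
    Settles (fun t => nmat (M t)) T where
  anti t a b := num_mono (h.anti t a b)
  final t ht := by rw [h.final t ht]

/-! ### Chains of improvements -/

section Chains

variable {V : Type} {K F B : V → V → Weight} {M : ℕ → V → V → Weight} {T : ℕ}

/-- With the final numerical values, an excursion for `Q` from `a'` to `b'` lies on a shortest path
for `P`. -/
def Tight (F B : V → V → Weight) (W : V → V → Weight) (P Q : V × V) (a' b' : V) : Prop :=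
  nmat W P.1 P.2 ≠ ⊤ ∧ nmat W P.1 P.2 =
    nmat W P.1 a' + (nmat F a' Q.1 + nmat W Q.1 Q.2 + nmat B Q.2 b') + nmat W b' P.2

/-- Some shortest path for `P` contains an excursion for `Q`. -/
def Uses (F B : V → V → Weight) (W : V → V → Weight) (P Q : V × V) : Prop :=
  ∃ a' b', Tight F B W P Q a' b'

/-- The first index at which the numerical part of the entry for `P` is final. -/
noncomputable def nstage (M : ℕ → V → V → Weight) (T : ℕ) (P : V × V) : ℕ :=
  stage (fun t => nmat (M t)) T P

/-- An index at which the numerical part of an entry improves for the last time is preceded by one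
for an excursion. -/
theorem LayerRec.exists_nstage_pred (h : LayerRec K F B M) (hT : Settles M T) {P : V × V} {d : ℕ}
    (hP : nstage M T P = d + 2) : ∃ a' b' Q, nstage M T Q = d + 1 ∧ nmat (M T) P.1 P.2 ≠ ⊤ ∧
      nmat (M T) P.1 P.2 = nmat (M T) P.1 a' +
        (nmat F a' Q.1 + nmat (M T) Q.1 Q.2 + nmat B Q.2 b') + nmat (M T) b' P.2 := by
  have hn := h.num_part
  have hTn := hT.num_part
  have h1 := hTn.eq_of_stage_le (P := P) (t := d + 2) (le_of_eq hP)
  have h2 := hTn.lt_of_lt_stage (P := P) (t := d + 1) (by rw [nstage] at hP; omega)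
  rw [← h1] at h2
  obtain ⟨a', c, e, b', h3, h4⟩ := hn.exists_improved h2
  have hne : nmat (M T) P.1 P.2 ≠ ⊤ := by rw [← h1]; exact h2.ne_top
  rw [h1] at h4
  obtain ⟨e1, e2, e3⟩ := WithTop.eq_of_add_eq hne h4 (hn.final_le hTn P.1 a' c e b' P.2)
    (hTn.final_le _ _ _) (hTn.final_le _ _ _) (hTn.final_le _ _ _)
  refine ⟨a', b', (c, e), hTn.stage_eq (P := (c, e)) e2.symm h3, hne, ?_⟩
  dsimp only
  rw [e1, e2, e3]
  exact h4

theorem LayerRec.exists_uses (h : LayerRec K F B M) (hT : Settles M T) {P : V × V} {d : ℕ}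
    (hP : nstage M T P = d + 2) : ∃ Q, Uses F B (M T) P Q ∧ nstage M T Q = d + 1 := by
  obtain ⟨a', b', Q, h1, h2, h3⟩ := h.exists_nstage_pred hT hP
  exact ⟨Q, ⟨a', b', h2, h3⟩, h1⟩

/-- All smaller positive numerical stages occur among the pairs that are used by `P`. -/
theorem LayerRec.exists_reachable_nstage (h : LayerRec K F B M) (hT : Settles M T) {P : V × V}
    {d i : ℕ} (hP : nstage M T P = d) (hi : 1 ≤ i) (hid : i ≤ d) :
    ∃ Q, Relation.ReflTransGen (Uses F B (M T)) P Q ∧ nstage M T Q = i := by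
  induction d generalizing P with
  | zero => omega
  | succ d ih =>
    rcases hid.eq_or_lt with rfl | hlt
    · exact ⟨P, .refl, hP⟩
    · obtain ⟨d, rfl⟩ : ∃ e, d = e + 1 := ⟨d - 1, by omega⟩
      obtain ⟨Q, h1, h2⟩ := h.exists_uses hT hP
      obtain ⟨R, h3, h4⟩ := ih h2 (by omega)
      exact ⟨R, .head h1 h3, h4⟩

/-- The connections of a tight excursion are settled soon after everything that is used. -/
theorem LayerRec.nstage_side_le (h : LayerRec K F B M) (hT : Settles M T) {P Q : V × V} {a' b' : V}
    (hPQ : Tight F B (M T) P Q a' b') {t : ℕ}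
    (ht : ∀ R, Uses F B (M T) P R → nstage M T R ≤ t) :
    nstage M T (P.1, a') ≤ t + 1 ∧ nstage M T (b', P.2) ≤ t + 1 := by
  have hn := h.num_part
  have hTn := hT.num_part
  have hc := closed_nmat (h.closed T)
  have hfin := fun a' c d b' => hn.final_le hTn P.1 a' c d b' P.2
  obtain ⟨h1, h2⟩ := hPQ
  constructor
  · by_contra hlt
    rw [not_le] at hlt
    obtain ⟨d, hd⟩ : ∃ d, nstage M T (P.1, a') = d + 2 :=
      ⟨nstage M T (P.1, a') - 2, by omega⟩
    obtain ⟨e, e', R, h3, h4, h5⟩ := h.exists_nstage_pred hT hd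
    dsimp only at h4 h5
    have := ht R ⟨e, e', h1, le_antisymm (hfin _ _ _ _) ?_⟩
    · omega
    · have h6 := hn.final_le hTn a' a' Q.1 Q.2 b' P.2
      rw [hc.diag, zero_add] at h6
      rw [h2, h5]
      refine (add_le_add le_rfl ((hc.tri e' a' P.2).trans (add_le_add le_rfl h6))).trans
        (le_of_eq ?_)
      simp only [add_assoc]
  · by_contra hlt
    rw [not_le] at hlt
    obtain ⟨d, hd⟩ : ∃ d, nstage M T (b', P.2) = d + 2 :=
      ⟨nstage M T (b', P.2) - 2, by omega⟩
    obtain ⟨e, e', R, h3, h4, h5⟩ := h.exists_nstage_pred hT hd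
    dsimp only at h4 h5
    have := ht R ⟨e, e', h1, le_antisymm (hfin _ _ _ _) ?_⟩
    · omega
    · have h6 := hn.final_le hTn P.1 a' Q.1 Q.2 b' b'
      rw [hc.diag, add_zero] at h6
      rw [h2, h5]
      refine (add_le_add (add_le_add ((hc.tri P.1 b' e).trans (add_le_add h6 le_rfl)) le_rfl)
        le_rfl).trans (le_of_eq ?_)
      simp only [add_assoc]

theorem isStrict_or_of_add {a b : Weight} (h : IsStrict (a + b)) : IsStrict a ∨ IsStrict b := by
  have ha : a ≠ ⊤ := by
    rintro rfl
    obtain ⟨d, hd⟩ := h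
    rw [top_add_weight] at hd
    exact wmk_ne_top _ _ hd.symm
  have hb : b ≠ ⊤ := by
    rintro rfl
    obtain ⟨d, hd⟩ := h
    rw [add_top_weight] at hd
    exact wmk_ne_top _ _ hd.symm
  exact (isStrict_add ha hb).1 h

/-- An entry that becomes final does so through an excursion whose entry became final one round
before, or through one whose numerical part did, and which is strict outside of that entry. -/
theorem LayerRec.exists_stage_pred (h : LayerRec K F B M) (hT : Settles M T) {P : V × V} {τ : ℕ}
    (hP : stage M T P = τ + 2) : ∃ Q a' b', Tight F B (M T) P Q a' b' ∧
      (stage M T Q = τ + 1 ∨ nstage M T Q = τ + 1 ∧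
        (IsStrict (M (τ + 2) P.1 a' + F a' Q.1) ∨ IsStrict (B Q.2 b' + M (τ + 2) b' P.2)) ∧
        nmat (M (τ + 2)) P.1 a' = nmat (M T) P.1 a' ∧
        nmat (M (τ + 2)) b' P.2 = nmat (M T) b' P.2) := by
  have hn := h.num_part
  have hTn := hT.num_part
  have h1 := hT.eq_of_stage_le (P := P) (t := τ + 2) (le_of_eq hP)
  have h2 := hT.lt_of_lt_stage (P := P) (t := τ + 1) (by omega)
  rw [← h1] at h2
  obtain ⟨a', c, e, b', h3, h4⟩ := h.exists_improved h2
  rw [h1] at h4 h2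
  have hne : nmat (M T) P.1 P.2 ≠ ⊤ := fun hh => h2.ne_top (num_eq_top.1 hh)
  have h5 : nmat (M T) P.1 P.2 = nmat (M (τ + 2)) P.1 a' +
      (nmat F a' c + nmat (M (τ + 1)) c e + nmat B e b') + nmat (M (τ + 2)) b' P.2 := by
    simp only [nmat, h4, num_add]
  obtain ⟨e1, e2, e3⟩ := WithTop.eq_of_add_eq hne h5 (hn.final_le hTn P.1 a' c e b' P.2)
    (hTn.final_le _ _ _) (hTn.final_le _ _ _) (hTn.final_le _ _ _)
  refine ⟨(c, e), a', b', ⟨hne, ?_⟩, ?_⟩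
  · dsimp only
    rw [e1, e2, e3]
    exact h5
  · rcases (hT.final_le (τ + 1) c e).eq_or_lt with h6 | h6
    · exact Or.inl (hT.stage_eq (P := (c, e)) h6.symm h3)
    · right
      obtain ⟨h7, h8⟩ := isStrict_of_lt h6 e2
      refine ⟨hTn.stage_eq (P := (c, e)) e2.symm (num_lt_of_lt_of_not_isStrict h3 h8), ?_,
        e1.symm, e3.symm⟩
      -- the final entry for `P` is strict, because the one for the excursion is
      have hle := h.final_le hT P.1 a' c e b' P.2
      have hnum : num (M T P.1 P.2) =
          num (M T P.1 a' + (F a' c + M T c e + B e b') + M T b' P.2) := by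
        simp only [num_add]
        change nmat (M T) P.1 P.2 = nmat (M T) P.1 a' +
          (nmat F a' c + nmat (M T) c e + nmat B e b') + nmat (M T) b' P.2
        rw [e1, e2, e3]
        exact h5
      have hst : IsStrict (M T P.1 a' + (F a' c + M T c e + B e b') + M T b' P.2) := by
        have hnt : M T P.1 a' + (F a' c + M T c e + B e b') + M T b' P.2 ≠ ⊤ := by
          intro hh
          rw [hh, num_top] at hnum
          exact hne hnum
        have t1 : M T P.1 a' ≠ ⊤ := by rintro hh; simp [hh, top_add_weight] at hnt
        have t2 : F a' c ≠ ⊤ := by rintro hh; simp [hh, top_add_weight, add_top_weight] at hnt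
        have t3 : M T c e ≠ ⊤ := by rintro hh; simp [hh, top_add_weight, add_top_weight] at hnt
        have t4 : B e b' ≠ ⊤ := by rintro hh; simp [hh, top_add_weight, add_top_weight] at hnt
        have t5 : M T b' P.2 ≠ ⊤ := by rintro hh; simp [hh, add_top_weight] at hnt
        have u1 := (isStrict_add t2 t3).2 (Or.inr h7)
        have n1 : F a' c + M T c e ≠ ⊤ := by
          intro hh; simp [hh, top_add_weight, add_top_weight] at hnt
        have u2 := (isStrict_add n1 t4).2 (Or.inl u1)
        have n2 : F a' c + M T c e + B e b' ≠ ⊤ := by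
          intro hh; simp [hh, top_add_weight, add_top_weight] at hnt
        have u3 := (isStrict_add t1 n2).2 (Or.inr u2)
        have n3 : M T P.1 a' + (F a' c + M T c e + B e b') ≠ ⊤ := by
          intro hh; simp [hh, top_add_weight] at hnt
        exact (isStrict_add n3 t5).2 (Or.inl u3)
      have hPs := isStrict_of_le hle hnum hst
      rw [h4, show M (τ + 2) P.1 a' + (F a' c + M (τ + 1) c e + B e b') + M (τ + 2) b' P.2 =
        (M (τ + 2) P.1 a' + F a' c) + (M (τ + 1) c e + (B e b' + M (τ + 2) b' P.2)) by
          simp only [add_assoc]] at hPs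
      rcases isStrict_or_of_add hPs with hs | hs
      · exact Or.inl hs
      · rcases isStrict_or_of_add hs with hs | hs
        · exact absurd hs h8
        · exact Or.inr hs

end Chains

/-! ### Retiming of a periodic chain -/

/-- Along a loop without slack, an inequality between consecutive values that holds for all pairs
of phases is an equality. -/
theorem retiming {L : ℕ} (hL : 0 < L) {p q : ℕ → ℤ} {h : ℕ → ℕ → WithTop ℤ}
    (hp : ∀ i, p (i + L) = p i) (hq : ∀ i, q (i + L) = q i)
    (hh : ∀ i k, h (i + L) (k + L) = h i k)
    (hle : ∀ i k, h i k ≤ ((p i + q k : ℤ) : WithTop ℤ) + h (i + 1) (k + 1))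
    (heq : ∀ i, h i i = ((p i + q i : ℤ) : WithTop ℤ) + h (i + 1) (i + 1)) (h0 : h 0 0 ≠ ⊤)
    (i k : ℕ) : h i k = ((p i + q k : ℤ) : WithTop ℤ) + h (i + 1) (k + 1) := by
  -- `n` moves forward bound `h i k` from above, and are exact on the diagonal
  have iter : ∀ n i k, h i k ≤
      ((∑ j ∈ Finset.range n, p (i + j) + ∑ j ∈ Finset.range n, q (k + j) : ℤ) : WithTop ℤ) +
        h (i + n) (k + n) := by
    intro n
    induction n with
    | zero => intro i k; simp
    | succ n ih =>
      intro i k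
      refine (ih i k).trans ?_
      refine (add_le_add le_rfl (hle (i + n) (k + n))).trans (le_of_eq ?_)
      rw [Finset.sum_range_succ, Finset.sum_range_succ, ← add_assoc, ← WithTop.coe_add]
      congr 2
      ring
  have iter' : ∀ n, h 0 0 =
      ((∑ j ∈ Finset.range n, p j + ∑ j ∈ Finset.range n, q j : ℤ) : WithTop ℤ) + h n n := by
    intro n
    induction n with
    | zero => simp
    | succ n ih =>
      rw [ih, heq n, Finset.sum_range_succ, Finset.sum_range_succ, ← add_assoc, ← WithTop.coe_add]
      congr 2
      ring
  have shift : ∀ {f : ℕ → ℤ}, (∀ i, f (i + L) = f i) → ∀ i,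
      ∑ j ∈ Finset.range L, f (i + j) = ∑ j ∈ Finset.range L, f j := by
    intro f hf i
    induction i with
    | zero => simp
    | succ i ih =>
      have h1 := Finset.sum_range_succ (fun j => f (i + j)) L
      have h2 := Finset.sum_range_succ' (fun j => f (i + j)) L
      simp only [add_zero, hf] at h1 h2
      have h3 : ∑ j ∈ Finset.range L, f (i + 1 + j) = ∑ j ∈ Finset.range L, f (i + (j + 1)) :=
        Finset.sum_congr rfl fun j _ => by congr 1; omega
      linarith
  -- since `h 0 0` is finite and recurs after one turn, the moves of a whole turn cancel
  have hsum : ∑ j ∈ Finset.range L, p j + ∑ j ∈ Finset.range L, q j = 0 := by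
    have h1 := iter' L
    have h2 := hh 0 0
    rw [zero_add] at h2
    rw [h2] at h1
    lift h 0 0 to ℤ using h0 with z
    norm_cast at h1
    omega
  -- the other inequality follows by completing the turn
  refine le_antisymm (hle i k) ?_
  obtain ⟨l, rfl⟩ : ∃ l, L = l + 1 := ⟨L - 1, by omega⟩
  have h1 := add_le_add (le_refl ((p i + q k : ℤ) : WithTop ℤ)) (iter l (i + 1) (k + 1))
  rw [← add_assoc, ← WithTop.coe_add, show i + 1 + l = i + (l + 1) by ring,
    show k + 1 + l = k + (l + 1) by ring, hh] at h1
  refine h1.trans ?_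
  have h2 := Finset.sum_range_succ' (fun j => p (i + j)) l
  have h3 := Finset.sum_range_succ' (fun j => q (k + j)) l
  rw [shift hp] at h2
  rw [shift hq] at h3
  have h4 : ∀ (f : ℕ → ℤ) i, ∑ j ∈ Finset.range l, f (i + 1 + j) =
      ∑ j ∈ Finset.range l, f (i + (j + 1)) := fun f i =>
    Finset.sum_congr rfl fun j _ => by congr 1; omega
  rw [h4, h4, show p i + q k + (∑ j ∈ Finset.range l, p (i + (j + 1)) +
    ∑ j ∈ Finset.range l, q (k + (j + 1))) = 0 by simp only [add_zero] at h2 h3; linarith]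
  simp

/-! ### Finite reachability -/

/-- A vertex that is reached in some number of rounds is reached in fewer rounds than there are
vertices: the first rounds at which vertices are reached have no gaps. -/
theorem exists_mem_lt_card {V : Type} [Fintype V] (Z : ℕ → Set V)
    (hZ : ∀ r z, z ∈ Z (r + 1) → ∃ z' ∈ Z r, ∀ s, z' ∈ Z s → z ∈ Z (s + 1)) {z : V} {r : ℕ}
    (hz : z ∈ Z r) : ∃ s < Fintype.card V, z ∈ Z s := by
  classical
  set f : V → ℕ := fun z => sInf {r | z ∈ Z r} with hf
  have key : ∀ e d, d + e = f z → ∃ z', f z' = d := by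
    intro e
    induction e with
    | zero => intro d hd; exact ⟨z, by omega⟩
    | succ e ih =>
      intro d hd
      obtain ⟨z1, hz1⟩ := ih (d + 1) (by omega)
      have hz1' : z1 ∈ Z (d + 1) := by
        have h1 : (0 : ℕ) < sInf {r | z1 ∈ Z r} := by
          change 0 < f z1
          omega
        have h2 : sInf {r | z1 ∈ Z r} ∈ {r | z1 ∈ Z r} :=
          Nat.sInf_mem (Nat.nonempty_of_pos_sInf h1)
        rw [show sInf {r | z1 ∈ Z r} = d + 1 from hz1] at h2
        exact h2
      obtain ⟨z2, h2, h3⟩ := hZ _ _ hz1'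
      have h4 : f z2 ≤ d := Nat.sInf_le h2
      have h5 : z2 ∈ Z (f z2) := Nat.sInf_mem (s := {r | z2 ∈ Z r}) ⟨d, h2⟩
      have h6 : f z1 ≤ f z2 + 1 := Nat.sInf_le (h3 _ h5)
      exact ⟨z2, by omega⟩
  refine ⟨f z, ?_, Nat.sInf_mem (s := {r | z ∈ Z r}) ⟨r, hz⟩⟩
  have hsub : Finset.range (f z + 1) ⊆ Finset.univ.image f := by
    intro d hd
    obtain ⟨z', hz'⟩ := key (f z - d) d (by have := Finset.mem_range.1 hd; omega)
    exact Finset.mem_image.2 ⟨z', Finset.mem_univ _, hz'⟩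
  have h1 := Finset.card_le_card hsub
  have h2 := Finset.card_image_le (s := (Finset.univ : Finset V)) (f := f)
  rw [Finset.card_range] at h1
  rw [Finset.card_univ] at h2
  omega

/-- A path that passes through `d` on its way from `a` to `c`, as a sequence. -/
theorem exists_path_through {α : Type} {r : α → α → Prop} {a d c : α}
    (h1 : Relation.ReflTransGen r a d) (h2 : Relation.ReflTransGen r d c) :
    ∃ (n k : ℕ) (f : ℕ → α), k ≤ n ∧ f 0 = a ∧ f k = d ∧ f n = c ∧
      ∀ i < n, r (f i) (f (i + 1)) := by
  have ext : ∀ {k n : ℕ} {f : ℕ → α} {d c c' : α}, k ≤ n → f 0 = a → f k = d → f n = c →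
      (∀ i < n, r (f i) (f (i + 1))) → r c c' →
      ∃ g : ℕ → α, g 0 = a ∧ g k = d ∧ g (n + 1) = c' ∧ ∀ i < n + 1, r (g i) (g (i + 1)) := by
    intro k n f d c c' hk hf0 hfk hfn hr hcc
    refine ⟨fun i => if i ≤ n then f i else c', by simp [hf0], by simp [hk, hfk], by simp, ?_⟩
    intro i hi
    rcases Nat.lt_succ_iff_lt_or_eq.1 hi with hi | rfl
    · simpa [hi.le, Nat.succ_le_iff.2 hi] using hr i hi
    · simpa [hfn] using hcc
  induction h2 with
  | refl =>
    induction h1 with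
    | refl => exact ⟨0, 0, fun _ => a, le_rfl, rfl, rfl, rfl, by simp⟩
    | tail _ hbc ih =>
      obtain ⟨n, k, f, hk, h0, -, h2, h3⟩ := ih
      obtain ⟨g, g0, -, g2, g3⟩ := ext le_rfl h0 h2 h2 h3 hbc
      exact ⟨n + 1, n + 1, g, le_rfl, g0, g2, g2, g3⟩
  | tail _ hbc ih =>
    obtain ⟨n, k, f, hk, h0, h1, h2, h3⟩ := ih
    obtain ⟨g, g0, g1, g2, g3⟩ := ext hk h0 h1 h2 h3 hbc
    exact ⟨n + 1, k, g, by omega, g0, g1, g2, g3⟩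

/-- A loop that starts with the step from `c` to `a` and passes through `d`, as a periodic sequence.
-/
theorem exists_periodic {α : Type} {r : α → α → Prop} {c a d : α} (h0 : r c a)
    (h1 : Relation.ReflTransGen r a d) (h2 : Relation.ReflTransGen r d c) :
    ∃ (L : ℕ) (P : ℕ → α), 0 < L ∧ (∀ i, P (i + L) = P i) ∧ P 0 = c ∧ P 1 = a ∧ (∃ i, P i = d) ∧
      ∀ i, r (P i) (P (i + 1)) := by
  obtain ⟨n, k, f, hk, f0, fk, fn, hf⟩ := exists_path_through h1 h2
  set g : ℕ → α := fun i => if i = 0 then c else f (i - 1) with hg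
  have hg0 : g 0 = c := rfl
  have hgs : ∀ i, g (i + 1) = f i := fun i => by simp [hg]
  have hgL : g (n + 1) = c := by rw [hgs, fn]
  have hr : ∀ i < n + 1, r (g i) (g (i + 1)) := by
    intro i hi
    cases i with
    | zero => rw [hg0, hgs, f0]; exact h0
    | succ i => rw [hgs, hgs]; exact hf i (by omega)
  have hwrap : ∀ i ≤ n + 1, g (i % (n + 1)) = g i := by
    intro i hi
    rcases hi.eq_or_lt with rfl | hi
    · rw [Nat.mod_self, hg0, hgL]
    · rw [Nat.mod_eq_of_lt hi]
  refine ⟨n + 1, fun i => g (i % (n + 1)), Nat.succ_pos _, fun i => by simp, by simp [hg0], ?_,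
    ⟨k + 1, ?_⟩, ?_⟩
  · change g (1 % (n + 1)) = a
    rw [hwrap 1 (by omega), show (1 : ℕ) = 0 + 1 from rfl, hgs, f0]
  · change g ((k + 1) % (n + 1)) = d
    rw [hwrap _ (by omega), hgs, fk]
  · intro i
    have hlt : i % (n + 1) < n + 1 := Nat.mod_lt _ (Nat.succ_pos _)
    have : g ((i + 1) % (n + 1)) = g (i % (n + 1) + 1) := by
      rw [← hwrap (i % (n + 1) + 1) (by omega)]
      simp
    dsimp only
    rw [this]
    exact hr _ hlt

/-! ### The matrices are constant after `N ^ 2` rounds -/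

section

variable {V : Type} {K F B : V → V → Weight} {M : ℕ → V → V → Weight} {T : ℕ}

theorem Settles.num_eq_of_le (hT : Settles M T) {s t : ℕ} (hst : s ≤ t) {a b : V}
    (h : nmat (M s) a b = nmat (M T) a b) : nmat (M t) a b = nmat (M T) a b :=
  le_antisymm ((hT.num_part.antitone hst a b).trans h.le) (hT.num_part.final_le t a b)

theorem isStrict_ne_top {a : Weight} (h : IsStrict a) : a ≠ ⊤ := by
  obtain ⟨d, rfl⟩ := h
  exact wmk_ne_top _ _

/-- A tight excursion whose parts have reached their final numbers, and which is strict on the way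
to its end, makes the entry strict. -/
theorem strict_of_tight (hc : ∀ t, Closed (M t))
    (hexc : ∀ t a c d b, M (t + 1) a b ≤ F a c + M t c d + B d b) (hT : Settles M T) {u : ℕ}
    {P Q : V × V} {a b : V} (hPQ : Tight F B (M T) P Q a b)
    (hQ : nmat (M u) Q.1 Q.2 = nmat (M T) Q.1 Q.2)
    (ha : nmat (M (u + 1)) P.1 a = nmat (M T) P.1 a)
    (hb : nmat (M (u + 1)) b P.2 = nmat (M T) b P.2)
    (hs : IsStrict (M (u + 1) P.1 a + F a Q.1 + M u Q.1 Q.2)) :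
    nmat (M (u + 1)) P.1 P.2 = nmat (M T) P.1 P.2 ∧ IsStrict (M (u + 1) P.1 P.2) := by
  have hle : M (u + 1) P.1 P.2 ≤
      M (u + 1) P.1 a + F a Q.1 + M u Q.1 Q.2 + (B Q.2 b + M (u + 1) b P.2) := by
    refine ((hc _).tri P.1 b P.2).trans ((add_le_add (((hc _).tri P.1 a b).trans
      (add_le_add le_rfl (hexc u a Q.1 Q.2 b))) le_rfl).trans (le_of_eq ?_))
    simp only [add_assoc]
  have hnum : num (M (u + 1) P.1 a + F a Q.1 + M u Q.1 Q.2 + (B Q.2 b + M (u + 1) b P.2)) =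
      nmat (M T) P.1 P.2 := by
    rw [hPQ.2, ← ha, ← hb, ← hQ]
    simp only [nmat, num_add, add_assoc]
  have h1 : nmat (M (u + 1)) P.1 P.2 = nmat (M T) P.1 P.2 :=
    le_antisymm ((num_mono hle).trans hnum.le) (hT.num_part.final_le _ _ _)
  refine ⟨h1, isStrict_of_le hle (by rw [hnum]; exact h1) ?_⟩
  have hne : M (u + 1) P.1 a + F a Q.1 + M u Q.1 Q.2 + (B Q.2 b + M (u + 1) b P.2) ≠ ⊤ := by
    intro hh
    rw [hh, num_top] at hnum
    exact hPQ.1 hnum.symm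
  refine (isStrict_add (isStrict_ne_top hs) ?_).2 (Or.inl hs)
  intro hh
  rw [hh, add_top_weight] at hne
  exact hne rfl

/-- If a loop of tight excursions contains a strict forward part, then its entries become final
soon after everything that it uses has reached its final number: in the other phases of the loop,
the strict part is reached by a shortcut that visits every vertex at most once. -/
theorem eq_of_strict_loop [Fintype V] (hc : ∀ t, Closed (M t))
    (hexc : ∀ t a c d b, M (t + 1) a b ≤ F a c + M t c d + B d b) (hT : Settles M T)
    {R : V × V → Prop} (hR : ∀ P Q, R P → Uses F B (M T) P Q → R Q) {t : ℕ}
    (hn : ∀ P, R P → nmat (M t) P.1 P.2 = nmat (M T) P.1 P.2)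
    (hside : ∀ P Q a b, R P → Tight F B (M T) P Q a b →
      nmat (M (t + 1)) P.1 a = nmat (M T) P.1 a ∧ nmat (M (t + 1)) b P.2 = nmat (M T) b P.2)
    {L : ℕ} (hL : 0 < L) {x y a b : ℕ → V} (hx : ∀ i, x (i + L) = x i) (hy : ∀ i, y (i + L) = y i)
    (ha : ∀ i, a (i + L) = a i) (hb : ∀ i, b (i + L) = b i)
    (hP : ∀ i, Tight F B (M T) (x i, y i) (x (i + 1), y (i + 1)) (a i) (b i))
    (h0 : R (x 0, y 0)) (hs : IsStrict (M (t + 1) (x 0) (a 0) + F (a 0) (x 1))) (i : ℕ) :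
    M (t + Fintype.card V) (x i) (y i) = M T (x i) (y i) := by
  set w := nmat (M T) with hw
  have hfin : ∀ a a' c d b' b, w a b ≤ w a a' + (nmat F a' c + w c d + nmat B d b') + w b' b := by
    intro a a' c d b' b
    have h1 := hexc T a' c d b'
    rw [hT.final (T + 1) (Nat.le_succ T)] at h1
    have h2 := num_mono (((hc T).tri a b' b).trans (add_le_add (((hc T).tri a a' b').trans
      (add_le_add le_rfl h1)) le_rfl))
    simpa only [num_add, hw, nmat] using h2
  have hRi : ∀ i, R (x i, y i) := by
    intro i
    induction i with
    | zero => exact h0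
    | succ i ih => exact hR _ _ ih ⟨_, _, hP i⟩
  have hpe : ∀ i, ∃ z : ℤ, (z : WithTop ℤ) = w (x i) (a i) + nmat F (a i) (x (i + 1)) := by
    intro i
    refine WithTop.ne_top_iff_exists.1 fun hh => (hP i).1 ?_
    rw [(hP i).2]
    dsimp only
    rw [← hw, ← add_assoc, ← add_assoc, hh]
    simp
  have hqe : ∀ i, ∃ z : ℤ, (z : WithTop ℤ) = nmat B (y (i + 1)) (b i) + w (b i) (y i) := by
    intro i
    refine WithTop.ne_top_iff_exists.1 fun hh => (hP i).1 ?_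
    rw [(hP i).2]
    dsimp only
    rw [← hw, ← add_assoc, add_assoc _ (nmat B _ _), hh]
    simp
  choose p hp using hpe
  choose q hq using hqe
  have rearr : ∀ i k, w (x i) (a i) + (nmat F (a i) (x (i + 1)) + w (x (i + 1)) (y (k + 1)) +
      nmat B (y (k + 1)) (b k)) + w (b k) (y k) =
      ((p i + q k : ℤ) : WithTop ℤ) + w (x (i + 1)) (y (k + 1)) := by
    intro i k
    rw [WithTop.coe_add, hp, hq]
    abel
  have hx1 : ∀ i, x (i + L + 1) = x (i + 1) := fun i => by rw [← hx (i + 1)]; congr 1; omega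
  have hy1 : ∀ i, y (i + L + 1) = y (i + 1) := fun i => by rw [← hy (i + 1)]; congr 1; omega
  -- the way out at phase `i` and the way back at phase `k` fit together for all `i` and `k`
  have hret := retiming hL (p := p) (q := q) (h := fun i k => w (x i) (y k))
    (fun i => WithTop.coe_injective (by rw [hp, hp, hx, ha, hx1]))
    (fun i => WithTop.coe_injective (by rw [hq, hq, hy, hb, hy1]))
    (fun i k => by rw [hx, hy])
    (fun i k => (hfin _ _ _ _ _ _).trans (rearr i k).le)
    (fun i => (hP i).2.trans (rearr i i)) (hP 0).1
  have htight : ∀ i k, w (x i) (y k) ≠ ⊤ →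
      Tight F B (M T) (x i, y k) (x (i + 1), y (k + 1)) (a i) (b k) := fun i k hne =>
    ⟨hne, (hret i k).trans (rearr i k).symm⟩
  -- the vertices from which `x 0` is reached by `r` forward moves
  let Z : ℕ → Set V := fun r => Nat.rec {x 0} (fun _ S => {z | ∃ i, x i = z ∧ x (i + 1) ∈ S}) r
  have hZ0 : Z 0 = {x 0} := rfl
  have hZs : ∀ r z, z ∈ Z (r + 1) ↔ ∃ i, x i = z ∧ x (i + 1) ∈ Z r := fun r z => Iff.rfl
  -- the strict part is reached after `r` moves, whatever the phase of the way back
  have good : ∀ r z, z ∈ Z r → ∀ k, R (z, y k) → w z (y k) ≠ ⊤ →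
      nmat (M (t + 1 + r)) z (y k) = w z (y k) ∧ IsStrict (M (t + 1 + r) z (y k)) := by
    intro r
    induction r with
    | zero =>
      intro z hz k hRz hne
      obtain rfl : z = x 0 := hz
      have ht := htight 0 k hne
      have hR1 := hR _ _ hRz ⟨_, _, ht⟩
      obtain ⟨s1, s2⟩ := hside _ _ _ _ hRz ht
      refine strict_of_tight hc hexc hT ht (hn _ hR1) s1 s2 ?_
      refine (isStrict_add (isStrict_ne_top hs) ?_).2 (Or.inl hs)
      intro hh
      refine ht.1 ?_
      rw [ht.2, ← hw, ← show _ = w _ _ from hn _ hR1]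
      have : nmat (M t) (x (0 + 1)) (y (k + 1)) = ⊤ := num_eq_top.2 hh
      simp [this]
    | succ r ih =>
      intro z hz k hRz hne
      obtain ⟨i, rfl, hi⟩ := (hZs _ _).1 hz
      have ht := htight i k hne
      have hR1 := hR _ _ hRz ⟨_, _, ht⟩
      obtain ⟨s1, s2⟩ := hside _ _ _ _ hRz ht
      have hne1 : w (x (i + 1)) (y (k + 1)) ≠ ⊤ := by
        intro hh
        refine ht.1 ?_
        rw [ht.2]
        dsimp only
        rw [← hw, hh]
        simp
      obtain ⟨n1, st1⟩ := ih _ hi (k + 1) hR1 hne1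
      have s1' := hT.num_eq_of_le (t := t + 1 + r + 1) (by omega) s1
      have s2' := hT.num_eq_of_le (t := t + 1 + r + 1) (by omega) s2
      refine strict_of_tight hc hexc hT ht n1 s1' s2' ?_
      refine (isStrict_add ?_ (isStrict_ne_top st1)).2 (Or.inr st1)
      intro hh
      refine ht.1 ?_
      rw [ht.2, ← s1']
      have : nmat (M (t + 1 + r + 1)) (x i) (a i) + nmat F (a i) (x (i + 1)) = ⊤ := by
        simp only [nmat]
        rw [← num_add]
        exact num_eq_top.2 hh
      dsimp only
      rw [← add_assoc, ← add_assoc, this]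
      simp
  have hxm : ∀ m, x (m * L) = x 0 := by
    intro m
    induction m with
    | zero => simp
    | succ m ih => rw [Nat.succ_mul, hx, ih]
  -- going round the loop, `x i` reaches `x 0`; by a shortcut, this takes less than `N` moves
  have hreach : ∀ r, r ≤ i * L → x (i * L - r) ∈ Z r := by
    intro r
    induction r with
    | zero => intro _; rw [hZ0, Nat.sub_zero, hxm]; rfl
    | succ r ih =>
      intro hr
      refine (hZs _ _).2 ⟨_, rfl, ?_⟩
      rw [show i * L - (r + 1) + 1 = i * L - r by omega]
      exact ih (by omega)
  have hiL : i ≤ i * L := Nat.le_mul_of_pos_right i hL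
  have hi := hreach (i * L - i) (by omega)
  rw [show i * L - (i * L - i) = i by omega] at hi
  obtain ⟨r, hr, hir⟩ := exists_mem_lt_card Z (fun r z hz => by
    obtain ⟨i, rfl, hi⟩ := (hZs _ _).1 hz
    exact ⟨_, hi, fun s hs => (hZs _ _).2 ⟨i, rfl, hs⟩⟩) hi
  obtain ⟨g1, g2⟩ := good r _ hir i (hRi i) (hP i).1
  have g3 := eq_of_le_of_num_eq (hT.final_le (t + 1 + r) (x i) (y i)) g1.symm (fun _ => g2)
  refine le_antisymm ?_ (hT.final_le _ _ _)
  rw [g3]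
  exact hT.antitone (by omega) _ _

theorem Settles.transpose (hT : Settles M T) : Settles (fun t a b => M t b a) T where
  anti t a b := hT.anti t b a
  final t ht := by funext a b; rw [hT.final t ht]

theorem Closed.transpose {α : Type} [AddCommMonoid α] [LinearOrder α] {W : V → V → α}
    (h : Closed W) : Closed fun a b => W b a where
  diag u := h.diag u
  tri u v w := by rw [add_comm]; exact h.tri w v u

theorem tight_transpose {W : V → V → Weight} {P Q : V × V} {a b : V} :
    Tight (fun a b => B b a) (fun a b => F b a) (fun a b => W b a) P Q a b ↔
      Tight F B W P.swap Q.swap b a := by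
  obtain ⟨p, q⟩ := P
  obtain ⟨c, d⟩ := Q
  simp only [Tight, nmat, Prod.swap]
  refine and_congr Iff.rfl ?_
  rw [show num (W a p) + (num (B c a) + num (W d c) + num (F b d)) + num (W q b) =
    num (W q b) + (num (F b d) + num (W d c) + num (B c a)) + num (W a p) by abel]

theorem uses_transpose {W : V → V → Weight} {P Q : V × V} :
    Uses (fun a b => B b a) (fun a b => F b a) (fun a b => W b a) P Q ↔
      Uses F B W P.swap Q.swap :=
  ⟨fun ⟨a, b, h⟩ => ⟨b, a, tight_transpose.1 h⟩, fun ⟨a, b, h⟩ => ⟨b, a, tight_transpose.2 h⟩⟩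

/-- The pairs in a set that is closed under `Uses` and the other pairs are counted separately, by
their numerical stages and by their stages. -/
theorem add_le_of_stages [Fintype V] (hc : ∀ t, Closed (M t)) {R : V × V → Prop} {r j s : ℕ}
    (hR : ∀ i, 1 ≤ i → i ≤ r → ∃ D, R D ∧ nstage M T D = i)
    (hC : ∀ i, j < i → i ≤ s → ∃ C, ¬ R C ∧ stage M T C = i) :
    r + (s - j) ≤ Fintype.card V * Fintype.card V - Fintype.card V := by
  classical
  set A := (Finset.univ : Finset V).offDiag.filter R with hA
  set A' := (Finset.univ : Finset V).offDiag.filter (¬ R ·) with hA'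
  have hAA : A.card + A'.card = Fintype.card V * Fintype.card V - Fintype.card V := by
    rw [hA, hA', Finset.card_filter_add_card_filter_not, Finset.offDiag_card, Finset.card_univ]
  have h1 : Finset.Icc 1 r ⊆ A.image (nstage M T) := by
    intro i hi
    rw [Finset.mem_Icc] at hi
    obtain ⟨D, hD, hDi⟩ := hR i hi.1 hi.2
    have hne : D.1 ≠ D.2 := ne_of_stage_pos (M := fun t => nmat (M t)) (T := T)
      (fun t => closed_nmat (hc t)) (by rw [nstage] at hDi; omega)
    exact Finset.mem_image.2 ⟨D, Finset.mem_filter.2 ⟨by simpa using hne, hD⟩, hDi⟩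
  have h2 : Finset.Ioc j s ⊆ A'.image (stage M T) := by
    intro i hi
    rw [Finset.mem_Ioc] at hi
    obtain ⟨C, hC1, hCi⟩ := hC i hi.1 hi.2
    have hne : C.1 ≠ C.2 := ne_of_stage_pos (M := M) (T := T) hc (by omega)
    exact Finset.mem_image.2 ⟨C, Finset.mem_filter.2 ⟨by simpa using hne, hC1⟩, hCi⟩
  have h3 := (Finset.card_le_card h1).trans Finset.card_image_le
  have h4 := (Finset.card_le_card h2).trans Finset.card_image_le
  rw [Nat.card_Icc] at h3
  rw [Nat.card_Ioc] at h4
  omega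

/-- Tracing an entry back through the excursions that made the entries final, either all smaller
stages occur, or the chain arrives at a step that is only explained by strictness. -/
theorem LayerRec.exists_chain (h : LayerRec K F B M) (hT : Settles M T) (s : ℕ) {P : V × V}
    (hP : stage M T P = s + 1) :
    (∀ j, 1 ≤ j → j ≤ s + 1 → ∃ D, stage M T D = j) ∨
    ∃ τ C Q a' b', stage M T C = τ + 2 ∧ τ + 2 ≤ s + 1 ∧
      Relation.ReflTransGen (Uses F B (M T)) P C ∧
      Tight F B (M T) C Q a' b' ∧ nstage M T Q = τ + 1 ∧
      (IsStrict (M (τ + 2) C.1 a' + F a' Q.1) ∨ IsStrict (B Q.2 b' + M (τ + 2) b' C.2)) ∧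
      nmat (M (τ + 2)) C.1 a' = nmat (M T) C.1 a' ∧
      nmat (M (τ + 2)) b' C.2 = nmat (M T) b' C.2 ∧
      ∀ j, τ + 2 ≤ j → j ≤ s + 1 →
        ∃ D, stage M T D = j ∧ Relation.ReflTransGen (Uses F B (M T)) D C := by
  induction s generalizing P with
  | zero => exact Or.inl fun j h1 h2 => ⟨P, by omega⟩
  | succ s ih =>
    obtain ⟨Q, a', b', h1, h2 | ⟨h2, h3, h4, h5⟩⟩ := h.exists_stage_pred hT hP
    · rcases ih h2 with h3 | ⟨τ, C, Q', a1, b1, g1, g2, g3, g4, g5, g6, g7, g8, g9⟩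
      · left
        intro j hj1 hj2
        rcases hj2.eq_or_lt with rfl | hj2
        · exact ⟨P, hP⟩
        · exact h3 j hj1 (by omega)
      · right
        refine ⟨τ, C, Q', a1, b1, g1, by omega, .head ⟨_, _, h1⟩ g3, g4, g5, g6, g7, g8, ?_⟩
        intro j hj1 hj2
        rcases hj2.eq_or_lt with rfl | hj2
        · exact ⟨P, hP, .head ⟨_, _, h1⟩ g3⟩
        · exact g9 j hj1 (by omega)
    · right
      refine ⟨s, P, Q, a', b', hP, le_rfl, .refl, h1, h2, h3, h4, h5, ?_⟩
      intro j hj1 hj2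
      exact ⟨P, by omega, .refl⟩

/-- Every entry is final after at most `N ^ 2` rounds, where `N` is the number of vertices.

The entry for `P` is traced back. If the chain stops at a strict step from `C` to `Q`, there are two
cases. If no pair on the chain is used by `Q`, directly or indirectly, then the pairs on the chain
and the pairs used by `Q` are counted separately. Otherwise, let `J` be the largest stage of a pair
`D` on the chain that is used by `Q`. The pairs on the chain with larger stages leave so little room
for the pairs used by `Q` that the numerical parts of the latter are final early, and
`eq_of_strict_loop` bounds `J`. -/
theorem LayerRec.stage_le_sq [Fintype V] (h : LayerRec K F B M) (hT : Settles M T) (P : V × V) :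
    stage M T P ≤ Fintype.card V * Fintype.card V := by
  classical
  set N := Fintype.card V with hN
  have hNN : N ≤ N * N := Nat.le_mul_self N
  rcases Nat.eq_zero_or_pos (stage M T P) with h0 | hpos
  · omega
  obtain ⟨s, hs⟩ : ∃ s, stage M T P = s + 1 := ⟨stage M T P - 1, by omega⟩
  rcases h.exists_chain hT s hs with h1 | ⟨τ, C, Q, a0, b0, g1, g2, -, g4, g5, g6, g7, g8, g9⟩
  · -- all stages from `1` to `s + 1` belong to different pairs
    have := add_le_of_stages (M := M) (T := T) h.closed (R := fun _ => False) (r := 0) (j := 0)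
      (s := s + 1) (fun i _ _ => by omega) (fun i hi1 hi2 => by
        obtain ⟨D, hD⟩ := h1 i hi1 hi2
        exact ⟨D, id, hD⟩)
    rw [← hN] at this
    omega
  -- the pairs that are used by `Q`
  set R : V × V → Prop := fun D => Relation.ReflTransGen (Uses F B (M T)) Q D with hRdef
  have hR : ∀ P Q, R P → Uses F B (M T) P Q → R Q := fun _ _ h1 h2 => h1.tail h2
  have hRn : ∀ D, R D → ∀ i, 1 ≤ i → i ≤ nstage M T D → ∃ E, R E ∧ nstage M T E = i := by
    intro D hD i hi1 hi2
    obtain ⟨E, hE1, hE2⟩ := h.exists_reachable_nstage hT rfl hi1 hi2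
    exact ⟨E, hD.trans hE1, hE2⟩
  set p : ℕ → Prop := fun j => τ + 2 ≤ j ∧ ∃ D, stage M T D = j ∧
    Relation.ReflTransGen (Uses F B (M T)) D C ∧ R D with hp
  by_cases hex : ∃ j, j ≤ s + 1 ∧ p j
  swap
  · have := add_le_of_stages (M := M) (T := T) h.closed (R := R) (r := τ + 1) (j := τ + 1)
      (s := s + 1) (fun i h1 h2 => hRn Q .refl i h1 (by omega)) (fun i hi1 hi2 => by
        obtain ⟨D, hD1, hD2⟩ := g9 i hi1 hi2
        exact ⟨D, fun hD => hex ⟨i, hi2, hi1, D, hD1, hD2, hD⟩, hD1⟩)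
    rw [← hN] at this
    omega
  obtain ⟨j, hj, hpj⟩ := hex
  have hmax := Nat.findGreatest_spec hj hpj
  have hmax' : ∀ i, Nat.findGreatest p (s + 1) < i → i ≤ s + 1 → ¬ p i := fun i h1 h2 =>
    Nat.findGreatest_is_greatest h1 h2
  have hJle : Nat.findGreatest p (s + 1) ≤ s + 1 := Nat.findGreatest_le _
  set J := Nat.findGreatest p (s + 1)
  obtain ⟨hJ, D, hD1, hD2, hD3⟩ := hmax
  have hcount : ∀ E, R E → nstage M T E + (s + 1 - J) ≤ N * N - N := fun E hE =>
    add_le_of_stages (M := M) (T := T) h.closed (R := R) (hRn E hE) fun i hi1 hi2 => by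
      obtain ⟨D, hD1, hD2⟩ := g9 i (by omega) hi2
      exact ⟨D, fun hD => hmax' i hi1 hi2 ⟨by omega, D, hD1, hD2, hD⟩, hD1⟩
  obtain ⟨t, ht⟩ : ∃ t, t + (s + 1 - J) = N * N - N := ⟨N * N - N - (s + 1 - J), by
    have := hcount Q .refl
    omega⟩
  have hτt : τ + 1 ≤ t := by
    have := hcount Q .refl
    omega
  have hnR : ∀ E, R E → nstage M T E ≤ t := fun E hE => by
    have := hcount E hE
    omega
  have hTn := hT.num_part
  have hside : ∀ P Q a b, R P → Tight F B (M T) P Q a b →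
      nmat (M (t + 1)) P.1 a = nmat (M T) P.1 a ∧
        nmat (M (t + 1)) b P.2 = nmat (M T) b P.2 := by
    intro P Q a b hP hPQ
    obtain ⟨e1, e2⟩ := h.nstage_side_le hT hPQ (t := t) fun E hE => hnR E (hR _ _ hP hE)
    exact ⟨hTn.eq_of_stage_le (P := (P.1, a)) e1, hTn.eq_of_stage_le (P := (b, P.2)) e2⟩
  have hnum : ∀ E, R E → nmat (M t) E.1 E.2 = nmat (M T) E.1 E.2 := fun E hE =>
    hTn.eq_of_stage_le (hnR E hE)
  -- the loop through the strict step and the pair `D`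
  obtain ⟨L, S, hL, hper, hS0, hS1, ⟨i0, hi0⟩, hSr⟩ :=
    exists_periodic (r := Uses F B (M T)) ⟨_, _, g4⟩ hD3 hD2
  -- connections of the excursions on the loop, which are `a0` and `b0` for the strict step
  have hcon : ∀ E E', ∃ c : V × V, (Uses F B (M T) E E' → Tight F B (M T) E E' c.1 c.2) ∧
      (E = C → E' = Q → c = (a0, b0)) := by
    intro E E'
    by_cases hEC : E = C ∧ E' = Q
    · obtain ⟨rfl, rfl⟩ := hEC
      exact ⟨(a0, b0), fun _ => g4, fun _ _ => rfl⟩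
    · by_cases hU : Uses F B (M T) E E'
      · obtain ⟨a', b', hab⟩ := hU
        exact ⟨(a', b'), fun _ => hab, fun h1 h2 => absurd ⟨h1, h2⟩ hEC⟩
      · exact ⟨(a0, b0), fun hU' => absurd hU' hU, fun _ _ => rfl⟩
  choose c hc1 hc2 using hcon
  have hper1 : ∀ i, S (i + L + 1) = S (i + 1) := fun i => by rw [← hper (i + 1)]; congr 1; omega
  have hc0 : c C Q = (a0, b0) := hc2 _ _ rfl rfl
  have hRC : R C := hD3.trans hD2
  have hfinal : M (t + N) D.1 D.2 = M T D.1 D.2 := by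
    rw [← hi0]
    rcases g6 with g6 | g6
    · refine eq_of_strict_loop h.closed h.exc hT hR hnum hside hL (x := fun i => (S i).1)
        (y := fun i => (S i).2) (a := fun i => (c (S i) (S (i + 1))).1)
        (b := fun i => (c (S i) (S (i + 1))).2) (fun i => by rw [hper]) (fun i => by rw [hper])
        (fun i => by rw [hper, hper1]) (fun i => by rw [hper, hper1])
        (fun i => hc1 _ _ (hSr i)) (by rw [hS0]; exact hRC) ?_ i0
      simp only [hc0, hS0, hS1, zero_add]
      have hle : M (t + 1) C.1 a0 + F a0 Q.1 ≤ M (τ + 2) C.1 a0 + F a0 Q.1 :=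
        add_le_add (hT.antitone (by omega) _ _) le_rfl
      refine isStrict_of_le hle ?_ g6
      have h1 := hT.num_eq_of_le (t := t + 1) (by omega) g7
      simp only [nmat] at h1 g7
      rw [num_add, num_add, h1, g7]
    · -- transposition exchanges the ways out and back
      have hexc : ∀ t a c d b, M (t + 1) b a ≤ B c a + M t d c + F b d := fun t a c d b =>
        (h.exc t b d c a).trans (le_of_eq (by abel))
      refine eq_of_strict_loop (M := fun t a b => M t b a) (F := fun a b => B b a)
        (B := fun a b => F b a) (R := fun E => R E.swap) (fun t => (h.closed t).transpose)
        hexc hT.transpose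
        (fun P Q hP hPQ => hR _ _ hP (uses_transpose.1 hPQ)) (fun P hP => hnum _ hP)
        (fun P Q a b hP hPQ => (hside _ _ _ _ hP (tight_transpose.1 hPQ)).symm) hL
        (x := fun i => (S i).2)
        (y := fun i => (S i).1) (a := fun i => (c (S i) (S (i + 1))).2)
        (b := fun i => (c (S i) (S (i + 1))).1) (fun i => by rw [hper]) (fun i => by rw [hper])
        (fun i => by rw [hper, hper1]) (fun i => by rw [hper, hper1])
        (fun i => tight_transpose.2 (hc1 _ _ (hSr i))) (by rw [hS0]; exact hRC) ?_ i0
      simp only [hc0, hS0, hS1, zero_add]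
      have hle : M (t + 1) b0 C.2 + B Q.2 b0 ≤ M (τ + 2) b0 C.2 + B Q.2 b0 :=
        add_le_add (hT.antitone (by omega) _ _) le_rfl
      rw [add_comm] at g6
      refine isStrict_of_le hle ?_ g6
      have h1 := hT.num_eq_of_le (t := t + 1) (by omega) g8
      simp only [nmat] at h1 g8
      rw [num_add, num_add, h1, g8]
  have h1 := stage_le (P := D) hfinal
  omega

/-- A number of rounds after which matrices over `N` vertices do not change any more. A matrix over
a single vertex is constant from the start. -/
def roundBound (N : ℕ) : ℕ := if N ≤ 1 then 0 else N * N

theorem LayerRec.eq_final [Fintype V] (h : LayerRec K F B M) (hT : Settles M T) {t : ℕ}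
    (ht : roundBound (Fintype.card V) ≤ t) : M t = M T := by
  funext a b
  rw [roundBound] at ht
  split_ifs at ht with h1
  · have : a = b := Fintype.card_le_one_iff.1 h1 a b
    rw [this, (h.closed _).diag, (h.closed _).diag]
  · exact hT.eq_of_stage_le (P := (a, b)) ((h.stage_le_sq hT _).trans ht)

end

/-! ### Iterated preimages of a zone -/

/-- The set of points from which `t` steps of the relation `P` lead to `D`. -/
def preIter {V : Type} (P : (V → ℝ) → (V → ℝ) → Prop) (D : Set (V → ℝ)) : ℕ → Set (V → ℝ)
  | 0 => D
  | t + 1 => {y | ∃ y' ∈ preIter P D t, P y y'}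

section

variable {V : Type}

/-- Two copies of the vertices; the constraints `K` are imposed on the first copy and `W` on the
second one, and `Γ` between them. -/
def layerGraph (Γ : V ⊕ V → V ⊕ V → Weight) (W : V → V → Weight) : V ⊕ V → V ⊕ V → Weight
  | .inl a, .inl b => min (Γ (.inl a) (.inl b)) (Γ (.inr a) (.inr b))
  | .inr a, .inr b => W a b
  | u, v => Γ u v

theorem sum_elim_mem_sol {G : V ⊕ V → V ⊕ V → Weight} {y y' : V → ℝ} :
    Sum.elim y y' ∈ Sol G ↔
      (y ∈ Sol fun a b => G (.inl a) (.inl b)) ∧ (y' ∈ Sol fun a b => G (.inr a) (.inr b)) ∧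
      (∀ a b, wsat (y' b - y a) (G (.inl a) (.inr b))) ∧
      ∀ a b, wsat (y b - y' a) (G (.inr a) (.inl b)) := by
  constructor
  · intro h
    exact ⟨fun a b => h (.inl a) (.inl b), fun a b => h (.inr a) (.inr b),
      fun a b => h (.inl a) (.inr b), fun a b => h (.inr a) (.inl b)⟩
  · rintro ⟨h1, h2, h3, h4⟩ (a | a) (b | b)
    · exact h1 a b
    · exact h3 a b
    · exact h4 a b
    · exact h2 a b

theorem mem_sol_min {G H : V → V → Weight} {y : V → ℝ} :
    (y ∈ Sol fun a b => min (G a b) (H a b)) ↔ y ∈ Sol G ∧ y ∈ Sol H := by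
  constructor
  · exact fun h => ⟨fun a b => (wsat_min.1 (h a b)).1, fun a b => (wsat_min.1 (h a b)).2⟩
  · exact fun h a b => wsat_min.2 ⟨h.1 a b, h.2 a b⟩

/-- Walks in `layerGraph Γ W` between vertices of the first copy decompose into edges of the first
copy and excursions. Consecutive edges within the second copy are merged, since `W` is closed. -/
theorem der_of_walk {Γ : V ⊕ V → V ⊕ V → Weight} {W : V → V → Weight} (hW : Closed W) {a₀ b : V}
    (l : List (V ⊕ V)) :
    (∀ a w₀, Der (fun a b => layerGraph Γ W (.inl a) (.inl b)) (fun a b => Γ (.inl a) (.inr b))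
        (fun a b => Γ (.inr a) (.inl b)) W a₀ a w₀ →
      ∃ w', Der (fun a b => layerGraph Γ W (.inl a) (.inl b)) (fun a b => Γ (.inl a) (.inr b))
        (fun a b => Γ (.inr a) (.inl b)) W a₀ b w' ∧
        w' ≤ w₀ + walkWeight (layerGraph Γ W) (.inl a) l (.inl b)) ∧
    (∀ a c d w₀, Der (fun a b => layerGraph Γ W (.inl a) (.inl b)) (fun a b => Γ (.inl a) (.inr b))
        (fun a b => Γ (.inr a) (.inl b)) W a₀ a w₀ →
      ∃ w', Der (fun a b => layerGraph Γ W (.inl a) (.inl b)) (fun a b => Γ (.inl a) (.inr b))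
        (fun a b => Γ (.inr a) (.inl b)) W a₀ b w' ∧
        w' ≤ w₀ + (Γ (.inl a) (.inr c) + W c d) +
          walkWeight (layerGraph Γ W) (.inr d) l (.inl b)) := by
  induction l with
  | nil =>
    refine ⟨fun a w₀ h => ⟨_, h.stat b, le_rfl⟩, fun a c d w₀ h => ⟨_, h.exc c d b, ?_⟩⟩
    refine le_of_eq ?_
    rw [walkWeight]
    simp only [layerGraph, add_assoc]
  | cons e l ih =>
    obtain ⟨ih1, ih2⟩ := ih
    simp only [walkWeight, wadd_eq_add]
    rcases e with e | e
    · constructor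
      · intro a w₀ h
        obtain ⟨w', h1, h2⟩ := ih1 e _ (h.stat e)
        exact ⟨w', h1, h2.trans (by rw [add_assoc])⟩
      · intro a c d w₀ h
        obtain ⟨w', h1, h2⟩ := ih1 e _ (h.exc c d e)
        refine ⟨w', h1, h2.trans (le_of_eq ?_)⟩
        simp only [layerGraph, add_assoc]
    · constructor
      · intro a w₀ h
        obtain ⟨w', h1, h2⟩ := ih2 a e e _ h
        refine ⟨w', h1, h2.trans (le_of_eq ?_)⟩
        rw [hW.diag, add_zero, add_assoc]
        rfl
      · intro a c d w₀ h
        obtain ⟨w', h1, h2⟩ := ih2 a c e _ h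
        refine ⟨w', h1, h2.trans ?_⟩
        rw [← add_assoc (w₀ + (Γ (.inl a) (.inr c) + W c d))]
        refine add_le_add ?_ le_rfl
        rw [add_assoc w₀, add_assoc (Γ (.inl a) (.inr c))]
        exact add_le_add le_rfl (add_le_add le_rfl (hW.tri c d e))

/-- A decreasing sequence of weights that is bounded below by a finite weight is finally constant.
-/
theorem exists_forall_ge_eq {f : ℕ → Weight} (hf : ∀ t, f (t + 1) ≤ f t) (c : ℤ)
    (hc : ∀ t, wmk c false ≤ f t) : ∃ T, ∀ t, T ≤ t → f t = f T := by
  -- weights above a fixed one are enumerated by natural numbers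
  let g : ℤ ×ₗ Bool → ℕ := fun a => (2 * ((ofLex a).1 - c)).toNat + (ofLex a).2.toNat
  let e : Weight → WithTop ℕ := WithTop.map g
  have he : ∀ a b, wmk c false ≤ b → b ≤ a → e a = e b → a = b := by
    intro a b h1 h2 h3
    rcases weight_cases a with rfl | ⟨d, s, rfl⟩
    · rcases weight_cases b with rfl | ⟨d', s', rfl⟩
      · rfl
      · exact absurd h3.symm (WithTop.coe_ne_top)
    · rcases weight_cases b with rfl | ⟨d', s', rfl⟩
      · exact absurd h3.symm (WithTop.coe_ne_top.symm)
      · have h3' : (2 * (d - c)).toNat + s.toNat = (2 * (d' - c)).toNat + s'.toNat :=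
          WithTop.coe_injective h3
        rw [wmk_le_wmk] at h1 h2
        rw [wmk_inj]
        cases s <;> cases s' <;> simp at * <;> omega
  have hanti : Antitone fun t => f t := antitone_nat_of_succ_le hf
  have hne : (Set.range fun t => e (f t)).Nonempty := ⟨_, 0, rfl⟩
  have hemono : ∀ a b, wmk c false ≤ b → b ≤ a → e b ≤ e a := by
    intro a b h1 h2
    rcases weight_cases a with rfl | ⟨d, s, rfl⟩
    · exact le_top
    · rcases weight_cases b with rfl | ⟨d', s', rfl⟩
      · exact absurd (top_le_iff.1 h2) (wmk_ne_top _ _)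
      · refine WithTop.coe_le_coe.2 ?_
        change (2 * (d' - c)).toNat + s'.toNat ≤ (2 * (d - c)).toNat + s.toNat
        rw [wmk_le_wmk] at h1 h2
        cases s <;> cases s' <;> simp at * <;> omega
  obtain ⟨T, hT⟩ := WellFounded.min_mem wellFounded_lt _ hne
  refine ⟨T, fun t ht => (he _ _ (hc t) (hanti ht) (le_antisymm ?_ ?_)).symm⟩
  · dsimp only at hT
    rw [hT]
    exact not_lt.1 (WellFounded.not_lt_min wellFounded_lt (Set.range fun t => e (f t)) ⟨t, rfl⟩)
  · exact hemono _ _ (hc t) (hanti ht)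

variable [Fintype V]

theorem Closed.exists_sum_elim_iff {Γ : V ⊕ V → V ⊕ V → Weight} (hΓ : Closed Γ) {y' : V → ℝ} :
    (y' ∈ Sol fun a b => Γ (.inr a) (.inr b)) ↔ ∃ y, Sum.elim y y' ∈ Sol Γ := by
  rw [hΓ.sol_comap Sum.inr]
  constructor
  · rintro ⟨q, hq, h⟩
    refine ⟨fun a => q (.inl a), ?_⟩
    convert hq using 1
    ext (a | a)
    · rfl
    · exact h a
  · rintro ⟨y, hy⟩
    exact ⟨_, hy, fun _ => rfl⟩

/-- The iterated preimages of a zone under a zone relation do not change any more after `N ^ 2`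
rounds, if they contain points of bounded extent that are also in the image of the relation. -/
theorem preIter_stable {P : (V → ℝ) → (V → ℝ) → Prop} {D : Set (V → ℝ)}
    {Γ : V ⊕ V → V ⊕ V → Weight} {Δ : V → V → Weight} (hΓ : Closed Γ)
    (hP : ∀ y y', P y y' ↔ Sum.elim y y' ∈ Sol Γ) (hD : D = Sol Δ)
    (hsub : preIter P D 1 ⊆ D) {C : ℤ}
    (hbdd : ∀ t, ∃ y ∈ preIter P D t, (∃ x, P x y) ∧ ∀ a b, |y b - y a| ≤ C) {t : ℕ}
    (ht : roundBound (Fintype.card V) ≤ t) :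
    preIter P D (t + 2) = preIter P D (t + 1) := by
  have hanti : ∀ t, preIter P D (t + 1) ⊆ preIter P D t := by
    intro t
    induction t with
    | zero => exact hsub
    | succ t ih => exact fun y ⟨y', h1, h2⟩ => ⟨y', ih h1, h2⟩
  -- the recursion intersects with the image `I` of `P`, which does not affect further preimages
  set I : Set (V → ℝ) := {y | ∃ x, P x y} with hI
  have hIsol : I = Sol fun a b => Γ (.inr a) (.inr b) := by
    ext y
    rw [hΓ.exists_sum_elim_iff]
    simp only [hI, hP, Set.mem_ofPred_eq]
  have hne : ∀ t, (I ∩ preIter P D t).Nonempty := fun t => by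
    obtain ⟨y, h1, h2, -⟩ := hbdd t
    exact ⟨y, h2, h1⟩
  -- the canonical matrices of the zones `I ∩ preIter P D t`
  let M : ℕ → V → V → Weight := fun t => Nat.rec
    (canon fun a b => min (Γ (.inr a) (.inr b)) (Δ a b))
    (fun _ W a b => canon (layerGraph Γ W) (.inl a) (.inl b)) t
  have hM0 : M 0 = canon fun a b => min (Γ (.inr a) (.inr b)) (Δ a b) := rfl
  have hMs : ∀ t, M (t + 1) = fun a b => canon (layerGraph Γ (M t)) (.inl a) (.inl b) :=
    fun t => rfl
  have hlayer : ∀ t, Sol (M t) = I ∩ preIter P D t →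
      {p | ∃ q ∈ Sol (layerGraph Γ (M t)), ∀ a, p a = q (.inl a)} = I ∩ preIter P D (t + 1) := by
    intro t hMt
    ext y
    constructor
    · rintro ⟨q, hq, hy⟩
      obtain rfl : y = fun a => q (.inl a) := funext hy
      rw [show q = Sum.elim (fun a => q (.inl a)) (fun a => q (.inr a)) by
        ext (a | a) <;> rfl, sum_elim_mem_sol] at hq
      obtain ⟨h1, h2, h3, h4⟩ := hq
      have h1' := mem_sol_min.1 h1
      have h2' : (fun a => q (.inr a)) ∈ I ∩ preIter P D t := by
        rw [← hMt]
        exact h2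
      refine ⟨by rw [hIsol]; exact h1'.2, _, h2'.2, (hP _ _).2 (sum_elim_mem_sol.2
        ⟨h1'.1, ?_, h3, h4⟩)⟩
      have := h2'.1
      rwa [hIsol] at this
    · rintro ⟨h1, y', h2, h3⟩
      have h4 := sum_elim_mem_sol.1 ((hP _ _).1 h3)
      refine ⟨Sum.elim y y', sum_elim_mem_sol.2 ⟨mem_sol_min.2 ⟨h4.1, ?_⟩, ?_, h4.2.2.1, h4.2.2.2⟩,
        fun _ => rfl⟩
      · rwa [hIsol] at h1
      · change y' ∈ Sol (M t)
        rw [hMt]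
        exact ⟨⟨y, h3⟩, h2⟩
  have hM : ∀ t, Closed (M t) ∧ Sol (M t) = I ∩ preIter P D t := by
    intro t
    induction t with
    | zero =>
      have hs : (Sol fun a b => min (Γ (.inr a) (.inr b)) (Δ a b)) = I ∩ preIter P D 0 := by
        ext y
        rw [mem_sol_min, hIsol, preIter, hD]
        rfl
      have hc : ¬ HasNegativeCycle fun a b => min (Γ (.inr a) (.inr b)) (Δ a b) := by
        obtain ⟨y, hy⟩ := hne 0
        rw [← hs] at hy
        exact not_hasNegativeCycle_of_mem_sol hy
      exact ⟨(canon_spec hc).1, by rw [hM0, sol_canon hc, hs]⟩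
    | succ t ih =>
      have hl := hlayer t ih.2
      have hn : (Sol (layerGraph Γ (M t))).Nonempty := by
        obtain ⟨y, hy⟩ := hne (t + 1)
        rw [← hl] at hy
        exact ⟨_, hy.choose_spec.1⟩
      obtain ⟨h1, h2⟩ := exists_closed_of_projection hn (Sum.inl : V → V ⊕ V)
      exact ⟨h1, by rw [hMs, h2, hl]⟩
  have hspec : ∀ t, Closed (canon (layerGraph Γ (M t))) ∧
      (∀ u v, canon (layerGraph Γ (M t)) u v ≤ layerGraph Γ (M t) u v) ∧
      ∀ u v, canon (layerGraph Γ (M t)) u v ∈ pathWeights (layerGraph Γ (M t)) u v := by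
    intro t
    refine canon_spec ?_
    obtain ⟨y, hy⟩ := hne (t + 1)
    rw [← hlayer t (hM t).2] at hy
    exact not_hasNegativeCycle_of_mem_sol hy.choose_spec.1
  have hrec : LayerRec (fun a b => min (Γ (.inl a) (.inl b)) (Γ (.inr a) (.inr b)))
      (fun a b => Γ (.inl a) (.inr b)) (fun a b => Γ (.inr a) (.inl b)) M := by
    have hexc : ∀ t a c d b, M (t + 1) a b ≤
        Γ (.inl a) (.inr c) + M t c d + Γ (.inr d) (.inl b) := by
      intro t a c d b
      obtain ⟨h1, h2, -⟩ := hspec t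
      exact (h1.tri _ (.inr d) _).trans (add_le_add ((h1.tri _ (.inr c) _).trans
        (add_le_add (h2 _ _) (h2 _ _))) (h2 _ _))
    have hstat : ∀ t a b, M (t + 1) a b ≤ min (Γ (.inl a) (.inl b)) (Γ (.inr a) (.inr b)) :=
      fun t a b => (hspec t).2.1 (.inl a) (.inl b)
    refine ⟨fun t => (hM t).1, ?_, hstat, hexc, ?_⟩
    · intro t a b
      refine (hM (t + 1)).1.le_of_sol_subset (fun u => ((hM t).1.diag u).ge) ?_ a b
      rw [(hM t).2, (hM (t + 1)).2]
      exact Set.inter_subset_inter_right _ (hanti t)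
    · intro t a b
      have hder_ge : ∀ {b w}, Der (fun a b => min (Γ (.inl a) (.inl b)) (Γ (.inr a) (.inr b)))
          (fun a b => Γ (.inl a) (.inr b)) (fun a b => Γ (.inr a) (.inl b)) (M t) a b w →
          M (t + 1) a b ≤ w := by
        intro b w hw
        induction hw with
        | nil => exact ((hM (t + 1)).1.diag _).le
        | stat c _ ih => exact ((hM (t + 1)).1.tri _ _ _).trans (add_le_add ih (hstat _ _ _))
        | exc c d e _ ih => exact ((hM (t + 1)).1.tri _ _ _).trans (add_le_add ih (hexc _ _ _ _ _))
      rcases (hspec t).2.2 (.inl a) (.inl b) with ⟨h1, h2⟩ | ⟨l, hl⟩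
      · obtain rfl : a = b := Sum.inl_injective h1
        rw [(hM (t + 1)).1.diag]
        exact Der.nil _
      · obtain ⟨w', h1, h2⟩ :=
          (der_of_walk (Γ := Γ) (hM t).1 (a₀ := a) (b := b) l).1 a 0 (Der.nil _)
        have h3 := hder_ge h1
        rw [zero_add, ← hl] at h2
        rw [show M (t + 1) a b = w' from le_antisymm h3 h2]
        exact h1
  -- the bounded points keep the matrices from decreasing for ever
  have hlow : ∀ t a b, wmk (-C - 1) false ≤ M t a b := by
    intro t a b
    obtain ⟨y, h1, h2, h3⟩ := hbdd t
    have h4 : y ∈ Sol (M t) := by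
      rw [(hM t).2]
      exact ⟨h2, h1⟩
    have h5 := h4 a b
    rcases weight_cases (M t a b) with h6 | ⟨d, s, h6⟩
    · rw [h6]
      exact le_top
    · rw [h6] at h5 ⊢
      rw [wmk_le_wmk]
      left
      have h7 : -(C : ℝ) ≤ d := by
        have h8 := (abs_le.1 (h3 a b)).1
        rw [wsat_wmk] at h5
        cases s <;> simp at h5 <;> linarith
      have h9 : -C ≤ d := by exact_mod_cast h7
      omega
  have hconst : ∀ a b, ∃ T, ∀ t, T ≤ t → M t a b = M T a b := fun a b =>
    exists_forall_ge_eq (fun t => hrec.anti t a b) _ fun t => hlow t a b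
  choose T hT using hconst
  set T₀ := Finset.univ.sup fun p : V × V => T p.1 p.2 with hT₀
  have hTle : ∀ a b, T a b ≤ T₀ := fun a b =>
    Finset.le_sup (f := fun p : V × V => T p.1 p.2) (Finset.mem_univ (a, b))
  have hset : Settles M T₀ := ⟨hrec.anti, fun t ht => by
    funext a b
    rw [hT a b t ((hTle a b).trans ht), hT a b T₀ (hTle a b)]⟩
  have e1 := hrec.eq_final hset ht
  have e2 := hrec.eq_final hset (t := t + 1) (by omega)
  have e3 : I ∩ preIter P D t = I ∩ preIter P D (t + 1) := by
    rw [← (hM t).2, ← (hM (t + 1)).2, e1, e2]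
  refine Set.Subset.antisymm (hanti _) ?_
  rintro y ⟨y', h1, h2⟩
  have h3 : y' ∈ I ∩ preIter P D t := ⟨⟨y, h2⟩, h1⟩
  rw [e3] at h3
  exact ⟨y', h3.2, h2⟩

end

/-! ### The relations described by transformation graphs -/

/-- One step of a transition on difference variables: `p x` is the value of the clock `x` minus the
current time, and `p 0` is minus the current time. -/
def RStep {n : ℕ} (t : Transition n) (p q : X n → ℝ) : Prop :=
  q 0 ≤ p 0 ∧ (∀ a ∈ t.guard, a.rel.holds (p a.clock.succ - q 0) a.const) ∧
    ∀ i : Fin n, if i ∈ t.reset then q i.succ = q 0 ∧ q 0 ≤ p i.succ else q i.succ = p i.succ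

/-- Execution of a sequence on difference variables. -/
def RExec {n : ℕ} : List (Transition n) → (X n → ℝ) → (X n → ℝ) → Prop
  | [], p, q => p = q
  | t :: σ, p, q => ∃ m, RStep t p m ∧ RExec σ m q

/-- The relation between the values of the leftmost and the rightmost variables. -/
def GRel {n k : ℕ} (G : TGraph n k) (p q : X n → ℝ) : Prop :=
  ∃ r ∈ Sol G, (∀ x, r (0, x) = p x) ∧ ∀ x, r (Fin.last k, x) = q x

theorem holds_iff_wsat {n : ℕ} (a : Atom n) (r : ℝ) :
    a.rel.holds r a.const ↔ wsat r a.upper ∧ wsat (-r) a.lower := by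
  obtain ⟨x, rel, c⟩ := a
  cases rel <;> simp [Rel.holds, Atom.upper, Atom.lower, wsat_wle, wsat_wlt, wsat_top]
  exact le_antisymm_iff

theorem wsat_guardUpper {n : ℕ} {x : Fin n} {g : List (Atom n)} {r : ℝ} :
    wsat r (guardUpper x g) ↔ ∀ a ∈ g, a.clock = x → wsat r a.upper := by
  induction g with
  | nil => simp [guardUpper, wsat_top]
  | cons a g ih =>
    rw [guardUpper]
    split_ifs with h <;> simp [ih, h, wsat_min]

theorem wsat_guardLower {n : ℕ} {x : Fin n} {g : List (Atom n)} {r : ℝ} :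
    wsat r (guardLower x g) ↔ ∀ a ∈ g, a.clock = x → wsat r a.lower := by
  induction g with
  | nil => simp [guardLower, wsat_top]
  | cons a g ih =>
    rw [guardLower]
    split_ifs with h <;> simp [ih, h, wsat_min]

theorem mem_sol_guardEdge {n : ℕ} {g : List (Atom n)} {m : X n → ℝ} :
    m ∈ Sol (guardEdge g) ↔ ∀ a ∈ g, a.rel.holds (m a.clock.succ - m 0) a.const := by
  constructor
  · intro h a ha
    rw [holds_iff_wsat]
    have h1 := h 0 a.clock.succ
    have h2 := h a.clock.succ 0
    change wsat _ (guardUpper a.clock g) at h1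
    change wsat _ (guardLower a.clock g) at h2
    rw [neg_sub]
    exact ⟨wsat_guardUpper.1 h1 a ha rfl, wsat_guardLower.1 h2 a ha rfl⟩
  · intro h x y
    refine Fin.cases ?_ (fun i => ?_) x <;> refine Fin.cases ?_ (fun j => ?_) y
    · exact wsat_top _
    · refine wsat_guardUpper.2 ?_
      intro a ha hj
      obtain rfl : a.clock = j := hj
      exact ((holds_iff_wsat a _).1 (h a ha)).1
    · refine wsat_guardLower.2 ?_
      intro a ha hi
      obtain rfl : a.clock = i := hi
      have := ((holds_iff_wsat a _).1 (h a ha)).2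
      rwa [neg_sub] at this
    · exact wsat_top _

theorem wsat_ite_zero {c : Prop} [Decidable c] {r : ℝ} :
    wsat r (if c then wle 0 else ⊤) ↔ (c → r ≤ 0) := by
  split_ifs with h <;> simp [h, wsat_wle, wsat_top]

theorem inReset_succ {n : ℕ} (R : Finset (Fin n)) (i : Fin n) :
    inReset R i.succ = decide (i ∈ R) := rfl

/-- The graph of a transition describes its effect on difference variables; the middle column holds
the state after the delay. -/
theorem grel_transGraph {n : ℕ} (t : Transition n) (p q : X n → ℝ) :
    GRel (transGraph t) p q ↔ RStep t p q := by
  constructor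
  · rintro ⟨r, hr, hp, hq⟩
    have hq' : ∀ x, r (2, x) = q x := hq
    have h01 : ∀ x, r (1, x) ≤ p x := by
      intro x
      have := wsat_ite_zero.1 (hr (0, x) (1, x)) rfl
      linarith [hp x]
    have h10 : ∀ i : Fin n, r (1, i.succ) = p i.succ := by
      intro i
      have := wsat_ite_zero.1 (hr (1, i.succ) (0, i.succ)) ⟨rfl, Fin.succ_ne_zero i⟩
      refine le_antisymm (h01 _) ?_
      linarith [hp i.succ]
    have h12 : ∀ x, q x ≤ r (1, x) := by
      intro x
      have := wsat_ite_zero.1 (hr (1, x) (2, x)) rfl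
      linarith [hq' x]
    have h21 : ∀ x, inReset t.reset x = false → q x = r (1, x) := by
      intro x hx
      have := wsat_ite_zero.1 (hr (2, x) (1, x)) ⟨rfl, hx⟩
      refine le_antisymm (h12 _) ?_
      linarith [hq' x]
    have h0 := h21 0 rfl
    refine ⟨h0.le.trans (h01 0), ?_, ?_⟩
    · have hg : (fun x => r (1, x)) ∈ Sol (guardEdge t.guard) := fun x y => hr (1, x) (1, y)
      intro a ha
      have := mem_sol_guardEdge.1 hg a ha
      rwa [h10, ← h0] at this
    · intro i
      split_ifs with hi
      · have e1 := wsat_ite_zero.1 (hr (2, 0) (2, i.succ)) (Or.inl ⟨rfl, by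
          simp [inReset_succ, hi]⟩)
        have e2 := wsat_ite_zero.1 (hr (2, i.succ) (2, 0)) (Or.inr ⟨by
          simp [inReset_succ, hi], rfl⟩)
        rw [hq', hq'] at e1 e2
        have e3 := h12 i.succ
        rw [h10] at e3
        exact ⟨by linarith, by linarith⟩
      · rw [h21 _ (by simp [inReset_succ, hi]), h10]
  · rintro ⟨h1, h2, h3⟩
    set m : X n → ℝ := fun x => if x = 0 then q 0 else p x with hm
    have hm0 : m 0 = q 0 := by simp [hm]
    have hms : ∀ i : Fin n, m i.succ = p i.succ := fun i => by simp [hm]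
    have hqm : ∀ x, q x ≤ m x := by
      intro x
      refine Fin.cases hm0.ge (fun i => ?_) x
      rw [hms]
      have := h3 i
      split_ifs at this
      · rw [this.1]; exact this.2
      · exact this.le
    refine ⟨fun u => if u.1 = 0 then p u.2 else if u.1 = 1 then m u.2 else q u.2, ?_,
      fun x => by simp, fun x => by simp [Fin.last]⟩
    rintro ⟨i, x⟩ ⟨j, y⟩
    dsimp only
    fin_cases i <;> fin_cases j
    · exact wsat_top _
    · change wsat (m y - p x) (if x = y then wle 0 else ⊤)
      rw [wsat_ite_zero]
      rintro rfl
      refine Fin.cases ?_ (fun i => ?_) x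
      · rw [hm0]; linarith
      · rw [hms]; linarith
    · exact wsat_top _
    · change wsat (p y - m x) (if x = y ∧ x ≠ 0 then wle 0 else ⊤)
      rw [wsat_ite_zero]
      rintro ⟨rfl, hx⟩
      obtain ⟨i, rfl⟩ := Fin.exists_succ_eq.2 hx
      rw [hms]; linarith
    · change wsat (m y - m x) (guardEdge t.guard x y)
      refine mem_sol_guardEdge.2 ?_ x y
      intro a ha
      rw [hms, hm0]
      exact h2 a ha
    · change wsat (q y - m x) (if x = y then wle 0 else ⊤)
      rw [wsat_ite_zero]
      rintro rfl
      linarith [hqm x]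
    · exact wsat_top _
    · change wsat (m y - q x) (if x = y ∧ inReset t.reset x = false then wle 0 else ⊤)
      rw [wsat_ite_zero]
      rintro ⟨rfl, hx⟩
      revert hx
      refine Fin.cases ?_ (fun i => ?_) x
      · intro _; rw [hm0]; linarith
      · intro hx
        rw [inReset_succ, decide_eq_false_iff_not] at hx
        have := h3 i
        rw [if_neg hx] at this
        rw [hms]; linarith
    · change wsat (q y - q x) (if (x = 0 ∧ inReset t.reset y = true) ∨
        (inReset t.reset x = true ∧ y = 0) then wle 0 else ⊤)
      rw [wsat_ite_zero]
      have key : ∀ z, inReset t.reset z = true → q z = q 0 := by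
        intro z
        refine Fin.cases (fun h => rfl) (fun i hi => ?_) z
        rw [inReset_succ, decide_eq_true_eq] at hi
        have := h3 i
        rw [if_pos hi] at this
        exact this.1
      rintro (⟨rfl, hy⟩ | ⟨hx, rfl⟩)
      · rw [key y hy]; linarith
      · rw [key x hx]; linarith

theorem grel_comp {n k l : ℕ} (G : TGraph n k) (H : TGraph n l) (p q : X n → ℝ) :
    GRel (comp G H) p q ↔ ∃ m, GRel G p m ∧ GRel H m q := by
  constructor
  · rintro ⟨r, hr, hp, hq⟩
    have hj : ∀ x, r (Fin.castAdd (l + 1) (Fin.last k), x) =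
        r (Fin.natAdd (k + 1) (0 : Fin (l + 1)), x) := by
      intro x
      have h1 := hr (Fin.castAdd (l + 1) (Fin.last k), x) (Fin.natAdd (k + 1) (0 : Fin (l + 1)), x)
      have h2 := hr (Fin.natAdd (k + 1) (0 : Fin (l + 1)), x) (Fin.castAdd (l + 1) (Fin.last k), x)
      simp only [comp, Fin.addCases_left, Fin.addCases_right, true_and, if_true, wsat_wle,
        Int.cast_zero] at h1 h2
      linarith
    refine ⟨fun x => r (Fin.castAdd (l + 1) (Fin.last k), x),
      ⟨fun u => r (Fin.castAdd (l + 1) u.1, u.2), ?_, hp, fun x => rfl⟩,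
      ⟨fun u => r (Fin.natAdd (k + 1) u.1, u.2), ?_, fun x => (hj x).symm, hq⟩⟩
    · rintro ⟨i, x⟩ ⟨j, y⟩
      have := hr (Fin.castAdd (l + 1) i, x) (Fin.castAdd (l + 1) j, y)
      simpa only [comp, Fin.addCases_left] using this
    · rintro ⟨i, x⟩ ⟨j, y⟩
      have := hr (Fin.natAdd (k + 1) i, x) (Fin.natAdd (k + 1) j, y)
      simpa only [comp, Fin.addCases_right] using this
  · rintro ⟨m, ⟨r, hr, hp, hm⟩, s, hs, hm', hq⟩
    set w : Vertex n (k + 1 + l) → ℝ := fun u =>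
      Fin.addCases (m := k + 1) (n := l + 1) (motive := fun _ => ℝ)
        (fun i => r (i, u.2)) (fun i => s (i, u.2)) u.1 with hw
    refine ⟨w, ?_, ?_, ?_⟩
    · rintro ⟨i, x⟩ ⟨j, y⟩
      simp only [hw]
      refine Fin.addCases (m := k + 1) (n := l + 1) (fun i => ?_) (fun i => ?_) i <;>
        refine Fin.addCases (m := k + 1) (n := l + 1) (fun j => ?_) (fun j => ?_) j
      · simp only [comp, Fin.addCases_left]
        exact hr (i, x) (j, y)
      · simp only [comp, Fin.addCases_left, Fin.addCases_right]
        rw [wsat_ite_zero]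
        rintro ⟨rfl, rfl, rfl⟩
        rw [hm, hm', sub_self]
      · simp only [comp, Fin.addCases_left, Fin.addCases_right]
        rw [wsat_ite_zero]
        rintro ⟨rfl, rfl, rfl⟩
        rw [hm, hm', sub_self]
      · simp only [comp, Fin.addCases_right]
        exact hs (i, x) (j, y)
    · intro x
      rw [← hp x]
      exact Fin.addCases_left (m := k + 1) (n := l + 1) (motive := fun _ => ℝ) (0 : Fin (k + 1))
    · intro x
      rw [← hq x]
      exact Fin.addCases_right (m := k + 1) (n := l + 1) (motive := fun _ => ℝ) (Fin.last l)

theorem grel_seqGraph {n : ℕ} (t : Transition n) (σ : List (Transition n)) (p q : X n → ℝ) :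
    GRel (seqGraph t σ) p q ↔ RExec (t :: σ) p q := by
  induction σ generalizing t p with
  | nil =>
    refine (grel_transGraph t p q).trans ?_
    simp [RExec]
  | cons s σ ih =>
    refine (grel_comp (transGraph t) (seqGraph s σ) p q).trans ?_
    simp only [grel_transGraph, ih]
    rfl

/-- The inclusion of the outer columns. -/
def outerIncl {n : ℕ} (k : ℕ) (u : Vertex n 1) : Vertex n k :=
  (if u.1 = 0 then 0 else Fin.last k, u.2)

theorem mem_sol_two_columns {n : ℕ} {G : TGraph n 1} {p q : X n → ℝ} :
    GRel G p q ↔ (fun u : Vertex n 1 => if u.1 = 0 then p u.2 else q u.2) ∈ Sol G := by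
  constructor
  · rintro ⟨r, hr, hp, hq⟩
    convert hr using 1
    ext ⟨i, x⟩
    fin_cases i
    · simp [hp]
    · exact (hq x).symm
  · intro h
    exact ⟨_, h, fun x => by simp, fun x => by simp [Fin.last]⟩

/-- The short graph is undefined if and only if the graph describes the empty relation. -/
theorem short_eq_none_iff {n k : ℕ} {G : TGraph n k} :
    short G = none ↔ ∀ p q, ¬ GRel G p q := by
  rw [short]
  split_ifs with h
  · simp only [true_iff]
    rintro p q ⟨r, hr, -⟩
    exact not_hasNegativeCycle_of_mem_sol hr h
  · simp only [false_iff, not_forall, not_not]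
    rw [hasNegativeCycle_iff_sol_eq_empty, ← Ne, ← Set.nonempty_iff_ne_empty] at h
    obtain ⟨r, hr⟩ := h
    exact ⟨_, _, r, hr, fun _ => rfl, fun _ => rfl⟩

/-- Passing to the short graph does not change the relation. -/
theorem short_eq_some {n k : ℕ} {G : TGraph n k} {H : TGraph n 1} (h : short G = some H) :
    Closed H ∧ ∀ p q, GRel H p q ↔ GRel G p q := by
  rw [short] at h
  split_ifs at h with hc
  obtain rfl : outer (canon G) = H := Option.some.inj h
  rw [hasNegativeCycle_iff_sol_eq_empty, ← Ne, ← Set.nonempty_iff_ne_empty] at hc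
  obtain ⟨h1, h2⟩ := exists_closed_of_projection hc (outerIncl (n := n) k)
  refine ⟨h1, fun p q => ?_⟩
  rw [mem_sol_two_columns]
  change _ ∈ Sol (fun a b => canon G (outerIncl k a) (outerIncl k b)) ↔ _
  rw [h2]
  constructor
  · rintro ⟨r, hr, h3⟩
    refine ⟨r, hr, fun x => (h3 (0, x)).symm, fun x => ?_⟩
    have := h3 (1, x)
    simpa [outerIncl] using this.symm
  · rintro ⟨r, hr, hp, hq⟩
    refine ⟨r, hr, ?_⟩
    rintro ⟨i, x⟩
    fin_cases i
    · simp [outerIncl, hp]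
    · simp [outerIncl, hq]

/-- The short graph only depends on the relation that is described. -/
theorem short_congr {n k l : ℕ} {G : TGraph n k} {H : TGraph n l}
    (h : ∀ p q, GRel G p q ↔ GRel H p q) : short G = short H := by
  rcases hG : short G with _ | G'
  · rw [eq_comm, short_eq_none_iff]
    rw [short_eq_none_iff] at hG
    exact fun p q hpq => hG p q ((h p q).2 hpq)
  · rcases hH : short H with _ | H'
    · rw [short_eq_none_iff] at hH
      rw [short_eq_none_iff.2 fun p q hpq => hH p q ((h p q).1 hpq)] at hG
      cases hG
    · obtain ⟨g1, g2⟩ := short_eq_some hG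
      obtain ⟨k1, k2⟩ := short_eq_some hH
      congr 1
      refine g1.eq_of_sol_eq k1 ?_
      ext r
      have e : r = fun u : Vertex n 1 => if u.1 = 0 then r (0, u.2) else r (1, u.2) := by
        ext ⟨i, x⟩
        fin_cases i <;> simp
      rw [e, ← mem_sol_two_columns (G := G') (p := fun x => r (0, x)) (q := fun x => r (1, x)),
        ← mem_sol_two_columns (G := H') (p := fun x => r (0, x)) (q := fun x => r (1, x)), g2,
        k2, h]

/-- The `m`-fold iteration of a relation. -/
def Iter {α : Type} (R : α → α → Prop) : ℕ → α → α → Prop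
  | 0, p, q => p = q
  | m + 1, p, q => ∃ r, R p r ∧ Iter R m r q

theorem iter_add {α : Type} {R : α → α → Prop} {a b : ℕ} {p q : α} :
    Iter R (a + b) p q ↔ ∃ r, Iter R a p r ∧ Iter R b r q := by
  induction a generalizing p with
  | zero => simp [Iter]
  | succ a ih =>
    rw [Nat.succ_add]
    simp only [Iter, ih]
    constructor
    · rintro ⟨r, h1, s, h2, h3⟩
      exact ⟨s, ⟨r, h1, h2⟩, h3⟩
    · rintro ⟨s, ⟨r, h1, h2⟩, h3⟩
      exact ⟨r, h1, s, h2, h3⟩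

theorem iter_one {α : Type} {R : α → α → Prop} {p q : α} : Iter R 1 p q ↔ R p q := by
  simp [Iter]

/-- The graph `G^{2^k}` describes the `2^k`-fold iteration of the sequence. -/
theorem power_spec {n : ℕ} (t : Transition n) (σ : List (Transition n)) (k : ℕ) :
    (power (t :: σ) k = none ↔ ∀ p q, ¬ Iter (RExec (t :: σ)) (2 ^ k) p q) ∧
    ∀ G, power (t :: σ) k = some G →
      Closed G ∧ ∀ p q, GRel G p q ↔ Iter (RExec (t :: σ)) (2 ^ k) p q := by
  induction k with
  | zero =>
    simp only [power, pow_zero, iter_one, short_eq_none_iff, grel_seqGraph, true_and]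
    intro G hG
    obtain ⟨h1, h2⟩ := short_eq_some hG
    exact ⟨h1, fun p q => (h2 p q).trans (grel_seqGraph _ _ _ _)⟩
  | succ k ih =>
    obtain ⟨ih1, ih2⟩ := ih
    rcases hp : power (t :: σ) k with _ | G
    · have h0 := ih1.1 hp
      have hn : power (t :: σ) (k + 1) = none := by rw [power, hp]; rfl
      refine ⟨⟨fun _ p q hpq => ?_, fun _ => hn⟩, fun G hG => by rw [hn] at hG; cases hG⟩
      rw [pow_succ, mul_two, iter_add] at hpq
      obtain ⟨r, hr, -⟩ := hpq
      exact h0 _ _ hr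
    · obtain ⟨h1, h2⟩ := ih2 G hp
      have hs : power (t :: σ) (k + 1) = short (comp G G) := by rw [power, hp]; rfl
      have hi : ∀ p q, GRel (comp G G) p q ↔ Iter (RExec (t :: σ)) (2 ^ (k + 1)) p q := by
        intro p q
        rw [grel_comp, pow_succ, mul_two, iter_add]
        simp only [h2]
      rw [hs]
      constructor
      · rw [short_eq_none_iff]
        simp only [hi]
      · intro G' hG'
        obtain ⟨g1, g2⟩ := short_eq_some hG'
        exact ⟨g1, fun p q => (g2 p q).trans (hi p q)⟩

theorem closed_left {n : ℕ} {G : TGraph n 1} (h : Closed G) : Closed (left G) :=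
  h.comap fun x => ((0 : Fin 2), x)

theorem closed_right {n : ℕ} {G : TGraph n 1} (h : Closed G) : Closed (right G) :=
  h.comap fun x => ((1 : Fin 2), x)

theorem sol_left {n : ℕ} {G : TGraph n 1} (h : Closed G) :
    Sol (left G) = {p | ∃ q, GRel G p q} := by
  have := h.sol_comap fun x : X n => ((0 : Fin 2), x)
  rw [show Sol (left G) = _ from this]
  ext p
  constructor
  · rintro ⟨r, hr, hp⟩
    exact ⟨_, r, hr, fun x => (hp x).symm, fun x => rfl⟩
  · rintro ⟨q, r, hr, hp, -⟩
    exact ⟨r, hr, fun x => (hp x).symm⟩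

theorem sol_right {n : ℕ} {G : TGraph n 1} (h : Closed G) :
    Sol (right G) = {q | ∃ p, GRel G p q} := by
  have := h.sol_comap fun x : X n => ((1 : Fin 2), x)
  rw [show Sol (right G) = _ from this]
  ext q
  constructor
  · rintro ⟨r, hr, hq⟩
    exact ⟨_, r, hr, fun x => rfl, fun x => (hq x).symm⟩
  · rintro ⟨p, r, hr, -, hq⟩
    exact ⟨r, hr, fun x => (hq x).symm⟩

/-- For closed graphs, `G ≍ H` means that the relations have the same domain and the same image. -/
theorem similar_iff {n : ℕ} {G H : TGraph n 1} (hG : Closed G) (hH : Closed H) :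
    Similar G H ↔ (∀ p, (∃ q, GRel G p q) ↔ ∃ q, GRel H p q) ∧
      ∀ q, (∃ p, GRel G p q) ↔ ∃ p, GRel H p q := by
  have e1 : left G = left H ↔ Sol (left G) = Sol (left H) :=
    ⟨fun h => by rw [h], (closed_left hG).eq_of_sol_eq (closed_left hH)⟩
  have e2 : right G = right H ↔ Sol (right G) = Sol (right H) :=
    ⟨fun h => by rw [h], (closed_right hG).eq_of_sol_eq (closed_right hH)⟩
  rw [Similar, e1, e2, sol_left hG, sol_left hH, sol_right hG, sol_right hH, Set.ext_iff,
    Set.ext_iff]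
  rfl

theorem mem_zone {n : ℕ} {Z : DBM n} {v : Valuation n} : v ∈ Z.zone ↔ extend v ∈ Sol Z := Iff.rfl

/-! ### Zones over arbitrary index types -/

/-- A set that is described by difference bounds. -/
def IsZone {V : Type} (S : Set (V → ℝ)) : Prop := ∃ G : V → V → Weight, S = Sol G

theorem IsZone.inter {V : Type} {S T : Set (V → ℝ)} (hS : IsZone S) (hT : IsZone T) :
    IsZone (S ∩ T) := by
  obtain ⟨G, rfl⟩ := hS
  obtain ⟨H, rfl⟩ := hT
  exact ⟨fun a b => min (G a b) (H a b), Set.ext fun y => mem_sol_min.symm⟩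

theorem wsat_inf {ι : Type} (s : Finset ι) (f : ι → Weight) (r : ℝ) :
    wsat r (s.inf f) ↔ ∀ i ∈ s, wsat r (f i) := by
  classical
  induction s using Finset.induction_on with
  | empty => simp [wsat_top]
  | insert a s _ ih => rw [Finset.inf_insert, wsat_min, ih]; simp

theorem IsZone.comap {U V : Type} [Fintype V] {S : Set (V → ℝ)} (hS : IsZone S) (f : V → U) :
    IsZone {p : U → ℝ | (fun a => p (f a)) ∈ S} := by
  classical
  obtain ⟨G, rfl⟩ := hS
  refine ⟨fun a b => (Finset.univ.filter fun u : V × V => f u.1 = a ∧ f u.2 = b).inf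
    fun u => G u.1 u.2, ?_⟩
  ext p
  constructor
  · intro h a b
    rw [wsat_inf]
    intro u hu
    obtain ⟨-, rfl, rfl⟩ := Finset.mem_filter.1 hu
    exact h _ _
  · intro h u v
    exact (wsat_inf _ _ _).1 (h (f u) (f v)) (u, v) (by simp)

/-- Zones are closed under projection, or elimination of variables. The index type has to be
nonempty, since without variables no constraint describes the empty set. -/
theorem IsZone.proj {U V : Type} [Fintype U] [Fintype V] [Nonempty U] {S : Set (V → ℝ)}
    (hS : IsZone S) (f : U → V) : IsZone {p : U → ℝ | ∃ q ∈ S, ∀ a, p a = q (f a)} := by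
  obtain ⟨G, rfl⟩ := hS
  rcases (Sol G).eq_empty_or_nonempty with h | h
  · refine ⟨fun _ _ => wle (-1), ?_⟩
    ext p
    simp only [h, Set.mem_empty_iff_false, false_and, exists_false, Set.mem_ofPred_eq, false_iff]
    intro hp
    obtain ⟨u⟩ := ‹Nonempty U›
    have := hp u u
    rw [sub_self, wsat_wle] at this
    norm_num at this
  · exact ⟨_, (exists_closed_of_projection h f).2.symm⟩

theorem isZone_eq {V : Type} [DecidableEq V] (a b : V) : IsZone {p : V → ℝ | p a = p b} := by
  refine ⟨fun u v => if (u = a ∧ v = b) ∨ (u = b ∧ v = a) then wle 0 else ⊤, ?_⟩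
  ext p
  constructor
  · intro h u v
    have h' : p a = p b := h
    dsimp only
    rw [wsat_ite_zero]
    rintro (⟨rfl, rfl⟩ | ⟨rfl, rfl⟩) <;> linarith
  · intro h
    have h1 := wsat_ite_zero.1 (h a b) (Or.inl ⟨rfl, rfl⟩)
    have h2 := wsat_ite_zero.1 (h b a) (Or.inr ⟨rfl, rfl⟩)
    exact le_antisymm (by linarith) (by linarith)

theorem IsZone.exists_closed {V : Type} [Fintype V] {S : Set (V → ℝ)} (hS : IsZone S)
    (h : S.Nonempty) : ∃ G : V → V → Weight, Closed G ∧ S = Sol G := by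
  obtain ⟨G, rfl⟩ := hS
  obtain ⟨h1, h2⟩ := exists_closed_of_projection h (id : V → V)
  refine ⟨_, h1, ?_⟩
  rw [h2]
  ext p
  constructor
  · exact fun hp => ⟨p, hp, fun _ => rfl⟩
  · rintro ⟨q, hq, h⟩
    rwa [show p = q from funext h]

theorem isZone_rstep {n : ℕ} (t : Transition n) :
    IsZone {r : X n ⊕ X n → ℝ | RStep t (fun x => r (.inl x)) (fun x => r (.inr x))} := by
  have h : IsZone (Sol (transGraph t)) := ⟨_, rfl⟩
  have h1 := h.proj (U := X n ⊕ X n) (Sum.elim (fun x => (0, x)) (fun x => (2, x)))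
  convert h1 using 1
  ext r
  rw [Set.mem_ofPred_eq, ← grel_transGraph, Set.mem_ofPred_eq]
  constructor
  · rintro ⟨s, hs, h2, h3⟩
    refine ⟨s, hs, ?_⟩
    rintro (x | x)
    · exact (h2 x).symm
    · exact (h3 x).symm
  · rintro ⟨s, hs, h2⟩
    exact ⟨s, hs, fun x => (h2 (.inl x)).symm, fun x => (h2 (.inr x)).symm⟩

theorem isZone_rexec {n : ℕ} (σ : List (Transition n)) :
    IsZone {r : X n ⊕ X n → ℝ | RExec σ (fun x => r (.inl x)) (fun x => r (.inr x))} := by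
  induction σ with
  | nil =>
    refine ⟨fun u v => if Sum.elim id id u = Sum.elim id id v then wle 0 else ⊤, ?_⟩
    ext r
    constructor
    · intro h u v
      have h' : ∀ x, r (.inl x) = r (.inr x) := fun x => congrFun h x
      rw [wsat_ite_zero]
      rcases u with u | u <;> rcases v with v | v <;> rintro (rfl : u = v) <;> simp [h']
    · intro h
      change (fun x => r (.inl x)) = fun x => r (.inr x)
      funext x
      have h1 := wsat_ite_zero.1 (h (.inl x) (.inr x)) rfl
      have h2 := wsat_ite_zero.1 (h (.inr x) (.inl x)) rfl
      exact le_antisymm (by linarith) (by linarith)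
  | cons t σ ih =>
    have h1 := (isZone_rstep t).comap (U := X n ⊕ X n ⊕ X n)
      (Sum.elim (fun x => .inl x) (fun x => .inr (.inl x)))
    have h2 := ih.comap (U := X n ⊕ X n ⊕ X n)
      (Sum.elim (fun x => .inr (.inl x)) (fun x => .inr (.inr x)))
    have h3 := (h1.inter h2).proj (U := X n ⊕ X n)
      (Sum.elim (fun x => .inl x) (fun x => .inr (.inr x)))
    convert h3 using 1
    ext r
    constructor
    · rintro ⟨m, hm1, hm2⟩
      refine ⟨Sum.elim (fun x => r (.inl x)) (Sum.elim m fun x => r (.inr x)), ⟨hm1, hm2⟩, ?_⟩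
      rintro (x | x) <;> rfl
    · rintro ⟨s, ⟨hs1, hs2⟩, h⟩
      obtain rfl : r = _ := funext h
      exact ⟨fun x => s (.inr (.inl x)), hs1, hs2⟩

/-! ### Executions on difference variables -/

section

variable {n : ℕ}

theorem rexec_append {σ τ : List (Transition n)} {p q : X n → ℝ} :
    RExec (σ ++ τ) p q ↔ ∃ m, RExec σ p m ∧ RExec τ m q := by
  induction σ generalizing p with
  | nil => simp [RExec]
  | cons t σ ih =>
    simp only [List.cons_append, RExec, ih]
    constructor
    · rintro ⟨m, h1, m', h2, h3⟩
      exact ⟨m', ⟨m, h1, h2⟩, h3⟩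
    · rintro ⟨m', ⟨m, h1, h2⟩, h3⟩
      exact ⟨m, h1, m', h2, h3⟩

theorem resetClocks_append (σ τ : List (Transition n)) :
    resetClocks (σ ++ τ) = resetClocks σ ∪ resetClocks τ := by
  induction σ with
  | nil => simp [resetClocks]
  | cons t σ ih => simp [resetClocks, ih]

theorem mem_resetClocks {σ : List (Transition n)} {x : Fin n} :
    x ∈ resetClocks σ ↔ ∃ t ∈ σ, x ∈ t.reset := by
  induction σ with
  | nil => simp [resetClocks]
  | cons t σ ih => simp [resetClocks, ih]

theorem RExec.time_le {σ : List (Transition n)} {p q : X n → ℝ} (h : RExec σ p q) : q 0 ≤ p 0 := by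
  induction σ generalizing p with
  | nil => rw [show p = q from h]
  | cons t σ ih =>
    obtain ⟨m, h1, h2⟩ := h
    exact (ih h2).trans h1.1

theorem RExec.eq_of_not_mem {σ : List (Transition n)} {p q : X n → ℝ} (h : RExec σ p q) {x : Fin n}
    (hx : x ∉ resetClocks σ) : q x.succ = p x.succ := by
  induction σ generalizing p with
  | nil => rw [show p = q from h]
  | cons t σ ih =>
    obtain ⟨m, h1, h2⟩ := h
    simp only [resetClocks, Finset.mem_union, not_or] at hx
    have := h1.2.2 x
    rw [if_neg hx.1] at this
    rw [ih h2 hx.2, this]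

/-- A clock that is reset was last reset during the execution. -/
theorem RExec.mem_Icc {σ : List (Transition n)} {p q : X n → ℝ} (h : RExec σ p q) {x : Fin n}
    (hx : x ∈ resetClocks σ) : q 0 ≤ q x.succ ∧ q x.succ ≤ p 0 := by
  induction σ generalizing p with
  | nil => simp [resetClocks] at hx
  | cons t σ ih =>
    obtain ⟨m, h1, h2⟩ := h
    by_cases hσ : x ∈ resetClocks σ
    · obtain ⟨h3, h4⟩ := ih h2 hσ
      exact ⟨h3, h4.trans h1.1⟩
    · have ht : x ∈ t.reset := by
        simp only [resetClocks, Finset.mem_union] at hx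
        tauto
      have h3 := h1.2.2 x
      rw [if_pos ht] at h3
      rw [RExec.eq_of_not_mem h2 hσ, h3.1]
      exact ⟨RExec.time_le h2, h1.1⟩

/-- The guards of `σ` only concern clocks in `W`, and only these are reset. -/
def Within (W : Finset (Fin n)) (σ : List (Transition n)) : Prop :=
  resetClocks σ ⊆ W ∧ ∀ t ∈ σ, ∀ a ∈ t.guard, a.clock ∈ W

theorem Within.append {W : Finset (Fin n)} {σ τ : List (Transition n)} :
    Within W (σ ++ τ) ↔ Within W σ ∧ Within W τ := by
  simp only [Within, resetClocks_append, Finset.union_subset_iff, List.mem_append, or_imp,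
    forall_and]
  tauto

/-- Clocks that are neither checked nor reset can be changed arbitrarily. -/
theorem RExec.shift {W : Finset (Fin n)} {σ : List (Transition n)} (hW : Within W σ)
    {p q : X n → ℝ} (h : RExec σ p q) {c : X n → ℝ} (hc0 : c 0 = 0)
    (hc : ∀ x ∈ W, c x.succ = 0) : RExec σ (fun x => p x + c x) (fun x => q x + c x) := by
  induction σ generalizing p with
  | nil => rw [show p = q from h]; rfl
  | cons t σ ih =>
    obtain ⟨m, h1, h2⟩ := h
    have hW' : Within W [t] ∧ Within W σ := Within.append.1 hW
    refine ⟨_, ?_, ih hW'.2 h2⟩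
    obtain ⟨g1, g2, g3⟩ := h1
    refine ⟨by simpa [hc0] using g1, ?_, ?_⟩
    · intro a ha
      have := g2 a ha
      dsimp only
      rw [hc0, hc _ (hW.2 t (by simp) a ha), add_zero, add_zero]
      exact this
    · intro i
      have := g3 i
      dsimp only
      by_cases hi : i ∈ t.reset
      · rw [if_pos hi] at this ⊢
        rw [hc0, hc i (hW.1 (by simp [resetClocks, hi])), add_zero, add_zero, add_zero]
        exact this
      · rw [if_neg hi] at this ⊢
        rw [this]

/-! ### The relation between consecutive cuts -/

/-- The clocks of `W` among all variables. -/
def clockIncl (W : Finset (Fin n)) (a : {x : Fin n // x ∈ W}) : X n := a.1.succ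

/-- The relation on the clocks of `W` between consecutive visits of the position between `σ₁` and
`σ₂` when `σ₁ ++ σ₂` is iterated, where the clock `z` has just been reset at this position. -/
def CutRel (W : Finset (Fin n)) (σ₁ σ₂ : List (Transition n)) (z : Fin n)
    (y y' : {x : Fin n // x ∈ W} → ℝ) : Prop :=
  ∃ q p q' : X n → ℝ, q 0 = q z.succ ∧ RExec σ₂ q p ∧ RExec σ₁ p q' ∧
    (∀ a, y a = q (clockIncl W a)) ∧ ∀ a, y' a = q' (clockIncl W a)

/-- The states at the cut from which `σ₂` can be executed. -/
def CutDom (W : Finset (Fin n)) (σ₂ : List (Transition n)) (z : Fin n) :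
    Set ({x : Fin n // x ∈ W} → ℝ) :=
  {y | ∃ q p : X n → ℝ, q 0 = q z.succ ∧ RExec σ₂ q p ∧ ∀ a, y a = q (clockIncl W a)}

/-- The states at the cut that are reached by `σ₁`. -/
def CutImg (W : Finset (Fin n)) (σ₁ : List (Transition n)) : Set ({x : Fin n // x ∈ W} → ℝ) :=
  {y | ∃ p q : X n → ℝ, RExec σ₁ p q ∧ ∀ a, y a = q (clockIncl W a)}

theorem isZone_cutRel (W : Finset (Fin n)) [Nonempty {x : Fin n // x ∈ W}]
    (σ₁ σ₂ : List (Transition n)) (z : Fin n) :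
    IsZone {r : {x : Fin n // x ∈ W} ⊕ {x : Fin n // x ∈ W} → ℝ |
      CutRel W σ₁ σ₂ z (fun a => r (.inl a)) (fun a => r (.inr a))} := by
  have h1 := (isZone_rexec σ₂).comap (U := X n ⊕ X n ⊕ X n)
    (Sum.elim (fun x => .inl x) (fun x => .inr (.inl x)))
  have h2 := (isZone_rexec σ₁).comap (U := X n ⊕ X n ⊕ X n)
    (Sum.elim (fun x => .inr (.inl x)) (fun x => .inr (.inr x)))
  have h3 := isZone_eq (V := X n ⊕ X n ⊕ X n) (.inl 0) (.inl z.succ)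
  have h4 := ((h1.inter h2).inter h3).proj
    (U := {x : Fin n // x ∈ W} ⊕ {x : Fin n // x ∈ W})
    (Sum.elim (fun x => .inl (clockIncl W x)) (fun x => .inr (.inr (clockIncl W x))))
  convert h4 using 1
  ext r
  constructor
  · rintro ⟨q, p, q', g1, g2, g3, g4, g5⟩
    refine ⟨Sum.elim q (Sum.elim p q'), ⟨⟨g2, g3⟩, g1⟩, ?_⟩
    rintro (x | x)
    · exact g4 x
    · exact g5 x
  · rintro ⟨s, ⟨⟨hs1, hs2⟩, hs3⟩, h⟩
    exact ⟨fun x => s (.inl x), fun x => s (.inr (.inl x)), fun x => s (.inr (.inr x)), hs3, hs1,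
      hs2, fun a => h (.inl a), fun a => h (.inr a)⟩

theorem isZone_cutDom (W : Finset (Fin n)) [Nonempty {x : Fin n // x ∈ W}]
    (σ₂ : List (Transition n)) (z : Fin n) : IsZone (CutDom W σ₂ z) := by
  have h3 := isZone_eq (V := X n ⊕ X n) (.inl 0) (.inl z.succ)
  have h4 := ((isZone_rexec σ₂).inter h3).proj
    (U := {x : Fin n // x ∈ W}) (fun x => .inl (clockIncl W x))
  convert h4 using 1
  ext r
  constructor
  · rintro ⟨q, p, g1, g2, g3⟩
    exact ⟨Sum.elim q p, ⟨g2, g1⟩, g3⟩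
  · rintro ⟨s, ⟨hs1, hs3⟩, h⟩
    exact ⟨fun x => s (.inl x), fun x => s (.inr x), hs3, hs1, h⟩

theorem isZone_cutImg (W : Finset (Fin n)) [Nonempty {x : Fin n // x ∈ W}]
    (σ₁ : List (Transition n)) : IsZone (CutImg W σ₁) := by
  have h4 := (isZone_rexec σ₁).proj (U := {x : Fin n // x ∈ W}) (fun x => .inr (clockIncl W x))
  convert h4 using 1
  ext r
  constructor
  · rintro ⟨q, p, g2, g3⟩
    exact ⟨Sum.elim q p, g2, g3⟩
  · rintro ⟨s, hs1, h⟩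
    exact ⟨fun x => s (.inl x), fun x => s (.inr x), hs1, h⟩

/-- The data of a cut: `z` has just been reset after `σ₁`, and only clocks in `W` matter. -/
structure Cut (W : Finset (Fin n)) (σ₁ σ₂ : List (Transition n)) (z : Fin n) : Prop where
  within₁ : Within W σ₁
  within₂ : Within W σ₂
  mem : z ∈ W
  reset : ∀ p q, RExec σ₁ p q → q 0 = q z.succ

variable {W : Finset (Fin n)} {σ₁ σ₂ : List (Transition n)} {z : Fin n}

/-- An execution can be moved to any state with the same time and the same clocks in `W`. -/
theorem exists_shift_left {σ : List (Transition n)} (hW : Within W σ) {p p' q : X n → ℝ}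
    (h : RExec σ p q) (h0 : p' 0 = p 0) (hp : ∀ a, p' (clockIncl W a) = p (clockIncl W a)) :
    ∃ q', RExec σ p' q' ∧ q' 0 = q 0 ∧ ∀ a, q' (clockIncl W a) = q (clockIncl W a) := by
  have hc : ∀ x ∈ W, (fun x => p' x - p x) x.succ = 0 := fun x hx =>
    sub_eq_zero.2 (hp ⟨x, hx⟩)
  refine ⟨fun x => q x + (p' x - p x), ?_, by simp [h0], fun a => by
    dsimp only
    rw [hp, sub_self, add_zero]⟩
  have := RExec.shift hW h (c := fun x => p' x - p x) (by simp [h0]) hc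
  simpa using this

/-- The same for the final state. -/
theorem exists_shift_right {σ : List (Transition n)} (hW : Within W σ) {p q q' : X n → ℝ}
    (h : RExec σ p q) (h0 : q' 0 = q 0) (hq : ∀ a, q' (clockIncl W a) = q (clockIncl W a)) :
    ∃ p', RExec σ p' q' ∧ p' 0 = p 0 ∧ ∀ a, p' (clockIncl W a) = p (clockIncl W a) := by
  have hc : ∀ x ∈ W, (fun x => q' x - q x) x.succ = 0 := fun x hx =>
    sub_eq_zero.2 (hq ⟨x, hx⟩)
  refine ⟨fun x => p x + (q' x - q x), ?_, by simp [h0], fun a => by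
    dsimp only
    rw [hq, sub_self, add_zero]⟩
  have := RExec.shift hW h (c := fun x => q' x - q x) (by simp [h0]) hc
  simpa using this

/-- The iterated preimages of the domain at the cut are the states from which `σ₂` and then `m`
periods can be executed. -/
theorem Cut.mem_preIter_iff (hc : Cut W σ₁ σ₂ z) (m : ℕ) {q : X n → ℝ} (hq : q 0 = q z.succ) :
    (fun a => q (clockIncl W a)) ∈ preIter (CutRel W σ₁ σ₂ z) (CutDom W σ₂ z) m ↔
      ∃ p, RExec σ₂ q p ∧ ∃ r, Iter (RExec (σ₁ ++ σ₂)) m p r := by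
  have hz : ∀ p : X n → ℝ, p z.succ = p (clockIncl W ⟨z, hc.mem⟩) := fun _ => rfl
  induction m generalizing q with
  | zero =>
    constructor
    · rintro ⟨q', p', h1, h2, h3⟩
      obtain ⟨p, hp, -⟩ := exists_shift_left hc.within₂ h2 (p' := q)
        (by rw [hq, h1]; exact h3 ⟨z, hc.mem⟩) h3
      exact ⟨p, hp, p, rfl⟩
    · rintro ⟨p, hp, -⟩
      exact ⟨q, p, hq, hp, fun _ => rfl⟩
  | succ m ih =>
    constructor
    · rintro ⟨y', hy', q₁, p₁, q₁', h1, h2, h3, h4, h5⟩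
      obtain ⟨p, hp, e0, e1⟩ := exists_shift_left hc.within₂ h2 (p' := q)
        (by rw [hq, h1]; exact h4 ⟨z, hc.mem⟩) h4
      obtain ⟨q', hq', -, e3⟩ := exists_shift_left hc.within₁ h3 e0 e1
      obtain rfl : y' = fun a => q' (clockIncl W a) := funext fun a => by rw [h5, e3]
      obtain ⟨p', hp', r, hr⟩ := (ih (hc.reset _ _ hq')).1 hy'
      exact ⟨p, hp, r, p', rexec_append.2 ⟨_, hq', hp'⟩, hr⟩
    · rintro ⟨p, hp, r, p', hpp, hr⟩
      obtain ⟨q', h1, h2⟩ := rexec_append.1 hpp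
      exact ⟨fun a => q' (clockIncl W a), (ih (hc.reset _ _ h1)).2 ⟨p', h2, r, hr⟩, q, p, q', hq,
        hp, h1, fun _ => rfl, fun _ => rfl⟩

/-- The iterated images at the cut are the states that are reached by `m` periods and then `σ₁`. -/
theorem Cut.mem_preIter_swap_iff (hc : Cut W σ₁ σ₂ z) (m : ℕ) {q : X n → ℝ} (hq : q 0 = q z.succ) :
    (fun a => q (clockIncl W a)) ∈
        preIter (fun y y' => CutRel W σ₁ σ₂ z y' y) (CutImg W σ₁) m ↔
      ∃ p, RExec σ₁ p q ∧ ∃ r, Iter (RExec (σ₁ ++ σ₂)) m r p := by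
  induction m generalizing q with
  | zero =>
    constructor
    · rintro ⟨p', q', h1, h2⟩
      obtain ⟨p, hp, -⟩ := exists_shift_right hc.within₁ h1 (q' := q)
        (by rw [hq, hc.reset _ _ h1]; exact h2 ⟨z, hc.mem⟩) h2
      exact ⟨p, hp, p, rfl⟩
    · rintro ⟨p, hp, -⟩
      exact ⟨p, q, hp, fun _ => rfl⟩
  | succ m ih =>
    constructor
    · rintro ⟨y', hy', q₁, p₁, q₁', h1, h2, h3, h4, h5⟩
      obtain ⟨p, hp, e0, e1⟩ := exists_shift_right hc.within₁ h3 (q' := q)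
        (by rw [hq, hc.reset _ _ h3]; exact h5 ⟨z, hc.mem⟩) h5
      obtain ⟨q', hq', e2, e3⟩ := exists_shift_right hc.within₂ h2 e0 e1
      obtain rfl : y' = fun a => q' (clockIncl W a) := funext fun a => by rw [h4, e3]
      have hq0 : q' 0 = q' z.succ := by
        rw [e2, h1]
        exact (e3 ⟨z, hc.mem⟩).symm
      obtain ⟨p', hp', r, hr⟩ := (ih hq0).1 hy'
      exact ⟨p, hp, r, iter_add.2 ⟨p', hr, iter_one.2 (rexec_append.2 ⟨_, hp', hq'⟩)⟩⟩
    · rintro ⟨p, hp, r, hr⟩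
      obtain ⟨p', hr', h1⟩ := iter_add.1 hr
      obtain ⟨q', h2, h3⟩ := rexec_append.1 (iter_one.1 h1)
      exact ⟨fun a => q' (clockIncl W a), (ih (hc.reset _ _ h2)).2 ⟨p', h2, r, hr'⟩, q', p, q,
        hc.reset _ _ h2, h3, hp, fun _ => rfl, fun _ => rfl⟩

theorem Cut.dom_iff (hc : Cut W σ₁ σ₂ z) (m : ℕ) (p : X n → ℝ) :
    (∃ r, Iter (RExec (σ₁ ++ σ₂)) (m + 1) p r) ↔ ∃ q, RExec σ₁ p q ∧
      (fun a => q (clockIncl W a)) ∈ preIter (CutRel W σ₁ σ₂ z) (CutDom W σ₂ z) m := by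
  constructor
  · rintro ⟨r, p', h1, h2⟩
    obtain ⟨q, h3, h4⟩ := rexec_append.1 h1
    exact ⟨q, h3, (hc.mem_preIter_iff m (hc.reset _ _ h3)).2 ⟨p', h4, r, h2⟩⟩
  · rintro ⟨q, h1, h2⟩
    obtain ⟨p', h3, r, hr⟩ := (hc.mem_preIter_iff m (hc.reset _ _ h1)).1 h2
    exact ⟨r, p', rexec_append.2 ⟨q, h1, h3⟩, hr⟩

theorem Cut.img_iff (hc : Cut W σ₁ σ₂ z) (m : ℕ) (r : X n → ℝ) :
    (∃ p, Iter (RExec (σ₁ ++ σ₂)) (m + 1) p r) ↔ ∃ q, q 0 = q z.succ ∧ RExec σ₂ q r ∧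
      (fun a => q (clockIncl W a)) ∈
        preIter (fun y y' => CutRel W σ₁ σ₂ z y' y) (CutImg W σ₁) m := by
  constructor
  · rintro ⟨p, h⟩
    obtain ⟨p', h1, h2⟩ := iter_add.1 h
    obtain ⟨q, h3, h4⟩ := rexec_append.1 (iter_one.1 h2)
    exact ⟨q, hc.reset _ _ h3, h4, (hc.mem_preIter_swap_iff m (hc.reset _ _ h3)).2 ⟨p', h3, p, h1⟩⟩
  · rintro ⟨q, h0, h1, h2⟩
    obtain ⟨p', h3, p, hp⟩ := (hc.mem_preIter_swap_iff m h0).1 h2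
    exact ⟨p, iter_add.2 ⟨p', hp, iter_one.2 (rexec_append.2 ⟨q, h3, h1⟩)⟩⟩

/-- Along an infinite run with periods of bounded duration, domains and images of the powers are
stable after `N ^ 2 + 2` iterations, where `N` is the number of clocks in `W`. -/
theorem Cut.stable (hc : Cut W σ₁ σ₂ z) (hW : W ⊆ resetClocks (σ₁ ++ σ₂)) {p : ℕ → X n → ℝ}
    (hp : ∀ i, RExec (σ₁ ++ σ₂) (p i) (p (i + 1))) {C : ℝ} (hC : ∀ i, p i 0 - p (i + 1) 0 ≤ C)
    {m : ℕ} (hm : roundBound W.card + 2 ≤ m) :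
    (∀ q, (∃ r, Iter (RExec (σ₁ ++ σ₂)) (m + 1) q r) ↔ ∃ r, Iter (RExec (σ₁ ++ σ₂)) m q r) ∧
    ∀ q, (∃ r, Iter (RExec (σ₁ ++ σ₂)) (m + 1) r q) ↔ ∃ r, Iter (RExec (σ₁ ++ σ₂)) m r q := by
  have : Nonempty {x : Fin n // x ∈ W} := ⟨⟨z, hc.mem⟩⟩
  choose c hc1 hc2 using fun i => rexec_append.1 (hp i)
  -- the states of the run at the cut; all clocks in `W` were reset during the last period
  set y : ℕ → {x : Fin n // x ∈ W} → ℝ := fun i a => c i (clockIncl W a) with hy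
  have hrel : ∀ i, CutRel W σ₁ σ₂ z (y i) (y (i + 1)) := fun i =>
    ⟨c i, p (i + 1), c (i + 1), hc.reset _ _ (hc1 i), hc2 i, hc1 (i + 1), fun _ => rfl,
      fun _ => rfl⟩
  obtain ⟨B, hB⟩ := exists_int_ge (C + C)
  have hbd : ∀ i a b, |y (i + 1) b - y (i + 1) a| ≤ (B : ℝ) := by
    intro i a b
    have h1 : RExec (σ₂ ++ σ₁) (c i) (c (i + 1)) := rexec_append.2 ⟨_, hc2 i, hc1 (i + 1)⟩
    have h2 : ∀ a : {x : Fin n // x ∈ W}, a.1 ∈ resetClocks (σ₂ ++ σ₁) := fun a => by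
      have := hW a.2
      rw [resetClocks_append] at this ⊢
      rwa [Finset.union_comm]
    obtain ⟨a1, a2⟩ := RExec.mem_Icc h1 (h2 a)
    obtain ⟨b1, b2⟩ := RExec.mem_Icc h1 (h2 b)
    have h3 := RExec.time_le (hc1 i)
    have h4 := RExec.time_le (hc2 (i + 1))
    have h5 := hC i
    have h6 := hC (i + 1)
    change |c (i + 1) b.1.succ - c (i + 1) a.1.succ| ≤ (B : ℝ)
    rw [abs_le]
    constructor <;> linarith
  have hSmem : ∀ t i, y i ∈ preIter (CutRel W σ₁ σ₂ z) (CutDom W σ₂ z) t := by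
    intro t
    induction t with
    | zero => exact fun i => ⟨c i, p (i + 1), hc.reset _ _ (hc1 i), hc2 i, fun _ => rfl⟩
    | succ t ih => exact fun i => ⟨y (i + 1), ih _, hrel i⟩
  have hUmem : ∀ t i, t ≤ i →
      y i ∈ preIter (fun y y' => CutRel W σ₁ σ₂ z y' y) (CutImg W σ₁) t := by
    intro t
    induction t with
    | zero => exact fun i _ => ⟨p i, c i, hc1 i, fun _ => rfl⟩
    | succ t ih =>
      intro i hi
      obtain ⟨j, rfl⟩ : ∃ j, i = j + 1 := ⟨i - 1, by omega⟩
      exact ⟨y j, ih j (by omega), hrel j⟩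
  have hcard : Fintype.card {x : Fin n // x ∈ W} = W.card := by simp
  obtain ⟨k, rfl⟩ : ∃ k, m = k + 2 := ⟨m - 2, by omega⟩
  have hS : preIter (CutRel W σ₁ σ₂ z) (CutDom W σ₂ z) (k + 2) =
      preIter (CutRel W σ₁ σ₂ z) (CutDom W σ₂ z) (k + 1) := by
    obtain ⟨Γ, hΓ, hPΓ⟩ := (isZone_cutRel W σ₁ σ₂ z).exists_closed
      ⟨Sum.elim (y 0) (y 1), hrel 0⟩
    obtain ⟨Δ, hΔ⟩ := isZone_cutDom W σ₂ z
    refine preIter_stable (C := B) hΓ (fun u u' => ?_) hΔ ?_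
      (fun t => ⟨y 1, hSmem _ _, ⟨_, hrel 0⟩, hbd 0⟩) (by rw [hcard]; omega)
    · rw [← hPΓ]
      rfl
    · rintro u ⟨u', -, q, r, q', h1, h2, -, h3, -⟩
      exact ⟨q, r, h1, h2, h3⟩
  have hU : preIter (fun y y' => CutRel W σ₁ σ₂ z y' y) (CutImg W σ₁) (k + 2) =
      preIter (fun y y' => CutRel W σ₁ σ₂ z y' y) (CutImg W σ₁) (k + 1) := by
    obtain ⟨Γ, hΓ, hPΓ⟩ := ((isZone_cutRel W σ₁ σ₂ z).comap
      (U := {x : Fin n // x ∈ W} ⊕ {x : Fin n // x ∈ W}) Sum.swap).exists_closed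
      ⟨Sum.elim (y 1) (y 0), hrel 0⟩
    obtain ⟨Δ, hΔ⟩ := isZone_cutImg W σ₁
    refine preIter_stable (C := B) hΓ (fun u u' => ?_) hΔ ?_
      (fun t => ⟨y (t + 1), hUmem _ _ (by omega), ⟨_, hrel (t + 1)⟩, hbd t⟩) (by rw [hcard]; omega)
    · rw [← hPΓ]
      rfl
    · rintro u ⟨u', -, q, r, q', h1, h2, h3, -, h4⟩
      exact ⟨r, q', h3, h4⟩
  refine ⟨fun q => ?_, fun q => ?_⟩
  · rw [hc.dom_iff (k + 2), hc.dom_iff (k + 1), hS]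
  · rw [hc.img_iff (k + 2), hc.img_iff (k + 1), hU]

end

section

variable {n : ℕ}

/-! ### Executions on valuations and on difference variables -/

/-- The difference variables of a valuation at time `T`. -/
noncomputable def diffVars (v : Valuation n) (T : ℝ) : X n → ℝ := fun x => extend v x - T

/-- The valuation described by difference variables. -/
noncomputable def toVal (p : X n → ℝ) : Valuation n := fun i => (p i.succ - p 0).toNNReal

theorem extend_zero (v : Valuation n) : extend v 0 = 0 := rfl

theorem extend_succ (v : Valuation n) (i : Fin n) : extend v i.succ = v i := rfl

theorem Step.rstep {t : Transition n} {v v' : Valuation n} {δ : ℝ≥0} (h : Step t v δ v') (T : ℝ) :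
    RStep t (diffVars v T) (diffVars v' (T + δ)) := by
  obtain ⟨h1, rfl⟩ := h
  refine ⟨?_, ?_, ?_⟩
  · simp [diffVars, extend_zero]
  · intro a ha
    have := h1 a ha
    simp only [diffVars, extend_zero, extend_succ]
    convert this using 1
    push_cast
    ring
  · intro i
    simp only [diffVars, extend_zero, extend_succ]
    split_ifs with hi
    · refine ⟨by simp, ?_⟩
      have := (v i).coe_nonneg
      have := δ.coe_nonneg
      linarith
    · push_cast
      ring

theorem Exec.rexec {σ : List (Transition n)} {v v' : Valuation n} {δ : ℝ≥0} (h : Exec σ v δ v')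
    (T : ℝ) : RExec σ (diffVars v T) (diffVars v' (T + δ)) := by
  induction h generalizing T with
  | nil => simp [RExec]
  | @cons t σ v₀ v₁ v₂ δ ε h1 _ ih =>
    refine ⟨_, h1.rstep T, ?_⟩
    have := ih (T + δ)
    rwa [add_assoc, ← NNReal.coe_add] at this

/-- A step on difference variables is a step of valuations, if no clock starts with a negative
value. -/
theorem RStep.step {t : Transition n} {p q : X n → ℝ} (h : RStep t p q) (hp : ∀ x, p 0 ≤ p x) :
    Step t (toVal p) (p 0 - q 0).toNNReal (toVal q) ∧ ∀ x, q 0 ≤ q x := by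
  obtain ⟨h1, h2, h3⟩ := h
  have hd : (((p 0 - q 0).toNNReal : ℝ≥0) : ℝ) = p 0 - q 0 := Real.coe_toNNReal _ (by linarith)
  have hv : ∀ i, ((toVal p i : ℝ≥0) : ℝ) = p i.succ - p 0 := fun i =>
    Real.coe_toNNReal _ (by linarith [hp i.succ])
  have hq : ∀ x, q 0 ≤ q x := by
    refine Fin.cases le_rfl fun i => ?_
    have := h3 i
    split_ifs at this
    · exact this.1.ge
    · rw [this]
      exact h1.trans (hp _)
  refine ⟨⟨?_, ?_⟩, hq⟩
  · intro a ha
    have := h2 a ha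
    convert this using 1
    rw [NNReal.coe_add, hv, hd]
    ring
  · funext i
    apply NNReal.coe_injective
    have h4 := h3 i
    rw [show ((toVal q i : ℝ≥0) : ℝ) = q i.succ - q 0 from
      Real.coe_toNNReal _ (by linarith [hq i.succ])]
    split_ifs at h4 ⊢ with hi
    · rw [h4.1, sub_self, NNReal.coe_zero]
    · rw [NNReal.coe_add, hv, hd, h4]
      ring

theorem RExec.exec {σ : List (Transition n)} {p q : X n → ℝ} (h : RExec σ p q)
    (hp : ∀ x, p 0 ≤ p x) : (∃ δ, Exec σ (toVal p) δ (toVal q)) ∧ ∀ x, q 0 ≤ q x := by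
  induction σ generalizing p with
  | nil =>
    obtain rfl : p = q := h
    exact ⟨⟨0, Exec.nil _⟩, hp⟩
  | cons t σ ih =>
    obtain ⟨m, h1, h2⟩ := h
    obtain ⟨h3, h4⟩ := h1.step hp
    obtain ⟨⟨δ, h5⟩, h6⟩ := ih h2 h4
    exact ⟨⟨_, Exec.cons h3 h5⟩, h6⟩

theorem toVal_extend (v : Valuation n) : toVal (extend v) = v := by
  funext i
  simp [toVal, extend_zero, extend_succ]

theorem omegaIterableFrom_of_run {σ : List (Transition n)} {p : ℕ → X n → ℝ}
    (h : ∀ i, RExec σ (p i) (p (i + 1))) (h0 : ∀ x, p 0 0 ≤ p 0 x) :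
    OmegaIterableFrom σ (toVal (p 0)) := by
  have hp : ∀ i x, p i 0 ≤ p i x := by
    intro i
    induction i with
    | zero => exact h0
    | succ i ih => exact (RExec.exec (h i) ih).2
  choose δ hδ using fun i => (RExec.exec (h i) (hp i)).1
  exact ⟨fun i => toVal (p i), δ, rfl, hδ⟩

/-- The valuations agree except for clocks that exceed `C`. -/
def AgreeUpTo (C : ℕ) (v w : Valuation n) : Prop :=
  ∀ x, v x = w x ∨ ((C : ℝ≥0) < v x ∧ (C : ℝ≥0) < w x)

theorem AgreeUpTo.sat {C : ℕ} {v w : Valuation n} (h : AgreeUpTo C v w) {g : List (Atom n)}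
    (hg : ∀ a ∈ g, a.const ≤ C) (hv : Sat v g) : Sat w g := by
  intro a ha
  have h1 := hv a ha
  rcases h a.clock with h2 | ⟨h2, h3⟩
  · rwa [← h2]
  · have hC : (a.const : ℝ) ≤ C := by exact_mod_cast hg a ha
    have h2' : (C : ℝ) < v a.clock := by exact_mod_cast h2
    have h3' : (C : ℝ) < w a.clock := by exact_mod_cast h3
    revert h1
    cases a.rel <;> simp only [Rel.holds] <;> intro h1 <;> linarith

/-- A step can be imitated with a delay of at most `C + 1`. -/
theorem Step.cap {t : Transition n} {C : ℕ} (hC : ∀ a ∈ t.guard, a.const ≤ C)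
    {v w v' : Valuation n} {δ : ℝ≥0} (h : Step t v δ w) (hv : AgreeUpTo C v v') :
    ∃ (δ' : ℝ≥0) (w' : Valuation n), δ' ≤ C + 1 ∧ Step t v' δ' w' ∧ AgreeUpTo C w w' := by
  obtain ⟨h1, rfl⟩ := h
  have key : AgreeUpTo C (fun x => v x + δ) (fun x => v' x + min δ (C + 1)) := by
    intro x
    rcases le_total δ (C + 1) with hδ | hδ
    · rw [min_eq_left hδ]
      rcases hv x with h2 | ⟨h2, h3⟩
      · exact Or.inl (congrArg (· + δ) h2)
      · exact Or.inr ⟨h2.trans_le le_self_add, h3.trans_le le_self_add⟩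
    · rw [min_eq_right hδ]
      have h4 : (C : ℝ≥0) < C + 1 := lt_add_one _
      exact Or.inr ⟨(h4.trans_le hδ).trans_le le_add_self, h4.trans_le le_add_self⟩
  refine ⟨min δ (C + 1), _, min_le_right _ _, ⟨key.sat hC h1, rfl⟩, ?_⟩
  intro x
  dsimp only
  split_ifs with hx
  · exact Or.inl rfl
  · exact key x

theorem Exec.cap {σ : List (Transition n)} {C : ℕ} (hC : ∀ t ∈ σ, ∀ a ∈ t.guard, a.const ≤ C)
    {v w v' : Valuation n} {δ : ℝ≥0} (h : Exec σ v δ w) (hv : AgreeUpTo C v v') :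
    ∃ (w' : Valuation n) (δ' : ℝ≥0), δ' ≤ σ.length * (C + 1) ∧ Exec σ v' δ' w' ∧
      AgreeUpTo C w w' := by
  induction h generalizing v' with
  | nil => exact ⟨v', 0, bot_le, Exec.nil _, hv⟩
  | @cons t σ v₀ v₁ v₂ δ ε h1 _ ih =>
    obtain ⟨δ₁, w₁, g1, g2, g3⟩ := h1.cap (hC t (by simp)) hv
    obtain ⟨w₂, δ₂, k1, k2, k3⟩ := ih (fun t ht => hC t (by simp [ht])) g3
    refine ⟨w₂, δ₁ + δ₂, ?_, Exec.cons g2 k2, k3⟩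
    rw [List.length_cons, Nat.cast_succ, add_mul, one_mul, add_comm]
    exact add_le_add k1 g1

theorem exists_const_bound (σ : List (Transition n)) :
    ∃ C : ℕ, ∀ t ∈ σ, ∀ a ∈ t.guard, a.const ≤ C := by
  refine ⟨((σ.flatMap Transition.guard).map Atom.const).sum, fun t ht a ha => ?_⟩
  exact List.le_sum_of_mem (List.mem_map.2 ⟨a, List.mem_flatMap.2 ⟨t, ht, ha⟩, rfl⟩)

/-- Long delays can be shortened, since no guard distinguishes values above the largest constant. -/
theorem exists_bounded_run {σ : List (Transition n)} {v : Valuation n}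
    (h : OmegaIterableFrom σ v) : ∃ (B : ℝ) (p : ℕ → X n → ℝ), p 0 = extend v ∧
      (∀ i, RExec σ (p i) (p (i + 1))) ∧ ∀ i, p i 0 - p (i + 1) 0 ≤ B := by
  obtain ⟨C, hC⟩ := exists_const_bound σ
  obtain ⟨w, δ, h0, hw⟩ := h
  have hstep : ∀ i (u : {u // AgreeUpTo C (w i) u}), ∃ (u' : {u // AgreeUpTo C (w (i + 1)) u}),
      ∃ ε : ℝ≥0, ε ≤ σ.length * (C + 1) ∧ Exec σ u.1 ε u'.1 := fun i u => by
    obtain ⟨w', ε, h1, h2, h3⟩ := (hw i).cap hC u.2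
    exact ⟨⟨w', h3⟩, ε, h1, h2⟩
  choose f ε hf1 hf2 using hstep
  let u : (i : ℕ) → {u // AgreeUpTo C (w i) u} := fun i =>
    Nat.rec ⟨w 0, fun _ => Or.inl rfl⟩ (fun i u => f i u) i
  have hu : ∀ i, u (i + 1) = f i (u i) := fun i => rfl
  set T : ℕ → ℝ := fun i => ∑ j ∈ Finset.range i, (ε j (u j) : ℝ) with hT
  have hTs : ∀ i, T (i + 1) = T i + ε i (u i) := fun i => Finset.sum_range_succ _ _
  refine ⟨((σ.length * (C + 1) : ℝ≥0) : ℝ), fun i => diffVars (u i).1 (T i), ?_, fun i => ?_,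
    fun i => ?_⟩
  · funext x
    change extend (w 0) x - T 0 = _
    rw [h0, show T 0 = 0 from Finset.sum_range_zero _, sub_zero]
  · dsimp only
    rw [hTs, hu]
    exact (hf2 i (u i)).rexec _
  · dsimp only
    rw [hTs]
    simp only [diffVars, extend_zero]
    have : (ε i (u i) : ℝ) ≤ ((σ.length * (C + 1) : ℝ≥0) : ℝ) := NNReal.coe_le_coe.2 (hf1 i (u i))
    linarith

theorem iter_of_run {α : Type} {R : α → α → Prop} {p : ℕ → α} (h : ∀ i, R (p i) (p (i + 1)))
    (m i : ℕ) : Iter R m (p i) (p (i + m)) := by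
  induction m generalizing i with
  | zero => rfl
  | succ m ih =>
    have := ih (i + 1)
    rw [Nat.add_right_comm] at this
    exact ⟨_, h i, this⟩

/-- If the domain of a power of `R` is not reduced by further iteration of this power, then infinite
runs start at all of its points. -/
theorem exists_run_of_dom {α : Type} {R : α → α → Prop} {K : ℕ} (hK : 0 < K)
    (h : ∀ p q, Iter R K p q → ∃ q', ∃ r, Iter R K p q' ∧ Iter R K q' r) {p q : α}
    (hp : Iter R K p q) : ∃ s : ℕ → α, s 0 = p ∧ ∀ i, R (s i) (s (i + 1)) := by
  set D : Set α := {m | ∃ j d e, Iter R j m d ∧ Iter R K d e} with hD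
  have hstep : ∀ m : {m // m ∈ D}, ∃ m' : {m // m ∈ D}, R m.1 m'.1 := by
    rintro ⟨m, j, d, e, h1, h2⟩
    cases j with
    | succ j =>
      obtain ⟨m', h3, h4⟩ := h1
      exact ⟨⟨m', j, d, e, h4, h2⟩, h3⟩
    | zero =>
      obtain rfl : m = d := h1
      obtain ⟨d', e', h3, h4⟩ := h _ _ h2
      obtain ⟨K, rfl⟩ : ∃ L, K = L + 1 := ⟨K - 1, by omega⟩
      obtain ⟨m', h5, h6⟩ := h3
      exact ⟨⟨m', K, d', e', h6, h4⟩, h5⟩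
  choose f hf using hstep
  let s : ℕ → {m // m ∈ D} := fun i => Nat.rec ⟨p, 0, p, q, rfl, hp⟩ (fun _ m => f m) i
  exact ⟨fun i => (s i).1, rfl, fun i => hf (s i)⟩

theorem not_omegaIterable_of_iter_empty {σ : List (Transition n)} {m : ℕ}
    (h : ∀ p q, ¬ Iter (RExec σ) m p q) : ¬ OmegaIterable σ := by
  rintro ⟨v, hv⟩
  obtain ⟨B, p, -, hp, -⟩ := exists_bounded_run hv
  exact h _ _ (iter_of_run hp m 0)

/-- A run that satisfies no sign conditions becomes a run of valuations after one period. -/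
theorem omegaIterable_of_rexec_run {σ : List (Transition n)} (hW : Within (resetClocks σ) σ)
    {p : ℕ → X n → ℝ} (hp : ∀ i, RExec σ (p i) (p (i + 1))) : OmegaIterable σ := by
  classical
  set c : X n → ℝ := Fin.cases 0 fun i => if i ∈ resetClocks σ then 0 else p 1 0 - p 1 i.succ
    with hc
  have hcs : ∀ i : Fin n, c i.succ = if i ∈ resetClocks σ then 0 else p 1 0 - p 1 i.succ :=
    fun i => rfl
  have h := omegaIterableFrom_of_run (σ := σ) (p := fun i x => p (i + 1) x + c x)
    (fun i => RExec.shift hW (hp (i + 1)) rfl fun x hx => by rw [hcs, if_pos hx]) ?_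
  · exact ⟨_, h⟩
  · refine Fin.cases le_rfl fun i => ?_
    rw [hcs, show c 0 = 0 from rfl, add_zero]
    split_ifs with hi
    · rw [add_zero]
      exact (RExec.mem_Icc (hp 0) hi).1
    · simp

/-- The exponents for which the procedure gives up exceed the number of iterations after which
domains and images are stable. -/
theorem roundBound_add_two_le {N n k : ℕ} (h1 : 1 ≤ N) (h2 : N ≤ n) (h3 : n ^ 2 < 2 ^ k) :
    roundBound N + 2 ≤ 2 ^ k := by
  rw [roundBound]
  split_ifs with h
  · have : 1 ≤ n ^ 2 := Nat.one_le_pow _ _ (h1.trans h2)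
    omega
  · have hNn : N * N ≤ n ^ 2 := by
      rw [sq]
      exact Nat.mul_le_mul h2 h2
    have h4 : 4 ≤ n ^ 2 := by nlinarith
    have hk : 2 ≤ k := by
      by_contra hk
      have : 2 ^ k ≤ 2 ^ 1 := Nat.pow_le_pow_right (by norm_num) (by omega)
      omega
    -- a square is not `3` modulo `4`
    have h5 : 2 ^ k % 4 = 0 := by
      obtain ⟨j, rfl⟩ : ∃ j, k = j + 2 := ⟨k - 2, by omega⟩
      rw [pow_add]
      omega
    have h6 : n ^ 2 % 4 = 0 ∨ n ^ 2 % 4 = 1 := by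
      rw [Nat.pow_mod]
      have : n % 4 < 4 := Nat.mod_lt _ (by norm_num)
      interval_cases n % 4 <;> simp
    omega

/-- Any clock that is reset provides a cut, just after a transition that resets it. -/
theorem exists_cut {σ : List (Transition n)} (hW : Within (resetClocks σ) σ) {z : Fin n}
    (hz : z ∈ resetClocks σ) : ∃ σ₁ σ₂, σ = σ₁ ++ σ₂ ∧ Cut (resetClocks σ) σ₁ σ₂ z := by
  obtain ⟨t, ht, hzt⟩ := mem_resetClocks.1 hz
  obtain ⟨a, b, rfl⟩ := List.append_of_mem ht
  refine ⟨a ++ [t], b, by simp, ?_⟩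
  have hW' : Within (resetClocks (a ++ t :: b)) ((a ++ [t]) ++ b) := by
    rw [List.append_assoc]
    exact hW
  refine ⟨(Within.append.1 hW').1, (Within.append.1 hW').2, hz, ?_⟩
  intro p q h
  obtain ⟨m, -, m', h1, h2⟩ := rexec_append.1 h
  obtain rfl : m' = q := h2
  have := h1.2.2 z
  rw [if_pos hzt] at this
  exact this.1.symm

/-! ### Correctness of the squaring loop -/

section

variable {t : Transition n} {σ : List (Transition n)}

theorem not_omegaIterable_of_power_eq_none {k : ℕ} (h : power (t :: σ) k = none) :
    ¬ OmegaIterable (t :: σ) :=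
  not_omegaIterable_of_iter_empty ((power_spec t σ k).1.1 h)

/-- For an iterable sequence, domains and images are stable from `2^k` iterations on. -/
theorem similar_of_omegaIterable (hW : Within (resetClocks (t :: σ)) (t :: σ)) {z : Fin n}
    (hz : z ∈ resetClocks (t :: σ)) {k : ℕ} (hk : n ^ 2 < 2 ^ k) {G G' : TGraph n 1}
    (hG : power (t :: σ) k = some G) (hG' : power (t :: σ) (k + 1) = some G')
    (h : OmegaIterable (t :: σ)) : Similar G' G := by
  obtain ⟨v, hv⟩ := h
  obtain ⟨B, p, -, hp, hB⟩ := exists_bounded_run hv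
  obtain ⟨σ₁, σ₂, hσ, hc⟩ := exists_cut hW hz
  rw [hσ] at hp
  have hN : 1 ≤ (resetClocks (t :: σ)).card := Finset.card_pos.2 ⟨z, hz⟩
  have hNn : (resetClocks (t :: σ)).card ≤ n := by
    simpa using Finset.card_le_univ (resetClocks (t :: σ))
  have hR := roundBound_add_two_le hN hNn hk
  have hst := fun m hm => hc.stable (by rw [← hσ]) hp hB (m := m) hm
  obtain ⟨g1, g2⟩ := (power_spec t σ k).2 G hG
  obtain ⟨g1', g2'⟩ := (power_spec t σ (k + 1)).2 G' hG'
  have key : ∀ d, (∀ q, (∃ r, Iter (RExec (σ₁ ++ σ₂)) (2 ^ k + d) q r) ↔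
      ∃ r, Iter (RExec (σ₁ ++ σ₂)) (2 ^ k) q r) ∧
      ∀ q, (∃ r, Iter (RExec (σ₁ ++ σ₂)) (2 ^ k + d) r q) ↔
        ∃ r, Iter (RExec (σ₁ ++ σ₂)) (2 ^ k) r q := by
    intro d
    induction d with
    | zero => exact ⟨fun _ => Iff.rfl, fun _ => Iff.rfl⟩
    | succ d ih =>
      obtain ⟨s1, s2⟩ := hst (2 ^ k + d) (by omega)
      exact ⟨fun q => (s1 q).trans (ih.1 q), fun q => (s2 q).trans (ih.2 q)⟩
  rw [similar_iff g1' g1]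
  simp only [g2, g2']
  rw [hσ, pow_succ, mul_two]
  exact key _

/-- Stability of the domain alone yields infinite runs from all of its points. -/
theorem zone_of_similar {k : ℕ} {G G' : TGraph n 1}
    (hG : power (t :: σ) k = some G) (hG' : power (t :: σ) (k + 1) = some G')
    (h : Similar G' G) : (left G).zone = {v | OmegaIterableFrom (t :: σ) v} ∧
      (Within (resetClocks (t :: σ)) (t :: σ) → OmegaIterable (t :: σ)) := by
  obtain ⟨g1, g2⟩ := (power_spec t σ k).2 G hG
  obtain ⟨g1', g2'⟩ := (power_spec t σ (k + 1)).2 G' hG'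
  have hdom := ((similar_iff g1' g1).1 h).1
  simp only [g2, g2'] at hdom
  have hrun : ∀ p, (∃ q, GRel G p q) →
      ∃ s : ℕ → X n → ℝ, s 0 = p ∧ ∀ i, RExec (t :: σ) (s i) (s (i + 1)) := by
    rintro p ⟨q, hq⟩
    refine exists_run_of_dom (K := 2 ^ k) (by positivity) (fun p q hpq => ?_) ((g2 p q).1 hq)
    obtain ⟨r, hr⟩ := (hdom p).2 ⟨q, hpq⟩
    rw [pow_succ, mul_two, iter_add] at hr
    obtain ⟨q', h1, h2⟩ := hr
    exact ⟨q', r, h1, h2⟩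
  constructor
  · ext v
    rw [mem_zone, sol_left g1]
    constructor
    · intro hv
      obtain ⟨s, hs0, hs⟩ := hrun _ hv
      have := omegaIterableFrom_of_run hs (by
        rw [hs0]
        exact Fin.cases le_rfl fun i => (v i).coe_nonneg)
      rwa [hs0, toVal_extend] at this
    · intro hv
      obtain ⟨B, p, h0, hp, -⟩ := exists_bounded_run hv
      refine ⟨p (0 + 2 ^ k), ?_⟩
      rw [g2, ← h0]
      exact iter_of_run hp _ 0
  · intro hW
    obtain ⟨p, hp⟩ := (closed_left g1).sol_nonempty
    rw [sol_left g1] at hp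
    obtain ⟨s, -, hs⟩ := hrun _ hp
    exact omegaIterable_of_rexec_run hW hs

end

end

section

variable {n : ℕ}

/-! ### The conditions that exclude iterability at once -/

/-- Every guard is checked at some time during an execution; the clock then has its initial value
or has been reset meanwhile. Here, `τ` is minus the time and `r` the difference variable of the
clock. -/
theorem RExec.exists_check {σ : List (Transition n)} {p q : X n → ℝ} (h : RExec σ p q) {a : Atom n}
    (ha : Occurs σ a) : ∃ τ r : ℝ, q 0 ≤ τ ∧ τ ≤ p 0 ∧ a.rel.holds (r - τ) a.const ∧
      (r = p a.clock.succ ∨ (r ≤ p 0 ∧ a.clock ∈ resetClocks σ)) := by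
  induction σ generalizing p with
  | nil =>
    obtain ⟨t, ht, -⟩ := ha
    simp at ht
  | cons t σ ih =>
    obtain ⟨m, h1, h2⟩ := h
    obtain ⟨s, hs, has⟩ := ha
    rcases List.mem_cons.1 hs with rfl | hs
    · exact ⟨m 0, p a.clock.succ, RExec.time_le h2, h1.1, h1.2.1 a has, Or.inl rfl⟩
    · obtain ⟨τ, r, g1, g2, g3, g4⟩ := ih h2 ⟨s, hs, has⟩
      refine ⟨τ, r, g1, g2.trans h1.1, g3, ?_⟩
      simp only [resetClocks, Finset.mem_union]
      rcases g4 with g4 | ⟨g4, g5⟩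
      · have h3 := h1.2.2 a.clock
        split_ifs at h3 with hr
        · exact Or.inr ⟨by rw [g4, h3.1]; exact h1.1, Or.inl hr⟩
        · exact Or.inl (by rw [g4, h3])
      · exact Or.inr ⟨g4.trans h1.1, Or.inr g5⟩

theorem Rel.le_of_holds_upper {r : Rel} (hr : r.isUpper = true) {x c : ℝ} (h : r.holds x c) :
    x ≤ c := by
  cases r <;> simp [Rel.isUpper, Rel.holds] at * <;> linarith

theorem Rel.le_of_holds_lower {r : Rel} (hr : r.isLower = true) {x c : ℝ} (h : r.holds x c) :
    c ≤ x := by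
  cases r <;> simp [Rel.isLower, Rel.holds] at * <;> linarith

theorem Rel.ne_of_holds_strict {r : Rel} (hr : r.isStrict = true) {x c : ℝ} (h : r.holds x c) :
    x ≠ c := by
  cases r <;> simp [Rel.isStrict, Rel.holds] at *
  · exact h.ne
  · exact h.ne'

/-- The difference variable of a clock that is not reset is constant along a run. -/
theorem run_eq_of_not_mem {σ : List (Transition n)} {p : ℕ → X n → ℝ}
    (hp : ∀ i, RExec σ (p i) (p (i + 1))) {x : Fin n} (hx : x ∉ resetClocks σ) (i : ℕ) :
    p i x.succ = p 0 x.succ := by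
  induction i with
  | zero => rfl
  | succ i ih => rw [RExec.eq_of_not_mem (hp i) hx, ih]

/-- A guard on a clock that is not reset is checked in every period of a run. -/
theorem run_check_of_not_mem {σ : List (Transition n)} {p : ℕ → X n → ℝ}
    (hp : ∀ i, RExec σ (p i) (p (i + 1))) {a : Atom n} (ha : Occurs σ a)
    (hx : a.clock ∉ resetClocks σ) (i : ℕ) :
    ∃ τ, p (i + 1) 0 ≤ τ ∧ τ ≤ p i 0 ∧ a.rel.holds (p 0 a.clock.succ - τ) a.const := by
  obtain ⟨τ, r, h1, h2, h3, h4 | h4⟩ := RExec.exists_check (hp i) ha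
  · rw [h4, run_eq_of_not_mem hp hx] at h3
    exact ⟨τ, h1, h2, h3⟩
  · exact absurd h4.2 hx

/-- The value of a clock that is reset, when it is checked, is at most the duration of two periods.
-/
theorem run_check_of_mem {σ : List (Transition n)} {p : ℕ → X n → ℝ}
    (hp : ∀ i, RExec σ (p i) (p (i + 1))) {a : Atom n} (ha : Occurs σ a)
    (hx : a.clock ∈ resetClocks σ) (i : ℕ) :
    ∃ r, r ≤ p i 0 - p (i + 2) 0 ∧ a.rel.holds r a.const := by
  obtain ⟨τ, r, h1, h2, h3, h4⟩ := RExec.exists_check (hp (i + 1)) ha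
  have h5 : r ≤ p i 0 := by
    rcases h4 with h4 | h4
    · rw [h4]
      exact (RExec.mem_Icc (hp i) hx).2
    · exact h4.1.trans (RExec.time_le (hp i))
  exact ⟨r - τ, by linarith, h3⟩

theorem not_omegaIterable_of_nonIterCondition {σ : List (Transition n)}
    (h : NonIterCondition σ) : ¬ OmegaIterable σ := by
  rintro ⟨v, hv⟩
  obtain ⟨B, p, -, hp, -⟩ := exists_bounded_run hv
  rcases h with ⟨a, b, ha, hb, hab, hr, hu, hl, hcd⟩ | ⟨a, b, ha, hb, hr, hl, hpos, hr', hu⟩ |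
    ⟨⟨x, hx, hxr, hxg, hx0⟩, a, b, ha, hb, hab, hr, hu, -, hl, -, hcd⟩
  · -- the lower bound is checked in the first period, and the upper bound in the second one
    obtain ⟨τ, h1, h2, h3⟩ := run_check_of_not_mem hp ha hr 1
    obtain ⟨τ', h4, h5, h6⟩ := run_check_of_not_mem hp hb (hab ▸ hr) 0
    rw [← hab] at h6
    have h7 := Rel.le_of_holds_upper hu h3
    have h8 := Rel.le_of_holds_lower hl h6
    have h4' : p 1 0 ≤ τ' := h4
    rcases hcd with hcd | ⟨hcd, hs⟩
    · have : (a.const : ℝ) < b.const := by exact_mod_cast hcd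
      linarith
    · have hc : (a.const : ℝ) = b.const := by exact_mod_cast hcd
      rcases hs with hs | hs
      · exact Rel.ne_of_holds_strict hs h3 (by linarith)
      · exact Rel.ne_of_holds_strict hs h6 (by linarith)
  · -- time diverges, but is bounded
    have hc : (1 : ℝ) ≤ a.const := by exact_mod_cast hpos
    have hdiv : ∀ m : ℕ, p (2 * m) 0 ≤ p 0 0 - m := by
      intro m
      induction m with
      | zero => simp
      | succ m ih =>
        obtain ⟨r, h1, h2⟩ := run_check_of_mem hp ha hr (2 * m)
        have h3 := Rel.le_of_holds_lower hl h2
        rw [show 2 * (m + 1) = 2 * m + 2 by ring]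
        push_cast
        linarith
    obtain ⟨m, hm⟩ := exists_nat_gt (b.const + p 0 0 - p 0 b.clock.succ)
    obtain ⟨τ, h1, h2, h3⟩ := run_check_of_not_mem hp hb hr' (2 * m)
    have h4 := Rel.le_of_holds_upper hu h3
    have h5 := hdiv m
    linarith
  · -- no time elapses after the lower bound has been checked
    obtain ⟨τ₁, h1, h2, h3⟩ := run_check_of_not_mem hp hb (hab ▸ hr) 0
    obtain ⟨τ₂, h4, h5, h6⟩ := run_check_of_not_mem hp ha hr 3
    obtain ⟨r, h7, h8⟩ := run_check_of_mem hp hx hxr 1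
    rw [hxg, hx0] at h8
    have h8' : (0 : ℝ) < r := by simpa [Rel.holds] using h8
    rw [← hab] at h3
    have h9 := Rel.le_of_holds_upper hu h6
    have h10 := Rel.le_of_holds_lower hl h3
    have hc : (a.const : ℝ) = b.const := by exact_mod_cast hcd
    have h1' : p 1 0 ≤ τ₁ := h1
    have h7' : r ≤ p 1 0 - p 3 0 := h7
    linarith

/-! ### Iterability without positive lower bounds -/

/-- A condition under which every transition can be executed, and which can be maintained, yields an
infinite run. -/
theorem omegaIterableFrom_of_invariant {σ : List (Transition n)} (I : Valuation n → Prop)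
    (hI : ∀ v, I v → ∀ t ∈ σ, ∃ δ v', Step t v δ v' ∧ I v') {v : Valuation n} (hv : I v) :
    OmegaIterableFrom σ v := by
  have key : ∀ τ : List (Transition n), (∀ t ∈ τ, t ∈ σ) → ∀ v, I v →
      ∃ δ v', Exec τ v δ v' ∧ I v' := by
    intro τ
    induction τ with
    | nil => exact fun _ v hv => ⟨0, v, Exec.nil v, hv⟩
    | cons t τ ih =>
      intro hτ v hv
      obtain ⟨δ, v', h1, h2⟩ := hI v hv t (hτ t (by simp))
      obtain ⟨ε, v'', h3, h4⟩ := ih (fun t ht => hτ t (by simp [ht])) v' h2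
      exact ⟨_, v'', Exec.cons h1 h3, h4⟩
  have hstep : ∀ u : {v // I v}, ∃ (u' : {v // I v}), ∃ δ, Exec σ u.1 δ u'.1 := fun u => by
    obtain ⟨δ, v', h1, h2⟩ := key σ (fun _ h => h) u.1 u.2
    exact ⟨⟨v', h2⟩, δ, h1⟩
  choose f δ hf using hstep
  let w : ℕ → {v // I v} := fun i => Nat.rec ⟨v, hv⟩ (fun _ u => f u) i
  exact ⟨fun i => (w i).1, fun i => δ (w i), rfl, fun i => hf (w i)⟩

/-- The largest lower bound on a clock. -/
theorem exists_greatest_lower (σ : List (Transition n)) (y : Fin n) :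
    ∃ L : ℕ, (∀ b, Occurs σ b → b.clock = y → b.rel.isLower → b.const ≤ L) ∧
      (L = 0 ∨ ∃ b, Occurs σ b ∧ b.clock = y ∧ b.rel.isLower ∧ b.const = L) := by
  set S : Set ℕ := {c | ∃ b, Occurs σ b ∧ b.clock = y ∧ b.rel.isLower ∧ b.const = c} with hS
  obtain ⟨C, hC⟩ := exists_const_bound σ
  have hbdd : BddAbove S := ⟨C, by
    rintro c ⟨b, ⟨t, ht, hb⟩, -, -, rfl⟩
    exact hC t ht b hb⟩
  refine ⟨sSup S, fun b h1 h2 h3 => le_csSup hbdd ⟨b, h1, h2, h3, rfl⟩, ?_⟩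
  rcases S.eq_empty_or_nonempty with h | h
  · left
    rw [h]
    simp
  · right
    obtain ⟨b, h1, h2, h3, h4⟩ := Nat.sSup_mem h hbdd
    exact ⟨b, h1, h2, h3, h4⟩

/-- A comparison holds if the bounds that it imposes are respected. -/
theorem Rel.holds_of_bounds {r : Rel} {x c : ℝ}
    (hu : r.isUpper = true → x < c ∨ (x = c ∧ r.isStrict = false))
    (hl : r.isLower = true → c < x ∨ (x = c ∧ r.isStrict = false)) : r.holds x c := by
  cases r <;> simp [Rel.isUpper, Rel.isLower, Rel.isStrict, Rel.holds] at *
  · exact hu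
  · rcases hu with h | h <;> linarith
  · rcases hu with h | h
    · rcases hl with h' | h' <;> linarith
    · exact h
  · rcases hl with h | h <;> linarith
  · exact hl

/-- Clocks that are reset stay below `1 / 2`. The other clocks start at their largest lower bound
or, if this is strict or time has to elapse, `1 / 2` above it, and stay within distance `1` of
it. -/
theorem omegaIterable_of_not_hasPositiveLower {σ : List (Transition n)}
    (h : ¬ NonIterCondition σ) (hpos : ¬ HasPositiveLower σ) (hdeg : NoDegenerateUpper σ) :
    OmegaIterable σ := by
  classical
  simp only [NonIterCondition, not_or] at h
  obtain ⟨hcon, -, hfro⟩ := h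
  choose L hL1 hL2 using exists_greatest_lower σ
  have hlow : ∀ a, Occurs σ a → a.clock ∈ resetClocks σ → a.rel.isLower → a.const = 0 :=
    fun a h1 h2 h3 => by
      by_contra hne
      exact hpos ⟨a, h1, h2, h3, Nat.pos_of_ne_zero hne⟩
  by_cases hgt : ∃ a, Occurs σ a ∧ a.clock ∈ resetClocks σ ∧ a.rel = Rel.gt ∧ a.const = 0
  · -- ever shorter delays keep the elapsed time below `1 / 2`
    have hup := hdeg.2 hgt
    have hsep : ∀ a, Occurs σ a → a.clock ∉ resetClocks σ → a.rel.isUpper →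
        L a.clock < a.const := by
      intro a ha hr hu
      rcases hL2 a.clock with h0 | ⟨b, hb, hba, hbl, hbc⟩
      · rw [h0]
        exact hup a ha hu
      · rw [← hbc]
        by_contra hle
        rcases (not_lt.1 hle).lt_or_eq with hlt | heq
        · exact hcon ⟨a, b, ha, hb, hba.symm, hr, hu, hbl, Or.inl hlt⟩
        · by_cases hs : a.rel.isStrict = true ∨ b.rel.isStrict = true
          · exact hcon ⟨a, b, ha, hb, hba.symm, hr, hu, hbl, Or.inr ⟨heq, hs⟩⟩
          · rw [not_or] at hs
            exact hfro ⟨hgt, a, b, ha, hb, hba.symm, hr, hu, hs.1, hbl, hs.2, heq⟩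
    refine ⟨fun x => if x ∈ resetClocks σ then 0 else L x + 1 / 2,
      omegaIterableFrom_of_invariant (fun v => ∃ e : ℝ≥0, e < 1 / 2 ∧ ∀ x,
        if x ∈ resetClocks σ then v x ≤ e else v x = L x + 1 / 2 + e) ?_ ⟨0, by simp, fun x => ?_⟩⟩
    · rintro v ⟨e, he, hv⟩ t ht
      obtain ⟨δ, hδ, hδe⟩ : ∃ δ : ℝ≥0, 0 < δ ∧ e + δ < 1 / 2 := by
        obtain ⟨c, h1, h2⟩ := exists_between he
        exact ⟨c - e, tsub_pos_of_lt h1, by rwa [add_tsub_cancel_of_le h1.le]⟩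
      have hδe' : (e : ℝ) + δ < 1 / 2 := by
        have := NNReal.coe_lt_coe.2 hδe
        push_cast at this
        exact this
      have hδ' : (0 : ℝ) < δ := NNReal.coe_pos.2 hδ
      have he0 : (0 : ℝ) ≤ e := e.coe_nonneg
      refine ⟨δ, _, ⟨?_, rfl⟩, e + δ, hδe, fun x => ?_⟩
      · intro a ha
        have hocc : Occurs σ a := ⟨t, ht, ha⟩
        have h1 := hv a.clock
        push_cast
        split_ifs at h1 with hr
        · have h1' : (v a.clock : ℝ) ≤ e := NNReal.coe_le_coe.2 h1
          have h0 : (0 : ℝ) ≤ v a.clock := (v a.clock).coe_nonneg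
          refine Rel.holds_of_bounds (fun hu => Or.inl ?_) (fun hl => Or.inl ?_)
          · have : (1 : ℝ) ≤ a.const := by exact_mod_cast hup a hocc hu
            linarith
          · rw [hlow a hocc hr hl]
            push_cast
            linarith
        · have h1' : (v a.clock : ℝ) = L a.clock + 1 / 2 + e := by
            rw [h1]
            push_cast
            ring
          refine Rel.holds_of_bounds (fun hu => Or.inl ?_) (fun hl => Or.inl ?_)
          · have : (L a.clock + 1 : ℝ) ≤ a.const := by exact_mod_cast hsep a hocc hr hu
            linarith
          · have : (a.const : ℝ) ≤ L a.clock := by exact_mod_cast hL1 _ a hocc rfl hl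
            linarith
      · have h1 := hv x
        by_cases hx : x ∈ resetClocks σ
        · rw [if_pos hx] at h1 ⊢
          split_ifs
          · exact bot_le
          · exact add_le_add h1 le_rfl
        · rw [if_neg hx] at h1 ⊢
          have hxt : x ∉ t.reset := fun hxt => hx (mem_resetClocks.2 ⟨t, ht, hxt⟩)
          rw [if_neg hxt, h1, add_assoc]
    · by_cases hx : x ∈ resetClocks σ <;> simp [hx]
  · -- without delays the valuation does not change
    have hs : ∀ y, ∃ s : ℝ≥0, (s = L y ∨ s = L y + 1 / 2) ∧
        (s = L y → ∀ b, Occurs σ b → b.clock = y → b.rel.isLower → b.rel.isStrict →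
          b.const ≠ L y) ∧
        (s = L y + 1 / 2 → ∃ b, Occurs σ b ∧ b.clock = y ∧ b.rel.isLower ∧ b.rel.isStrict ∧
          b.const = L y) := by
      intro y
      have hne : (L y : ℝ≥0) ≠ L y + 1 / 2 := by simp
      by_cases hex : ∃ b, Occurs σ b ∧ b.clock = y ∧ b.rel.isLower ∧ b.rel.isStrict ∧
          b.const = L y
      · exact ⟨L y + 1 / 2, Or.inr rfl, fun h => absurd h.symm hne, fun _ => hex⟩
      · exact ⟨L y, Or.inl rfl, fun _ b h1 h2 h3 h4 h5 => hex ⟨b, h1, h2, h3, h4, h5⟩,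
          fun h => absurd h hne⟩
    choose s hs1 hs2 hs3 using hs
    set v₀ : Valuation n := fun x => if x ∈ resetClocks σ then 0 else s x with hv₀
    refine ⟨v₀, omegaIterableFrom_of_invariant (fun v => v = v₀) ?_ rfl⟩
    rintro v rfl t ht
    refine ⟨0, _, ⟨?_, rfl⟩, ?_⟩
    · intro a ha
      have hocc : Occurs σ a := ⟨t, ht, ha⟩
      simp only [add_zero, hv₀]
      split_ifs with hr
      · rw [NNReal.coe_zero]
        refine Rel.holds_of_bounds (fun hu => ?_) (fun hl => Or.inr ?_)
        · rcases Nat.eq_zero_or_pos a.const with h0 | h0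
          · right
            rw [h0]
            refine ⟨by simp, ?_⟩
            by_contra hstr
            have hlt : a.rel = Rel.lt := by
              revert hu hstr
              cases a.rel <;> simp [Rel.isUpper, Rel.isStrict]
            have := hdeg.1 a hocc hlt
            omega
          · left
            exact_mod_cast h0
        · have h0 := hlow a hocc hr hl
          refine ⟨by simp [h0], ?_⟩
          by_contra hstr
          refine hgt ⟨a, hocc, hr, ?_, h0⟩
          revert hl hstr
          cases a.rel <;> simp [Rel.isLower, Rel.isStrict]
      · rcases hs1 a.clock with hsa | hsa
        · have hval : (s a.clock : ℝ) = L a.clock := by rw [hsa]; simp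
          rw [hval]
          refine Rel.holds_of_bounds (fun hu => ?_) (fun hl => ?_)
          · rcases hL2 a.clock with h0 | ⟨b, hb, hba, hbl, hbc⟩
            · rw [h0]
              rcases Nat.eq_zero_or_pos a.const with h0 | h0
              · right
                rw [h0]
                refine ⟨rfl, ?_⟩
                by_contra hstr
                have hlt : a.rel = Rel.lt := by
                  revert hu hstr
                  cases a.rel <;> simp [Rel.isUpper, Rel.isStrict]
                have := hdeg.1 a hocc hlt
                omega
              · left
                exact_mod_cast h0
            · have h1 : ¬ a.const < b.const := fun hlt =>
                hcon ⟨a, b, hocc, hb, hba.symm, hr, hu, hbl, Or.inl hlt⟩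
              have h2 : a.const = b.const → ¬ a.rel.isStrict = true := fun heq hstr =>
                hcon ⟨a, b, hocc, hb, hba.symm, hr, hu, hbl, Or.inr ⟨heq, Or.inl hstr⟩⟩
              rw [← hbc]
              rcases (not_lt.1 h1).lt_or_eq with hlt | heq
              · left
                exact_mod_cast hlt
              · right
                exact ⟨by rw [heq], by simpa using h2 heq.symm⟩
          · rcases (hL1 _ a hocc rfl hl).lt_or_eq with hlt | heq
            · left
              exact_mod_cast hlt
            · right
              refine ⟨by rw [heq], ?_⟩
              by_contra hstr
              exact hs2 _ hsa a hocc rfl hl (by simpa using hstr) heq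
        · have hval : (s a.clock : ℝ) = L a.clock + 1 / 2 := by rw [hsa]; push_cast; ring
          rw [hval]
          obtain ⟨b, hb, hba, hbl, hbs, hbc⟩ := hs3 _ hsa
          refine Rel.holds_of_bounds (fun hu => Or.inl ?_) (fun hl => Or.inl ?_)
          · have h1 : b.const < a.const := by
              by_contra hle
              rcases (not_lt.1 hle).lt_or_eq with hlt | heq
              · exact hcon ⟨a, b, hocc, hb, hba.symm, hr, hu, hbl, Or.inl hlt⟩
              · exact hcon ⟨a, b, hocc, hb, hba.symm, hr, hu, hbl, Or.inr ⟨heq, Or.inr hbs⟩⟩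
            have h2 : (L a.clock + 1 : ℝ) ≤ a.const := by
              rw [← hbc]
              exact_mod_cast h1
            linarith
          · have : (a.const : ℝ) ≤ L a.clock := by exact_mod_cast hL1 _ a hocc rfl hl
            linarith
    · funext x
      simp only [add_zero, hv₀]
      by_cases hx : x ∈ t.reset
      · rw [if_pos hx, if_pos (mem_resetClocks.2 ⟨t, ht, hx⟩)]
      · rw [if_neg hx]

/-! ### Removal of the guards on clocks that are not reset -/

theorem resetClocks_map {W : Finset (Fin n)} (σ : List (Transition n)) :
    resetClocks (σ.map fun t => (⟨t.guard.filter fun a => decide (a.clock ∈ W), t.reset⟩ :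
      Transition n)) = resetClocks σ := by
  induction σ with
  | nil => rfl
  | cons t σ ih => rw [List.map_cons, resetClocks, resetClocks, ih]

theorem resetClocks_removeUnreset (σ : List (Transition n)) :
    resetClocks (removeUnreset σ) = resetClocks σ :=
  resetClocks_map σ

theorem within_removeUnreset (σ : List (Transition n)) :
    Within (resetClocks (removeUnreset σ)) (removeUnreset σ) := by
  refine ⟨subset_rfl, ?_⟩
  rw [resetClocks_removeUnreset]
  intro t ht a ha
  obtain ⟨s, -, rfl⟩ := List.mem_map.1 ht
  simpa using (List.mem_filter.1 ha).2

theorem Exec.map_guards {f : Transition n → Transition n} {F : Valuation n → Valuation n}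
    {σ : List (Transition n)}
    (h : ∀ t ∈ σ, ∀ v δ v', Step t v δ v' → Step (f t) (F v) δ (F v'))
    {v v' : Valuation n} {δ : ℝ≥0} (hσ : Exec σ v δ v') : Exec (σ.map f) (F v) δ (F v') := by
  induction hσ with
  | nil => exact Exec.nil _
  | cons h1 _ ih =>
    exact Exec.cons (h _ (by simp) _ _ _ h1) (ih fun t ht => h t (by simp [ht]))

theorem Exec.of_map_guards {f : Transition n → Transition n} {F : Valuation n → Valuation n}
    {σ : List (Transition n)}
    (h : ∀ t ∈ σ, ∀ v δ v', Step (f t) v δ v' → Step t (F v) δ (F v'))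
    {v v' : Valuation n} {δ : ℝ≥0} (hσ : Exec (σ.map f) v δ v') : Exec σ (F v) δ (F v') := by
  induction σ generalizing v δ with
  | nil =>
    cases hσ
    exact Exec.nil _
  | cons t σ ih =>
    cases hσ with
    | cons h1 h2 =>
      exact Exec.cons (h _ (by simp) _ _ _ h1) (ih (fun t ht => h t (by simp [ht])) h2)

theorem omegaIterable_removeUnreset_iff {σ : List (Transition n)} (h : ¬ NonIterCondition σ)
    (hpos : HasPositiveLower σ) : OmegaIterable σ ↔ OmegaIterable (removeUnreset σ) := by
  constructor
  · rintro ⟨v, w, δ, h0, hw⟩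
    refine ⟨v, w, δ, h0, fun i => ?_⟩
    refine Exec.map_guards (F := id) ?_ (hw i)
    exact fun t _ v δ v' ht => ⟨fun a ha => ht.1 a (List.mem_filter.1 ha).1, ht.2⟩
  · -- clocks that are not reset have no upper bounds, and satisfy their lower bounds if large
    rintro ⟨v, w, δ, -, hw⟩
    simp only [NonIterCondition, not_or] at h
    obtain ⟨a, ha, har, hal, hac⟩ := hpos
    have hup : ∀ b, Occurs σ b → b.clock ∉ resetClocks σ → ¬ b.rel.isUpper = true :=
      fun b hb hbr hbu => h.2.1 ⟨a, b, ha, hb, har, hal, hac, hbr, hbu⟩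
    obtain ⟨C, hC⟩ := exists_const_bound σ
    refine ⟨_, fun i x => if x ∈ resetClocks σ then w i x else w i x + (C + 1), δ, rfl,
      fun i => ?_⟩
    refine Exec.of_map_guards
      (F := fun v x => if x ∈ resetClocks σ then v x else v x + (C + 1)) ?_ (hw i)
    rintro t ht v δ v' ⟨h1, rfl⟩
    refine ⟨?_, ?_⟩
    · intro b hb
      dsimp only
      split_ifs with hr
      · exact h1 b (List.mem_filter.2 ⟨hb, by simpa using hr⟩)
      · refine Rel.holds_of_bounds (fun hu => absurd hu (hup b ⟨t, ht, hb⟩ hr)) (fun _ => Or.inl ?_)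
        have h2 : (b.const : ℝ) ≤ C := by exact_mod_cast hC t ht b hb
        have h3 := (v b.clock).coe_nonneg
        have h4 := δ.coe_nonneg
        push_cast
        linarith
    · funext x
      dsimp only
      by_cases hx : x ∈ t.reset
      · rw [if_pos hx, if_pos hx, if_pos (mem_resetClocks.2 ⟨t, ht, hx⟩)]
      · rw [if_neg hx, if_neg hx]
        split_ifs
        · rfl
        · rw [add_right_comm]

theorem removeUnreset_eq_cons {σ : List (Transition n)} (hpos : HasPositiveLower σ) :
    ∃ t τ, removeUnreset σ = t :: τ := by
  obtain ⟨a, ⟨t, ht, -⟩, -⟩ := hpos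
  cases σ with
  | nil => simp at ht
  | cons t σ => exact ⟨_, _, rfl⟩

/-- Correctness of the individual answers for a sequence with a positive lower bound. -/
theorem correct_of_hasPositiveLower {σ : List (Transition n)} (h : ¬ NonIterCondition σ)
    (hpos : HasPositiveLower σ) (k : ℕ) :
    (power (removeUnreset σ) k = none → ¬ OmegaIterable σ) ∧
      ∀ G G' : TGraph n 1, power (removeUnreset σ) k = some G →
        power (removeUnreset σ) (k + 1) = some G' →
        (¬ Similar G' G → n ^ 2 < 2 ^ k → ¬ OmegaIterable σ) ∧
        (Similar G' G → OmegaIterable σ ∧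
          (left G).zone = {v | OmegaIterableFrom (removeUnreset σ) v}) := by
  rw [omegaIterable_removeUnreset_iff h hpos]
  have hW := within_removeUnreset σ
  obtain ⟨t, τ, hσ⟩ := removeUnreset_eq_cons hpos
  obtain ⟨a, -, ha, -⟩ := hpos
  rw [← resetClocks_removeUnreset] at ha
  rw [hσ] at hW ha ⊢
  refine ⟨not_omegaIterable_of_power_eq_none,
    fun G G' hG hG' => ⟨fun hs hk hit => ?_, fun hs => ?_⟩⟩
  · exact hs (similar_of_omegaIterable hW ha hk hG hG' hit)
  · obtain ⟨h1, h2⟩ := zone_of_similar hG hG' hs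
    exact ⟨h2 hW, h1⟩

end

/-! ### Values computed by the implementation -/

section Values

variable {α β ι : Type}

theorem bind_val (m : Timed α) (f : α → Timed β) : (m >>= f).val = (f m.val).val := rfl

theorem bind_cost (m : Timed α) (f : α → Timed β) :
    (m >>= f).cost = m.cost + (f m.val).cost := rfl

theorem step_val (a : α) : (step a).val = a := rfl

theorem step_cost (a : α) : (step a).cost = 1 := rfl

theorem tabulate_val [Fintype ι] (f : ι → Timed α) : (tabulate f).val = fun i => (f i).val := rfl

theorem loop_val (f : β → α → Timed β) (b : β) (l : List α) :
    (loop f b l).val = l.foldl (fun b a => (f b a).val) b := by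
  induction l generalizing b with
  | nil => rfl
  | cons a l ih => exact ih _

theorem anyT_val (p : α → Timed Bool) (l : List α) :
    (anyT p l).val = l.any fun a => (p a).val := by
  rw [anyT, loop_val]
  have key : ∀ b : Bool, l.foldl (fun b a => b || (p a).val) b =
      (b || l.any fun a => (p a).val) := by
    induction l with
    | nil => simp
    | cons a l ih => intro b; rw [List.foldl_cons, ih, List.any_cons, Bool.or_assoc]
  exact key false

variable {n k l : ℕ}

theorem mem_vertices (u : Vertex n k) : u ∈ vertices n k := by
  obtain ⟨i, x⟩ := u
  exact List.mem_product.2 ⟨List.mem_finRange i, List.mem_finRange x⟩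

theorem floydWarshall_val (G : TGraph n k) :
    (floydWarshall G).val = (vertices n k).foldl relax (withDiag G) := by
  rw [floydWarshall, bind_val, loop_val]
  rfl

theorem shortT_val (G : TGraph n k) : (shortT G).val = short G := by
  have hl := hasNegativeCycle_iff (G := G) (mem_vertices (n := n) (k := k))
  have hval : (shortT G).val = if (vertices n k).any (fun u =>
      wless ((floydWarshall G).val u u) (wle 0)) then none
      else some (outer (floydWarshall G).val) := by
    rw [shortT, bind_val, bind_val, anyT_val]
    by_cases h : ((vertices n k).any fun u => wless ((floydWarshall G).val u u) (wle 0)) = true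
    · exact (congrArg Timed.val (if_pos h)).trans (if_pos h).symm
    · exact (congrArg Timed.val (if_neg h)).trans (if_neg h).symm
  rw [hval, short, floydWarshall_val]
  have hany : ((vertices n k).any fun u =>
      wless ((vertices n k).foldl relax (withDiag G) u u) (wle 0)) = true ↔
      HasNegativeCycle G := by
    rw [hl, List.any_eq_true]
    constructor
    · rintro ⟨u, -, hu⟩
      exact ⟨u, (wless_iff _ _).1 hu⟩
    · rintro ⟨u, hu⟩
      exact ⟨u, mem_vertices u, (wless_iff _ _).2 hu⟩
  by_cases hc : HasNegativeCycle G
  · rw [if_pos hc, if_pos (hany.2 hc)]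
  · rw [if_neg hc, if_neg fun h => hc (hany.1 h), canon_eq_foldl_relax mem_vertices]
    intro u
    by_contra hu
    exact hc (hl.2 ⟨u, not_le.1 hu⟩)

theorem mulT_val (G H : TGraph n 1) : (mulT G H).val = short (comp G H) := by
  rw [mulT, bind_val, shortT_val]
  rfl

theorem boundsT_val (b : (Fin n → Weight) × (Fin n → Weight)) (g : List (Atom n)) :
    (boundsT b g).val =
      (fun x => min (guardUpper x g) (b.1 x), fun x => min (guardLower x g) (b.2 x)) := by
  rw [boundsT, loop_val]
  induction g generalizing b with
  | nil => simp [guardUpper, guardLower]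
  | cons a g ih =>
    rw [List.foldl_cons, ih]
    simp only [bind_val, step_val, guardUpper, guardLower]
    refine Prod.ext (funext fun x => ?_) (funext fun x => ?_)
    · by_cases hx : a.clock = x
      · subst hx
        simp only [Function.update_self, if_true]
        rw [min_left_comm, ← min_assoc]
      · simp [hx, Function.update_of_ne (Ne.symm hx)]
    · by_cases hx : a.clock = x
      · subst hx
        simp only [Function.update_self, if_true]
        rw [min_left_comm, ← min_assoc]
      · simp [hx, Function.update_of_ne (Ne.symm hx)]

theorem noBoundsT_val (n : ℕ) : (noBoundsT n).val = (fun _ => ⊤, fun _ => ⊤) := rfl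

theorem transGraphT_val (t : Transition n) : (transGraphT t).val = short (transGraph t) := by
  rw [transGraphT, bind_val, bind_val, bind_val, bind_val, shortT_val, boundsT_val, noBoundsT_val]
  simp only [tabulate_val, step_val, min_eq_left le_top]
  rfl

/-- Incremental composition yields the same short graph as the composition of all graphs. -/
theorem short_comp_congr {G : TGraph n k} {H : TGraph n l} {G' H' : TGraph n 1}
    (hG : short G = some G') (hH : short H = some H') :
    short (comp G' H') = short (comp G H) := by
  refine short_congr fun p q => ?_
  simp only [grel_comp, (short_eq_some hG).2, (short_eq_some hH).2]

theorem short_comp_eq_none {G : TGraph n k} {H : TGraph n l}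
    (h : short G = none ∨ short H = none) : short (comp G H) = none := by
  simp only [short_eq_none_iff, grel_comp] at h ⊢
  rintro p q ⟨m, h1, h2⟩
  rcases h with h | h
  · exact h _ _ h1
  · exact h _ _ h2

theorem seqGraphT_val (t : Transition n) (σ : List (Transition n)) :
    (seqGraphT (t :: σ)).val = short (seqGraph t σ) := by
  induction σ generalizing t with
  | nil => exact transGraphT_val t
  | cons s σ ih =>
    have ht := transGraphT_val t
    have hs := ih s
    have hval : (seqGraphT (t :: s :: σ)).val =
        (match (transGraphT t).val, (seqGraphT (s :: σ)).val with
          | some G, some H => mulT G H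
          | _, _ => step none).val := rfl
    rw [hval, ht, hs]
    change _ = short (comp (transGraph t) (seqGraph s σ))
    rcases hG : short (transGraph t) with _ | G
    · exact (short_comp_eq_none (Or.inl hG)).symm
    · rcases hH : short (seqGraph s σ) with _ | H
      · exact (short_comp_eq_none (Or.inr hH)).symm
      · exact (mulT_val G H).trans (short_comp_congr hG hH)

theorem similarT_val (G H : TGraph n 1) : (similarT G H).val = true ↔ Similar G H := by
  have hval : (similarT G H).val = !((List.finRange (n + 1)).any fun x =>
      (List.finRange (n + 1)).any fun y => decide (G (0, x) (0, y) ≠ H (0, x) (0, y)) ||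
        decide (G (1, x) (1, y) ≠ H (1, x) (1, y))) := by
    rw [similarT, bind_val, anyT_val]
    simp only [anyT_val]
    rfl
  rw [hval, Bool.not_eq_true', ← Bool.not_eq_true]
  simp only [List.any_eq_true, List.mem_finRange, true_and, Bool.or_eq_true, decide_eq_true_eq,
    not_exists, not_or, not_not]
  constructor
  · exact fun h => ⟨funext fun x => funext fun y => (h x y).1,
      funext fun x => funext fun y => (h x y).2⟩
  · exact fun h x y => ⟨congrFun (congrFun h.1 x) y, congrFun (congrFun h.2 x) y⟩

theorem squaringT_val {σ : List (Transition n)} (fuel k : ℕ) {G : TGraph n 1}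
    (hG : power σ k = some G) :
    (squaringT fuel (2 ^ k) G).val = squaring σ fuel k := by
  induction fuel generalizing k G with
  | zero => rfl
  | succ fuel ih =>
    rw [squaringT, squaring, bind_val, mulT_val, hG]
    have hpow : power σ (k + 1) = short (comp G G) := by rw [power, hG]; rfl
    rw [hpow]
    rcases hG' : short (comp G G) with _ | G'
    · rfl
    · dsimp only
      rw [bind_val]
      by_cases hs : Similar G' G
      · rw [if_pos ((similarT_val _ _).2 hs), if_pos hs]
        rfl
      · rw [if_neg (fun h => hs ((similarT_val _ _).1 h)), if_neg hs, bind_val, step_val]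
        by_cases hn : n ^ 2 < 2 ^ k
        · rw [if_pos (by rw [← sq]; simpa using hn), if_pos hn]
          rfl
        · rw [if_neg (by rw [← sq]; simpa using hn), if_neg hn, bind_val, step_val, ← mul_two,
            ← pow_succ]
          exact ih (k + 1) (hpow.trans hG')

theorem resetT_val (σ : List (Transition n)) :
    (resetT σ).val = fun x => decide (x ∈ resetClocks σ) := by
  rw [resetT, bind_val, loop_val]
  have key : ∀ r : Fin n → Bool, σ.foldl (fun r t => fun x => r x || decide (x ∈ t.reset)) r =
      fun x => r x || decide (x ∈ resetClocks σ) := by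
    induction σ with
    | nil => simp [resetClocks]
    | cons t σ ih =>
      intro r
      rw [List.foldl_cons, ih]
      funext x
      simp [resetClocks, Bool.or_assoc]
  exact (key _).trans (by simp [tabulate_val, step_val])

theorem guardUpper_append (x : Fin n) (g h : List (Atom n)) :
    guardUpper x (g ++ h) = min (guardUpper x g) (guardUpper x h) := by
  induction g with
  | nil => simp [guardUpper]
  | cons a g ih =>
    rw [List.cons_append, guardUpper, guardUpper, ih]
    split_ifs
    · rw [min_assoc]
    · rfl

theorem guardLower_append (x : Fin n) (g h : List (Atom n)) :
    guardLower x (g ++ h) = min (guardLower x g) (guardLower x h) := by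
  induction g with
  | nil => simp [guardLower]
  | cons a g ih =>
    rw [List.cons_append, guardLower, guardLower, ih]
    split_ifs
    · rw [min_assoc]
    · rfl

/-- All atomic constraints in the guards of a sequence. -/
def atoms (σ : List (Transition n)) : List (Atom n) := σ.flatMap Transition.guard

theorem mem_atoms {σ : List (Transition n)} {a : Atom n} : a ∈ atoms σ ↔ Occurs σ a :=
  List.mem_flatMap

theorem summaryT_val (r : Fin n → Bool) (σ : List (Transition n)) :
    (summaryT r σ).val =
      ⟨(atoms σ).any fun a => r a.clock && a.rel.isLower && decide (0 < a.const),
       (atoms σ).any fun a => r a.clock && a.rel.isLower && a.rel.isStrict && decide (a.const = 0),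
       (atoms σ).any fun a => !r a.clock && a.rel.isUpper,
       (fun x => guardUpper x (atoms σ), fun x => guardLower x (atoms σ))⟩ := by
  have inner : ∀ (g : List (Atom n)) (s : Summary n),
      g.foldl (fun (s : Summary n) a => (⟨s.posLower || (r a.clock && a.rel.isLower &&
          decide (0 < a.const)),
        s.gtZero || (r a.clock && a.rel.isLower && a.rel.isStrict && decide (a.const = 0)),
        s.upperUnreset || (!r a.clock && a.rel.isUpper), s.bounds⟩ : Summary n)) s =
      ⟨s.posLower || g.any fun a => r a.clock && a.rel.isLower && decide (0 < a.const),
       s.gtZero || g.any fun a => r a.clock && a.rel.isLower && a.rel.isStrict &&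
          decide (a.const = 0),
       s.upperUnreset || g.any fun a => !r a.clock && a.rel.isUpper, s.bounds⟩ := by
    intro g
    induction g with
    | nil => intro s; simp
    | cons a g ih =>
      intro s
      rw [List.foldl_cons, ih]
      simp only [List.any_cons, Bool.or_assoc]
  have outer : ∀ (σ : List (Transition n)) (s : Summary n),
      (loop (fun s t => do
        let s' ← loop (fun (s : Summary n) a => do
          let isReset ← step (r a.clock)
          let p ← step (s.posLower || (isReset && a.rel.isLower && decide (0 < a.const)))
          let q ← step (s.gtZero ||
            (isReset && a.rel.isLower && a.rel.isStrict && decide (a.const = 0)))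
          let u ← step (s.upperUnreset || (!isReset && a.rel.isUpper))
          step (⟨p, q, u, s.bounds⟩ : Summary n)) s t.guard
        let b ← boundsT s'.bounds t.guard
        step (⟨s'.posLower, s'.gtZero, s'.upperUnreset, b⟩ : Summary n)) s σ).val =
      ⟨s.posLower || (atoms σ).any fun a => r a.clock && a.rel.isLower && decide (0 < a.const),
       s.gtZero || (atoms σ).any fun a => r a.clock && a.rel.isLower && a.rel.isStrict &&
          decide (a.const = 0),
       s.upperUnreset || (atoms σ).any fun a => !r a.clock && a.rel.isUpper,
       (fun x => min (guardUpper x (atoms σ)) (s.bounds.1 x),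
        fun x => min (guardLower x (atoms σ)) (s.bounds.2 x))⟩ := by
    intro σ
    induction σ with
    | nil => intro s; simp [loop, step_val, atoms, guardUpper, guardLower]
    | cons t σ ih =>
      intro s
      rw [loop, bind_val, bind_val, ih, step_val]
      simp only [bind_val, loop_val, step_val, inner, boundsT_val]
      have ha : atoms (t :: σ) = t.guard ++ atoms σ := rfl
      simp only [ha, List.any_append, Bool.or_assoc, guardUpper_append, guardLower_append]
      congr 2
      · funext x
        rw [← min_assoc, min_comm (guardUpper x (atoms σ))]
      · funext x
        rw [← min_assoc, min_comm (guardLower x (atoms σ))]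
  rw [summaryT, bind_val, outer, noBoundsT_val]
  simp

theorem guardUpper_le {x : Fin n} {g : List (Atom n)} {a : Atom n} (ha : a ∈ g)
    (hx : a.clock = x) : guardUpper x g ≤ a.upper := by
  induction g with
  | nil => simp at ha
  | cons b g ih =>
    rw [guardUpper]
    rcases List.mem_cons.1 ha with rfl | ha
    · rw [if_pos hx]
      exact min_le_left _ _
    · split_ifs
      · exact (min_le_right _ _).trans (ih ha)
      · exact ih ha

theorem guardLower_le {x : Fin n} {g : List (Atom n)} {a : Atom n} (ha : a ∈ g)
    (hx : a.clock = x) : guardLower x g ≤ a.lower := by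
  induction g with
  | nil => simp at ha
  | cons b g ih =>
    rw [guardLower]
    rcases List.mem_cons.1 ha with rfl | ha
    · rw [if_pos hx]
      exact min_le_left _ _
    · split_ifs
      · exact (min_le_right _ _).trans (ih ha)
      · exact ih ha

theorem exists_guardUpper_eq (x : Fin n) (g : List (Atom n)) :
    guardUpper x g = ⊤ ∨ ∃ a ∈ g, a.clock = x ∧ guardUpper x g = a.upper := by
  induction g with
  | nil => exact Or.inl rfl
  | cons b g ih =>
    rw [guardUpper]
    split_ifs with hb
    · rcases min_choice b.upper (guardUpper x g) with h | h
      · exact Or.inr ⟨b, by simp, hb, h⟩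
      · rw [h]
        rcases ih with ih | ⟨a, h1, h2, h3⟩
        · exact Or.inl ih
        · exact Or.inr ⟨a, by simp [h1], h2, h3⟩
    · rcases ih with ih | ⟨a, h1, h2, h3⟩
      · exact Or.inl ih
      · exact Or.inr ⟨a, by simp [h1], h2, h3⟩

theorem exists_guardLower_eq (x : Fin n) (g : List (Atom n)) :
    guardLower x g = ⊤ ∨ ∃ a ∈ g, a.clock = x ∧ guardLower x g = a.lower := by
  induction g with
  | nil => exact Or.inl rfl
  | cons b g ih =>
    rw [guardLower]
    split_ifs with hb
    · rcases min_choice b.lower (guardLower x g) with h | h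
      · exact Or.inr ⟨b, by simp, hb, h⟩
      · rw [h]
        rcases ih with ih | ⟨a, h1, h2, h3⟩
        · exact Or.inl ih
        · exact Or.inr ⟨a, by simp [h1], h2, h3⟩
    · rcases ih with ih | ⟨a, h1, h2, h3⟩
      · exact Or.inl ih
      · exact Or.inr ⟨a, by simp [h1], h2, h3⟩

/-- Comparing the tightest bounds on a clock means looking for a pair of constraints. -/
theorem guardUpper_add_guardLower_le_iff {x : Fin n} {g : List (Atom n)} {w : Weight} (hw : w ≠ ⊤) :
    guardUpper x g + guardLower x g ≤ w ↔
      ∃ a ∈ g, ∃ b ∈ g, a.clock = x ∧ b.clock = x ∧ a.upper + b.lower ≤ w := by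
  constructor
  · intro h
    rcases exists_guardUpper_eq x g with h1 | ⟨a, ha, hax, h1⟩
    · rw [h1, top_add_weight, top_le_iff] at h
      exact absurd h hw
    · rcases exists_guardLower_eq x g with h2 | ⟨b, hb, hbx, h2⟩
      · rw [h2, add_top_weight, top_le_iff] at h
        exact absurd h hw
      · exact ⟨a, ha, b, hb, hax, hbx, by rwa [h1, h2] at h⟩
  · rintro ⟨a, ha, b, hb, hax, hbx, h⟩
    exact (add_le_add (guardUpper_le ha hax) (guardLower_le hb hbx)).trans h

theorem Atom.upper_eq (a : Atom n) :
    a.upper = if a.rel.isUpper then wmk a.const (!a.rel.isStrict) else ⊤ := by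
  obtain ⟨x, r, c⟩ := a
  cases r <;> rfl

theorem Atom.lower_eq (a : Atom n) :
    a.lower = if a.rel.isLower then wmk (-a.const) (!a.rel.isStrict) else ⊤ := by
  obtain ⟨x, r, c⟩ := a
  cases r <;> rfl

theorem upper_add_lower_le_iff {a b : Atom n} {s : Bool} :
    a.upper + b.lower ≤ wmk 0 s ↔ a.rel.isUpper ∧ b.rel.isLower ∧
      (a.const < b.const ∨
        (a.const = b.const ∧ (s = false → a.rel.isStrict ∨ b.rel.isStrict))) := by
  rw [Atom.upper_eq, Atom.lower_eq]
  split_ifs with h1 h2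
  · rw [wmk_add, wmk_le_wmk]
    simp only [h1, h2, true_and]
    refine or_congr (by omega) (and_congr (by omega) ?_)
    cases s <;> cases a.rel.isStrict <;> cases b.rel.isStrict <;> simp
  · simp [h2, add_top_weight, wmk_ne_top]
  · simp [h1, top_add_weight, wmk_ne_top]
  · simp [h1, top_add_weight, wmk_ne_top]

theorem wmk_lt_zero_iff {a : Weight} : a < wle 0 ↔ a ≤ wmk 0 false := by
  rcases weight_cases a with rfl | ⟨d, s, rfl⟩
  · simp [wmk_ne_top]
  · rw [wle_eq_wmk, wmk_lt_wmk, wmk_le_wmk]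
    cases s <;> simp

/-- For the third condition, the implementation only tests `≤` between the constants of an upper and
a lower bound; this suffices because `<` and strict bounds are covered by the first condition. -/
theorem nonIterT_val (σ : List (Transition n)) :
    (nonIterT (fun x => decide (x ∈ resetClocks σ))
      (summaryT (fun x => decide (x ∈ resetClocks σ)) σ).val).val = true ↔ NonIterCondition σ := by
  rw [summaryT_val]
  simp only [nonIterT, bind_val, anyT_val, step_val, Bool.or_eq_true, Bool.and_eq_true,
    List.any_eq_true, List.mem_finRange, true_and, Bool.not_eq_true', wless_iff,
    decide_eq_false_iff_not, decide_eq_true_eq, mem_atoms]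
  have h1 : (∃ x, x ∉ resetClocks σ ∧
      wadd (guardUpper x (atoms σ)) (guardLower x (atoms σ)) < wle 0) ↔ ContradictoryBounds σ := by
    simp only [wadd_eq_add, wmk_lt_zero_iff, guardUpper_add_guardLower_le_iff (wmk_ne_top 0 false),
      upper_add_lower_le_iff, mem_atoms, forall_const]
    constructor
    · rintro ⟨x, hx, a, ha, b, hb, rfl, hbx, h1, h2, h3⟩
      exact ⟨a, b, ha, hb, hbx.symm, hx, h1, h2, h3⟩
    · rintro ⟨a, b, ha, hb, hab, hx, h1, h2, h3⟩
      exact ⟨_, hx, a, ha, b, hb, rfl, hab.symm, h1, h2, h3⟩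
  have h3 : (∃ x, x ∉ resetClocks σ ∧
      wless (wle 0) (wadd (guardUpper x (atoms σ)) (guardLower x (atoms σ))) = false) ↔
      ∃ a b, Occurs σ a ∧ Occurs σ b ∧ a.clock = b.clock ∧ a.clock ∉ resetClocks σ ∧
        a.rel.isUpper ∧ b.rel.isLower ∧ a.const ≤ b.const := by
    have : ∀ w : Weight, wless (wle 0) w = false ↔ w ≤ wmk 0 true := fun w => by
      rw [← Bool.not_eq_true, wless_iff, not_lt]
      rfl
    simp only [this, wadd_eq_add, guardUpper_add_guardLower_le_iff (wmk_ne_top 0 true),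
      upper_add_lower_le_iff, mem_atoms]
    constructor
    · rintro ⟨x, hx, a, ha, b, hb, rfl, hbx, h1, h2, h3⟩
      exact ⟨a, b, ha, hb, hbx.symm, hx, h1, h2, by omega⟩
    · rintro ⟨a, b, ha, hb, hab, hx, h1, h2, h3⟩
      refine ⟨_, hx, a, ha, b, hb, rfl, hab.symm, h1, h2, ?_⟩
      rcases h3.lt_or_eq with h3 | h3
      · exact Or.inl h3
      · exact Or.inr ⟨h3, by simp⟩
  rw [h1, h3, NonIterCondition, or_assoc]
  have hgt : ∀ r : Rel, r = Rel.gt ↔ r.isLower = true ∧ r.isStrict = true := by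
    intro r
    cases r <;> simp [Rel.isLower, Rel.isStrict]
  constructor
  · rintro (h | ⟨⟨a, ha, ⟨har, hal⟩, hac⟩, b, hb, hbr, hbu⟩ |
      ⟨⟨x, hx, ⟨⟨hxr, hxl⟩, hxs⟩, hxc⟩, a, b, ha, hb, hab, hr, hu, hl, hc⟩)
    · exact Or.inl h
    · exact Or.inr (Or.inl ⟨a, b, ha, hb, har, hal, hac, hbr, hbu⟩)
    · by_cases hcon : ContradictoryBounds σ
      · exact Or.inl hcon
      · refine Or.inr (Or.inr ⟨⟨x, hx, hxr, (hgt _).2 ⟨hxl, hxs⟩, hxc⟩, a, b, ha, hb, hab, hr, hu,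
          fun hs => ?_, hl, fun hs => ?_, ?_⟩)
        · rcases hc.lt_or_eq with hc | hc
          · exact hcon ⟨a, b, ha, hb, hab, hr, hu, hl, Or.inl hc⟩
          · exact hcon ⟨a, b, ha, hb, hab, hr, hu, hl, Or.inr ⟨hc, Or.inl hs⟩⟩
        · rcases hc.lt_or_eq with hc | hc
          · exact hcon ⟨a, b, ha, hb, hab, hr, hu, hl, Or.inl hc⟩
          · exact hcon ⟨a, b, ha, hb, hab, hr, hu, hl, Or.inr ⟨hc, Or.inr hs⟩⟩
        · rcases hc.lt_or_eq with hc | hc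
          · exact absurd ⟨a, b, ha, hb, hab, hr, hu, hl, Or.inl hc⟩ hcon
          · exact hc
  · rintro (h | ⟨a, b, ha, hb, har, hal, hac, hbr, hbu⟩ |
      ⟨⟨x, hx, hxr, hxg, hxc⟩, a, b, ha, hb, hab, hr, hu, -, hl, -, hc⟩)
    · exact Or.inl h
    · exact Or.inr (Or.inl ⟨⟨a, ha, ⟨har, hal⟩, hac⟩, b, hb, hbr, hbu⟩)
    · exact Or.inr (Or.inr ⟨⟨x, hx, ⟨⟨hxr, ((hgt _).1 hxg).1⟩, ((hgt _).1 hxg).2⟩, hxc⟩,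
        a, b, ha, hb, hab, hr, hu, hl, hc.le⟩)

theorem summaryT_posLower (σ : List (Transition n)) :
    (summaryT (fun x => decide (x ∈ resetClocks σ)) σ).val.posLower = true ↔
      HasPositiveLower σ := by
  rw [summaryT_val]
  simp only [List.any_eq_true, Bool.and_eq_true, decide_eq_true_eq, mem_atoms, and_assoc]
  rfl

/-- The loop that removes guards collects them in reverse order. -/
theorem filterT_val (r : Fin n → Bool) (g acc : List (Atom n)) :
    (loop (fun g a => do
      let isReset ← step (r a.clock)
      if isReset then step (a :: g) else step g) acc g).val =
      (g.filter fun a => r a.clock).reverse ++ acc := by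
  rw [loop_val]
  induction g generalizing acc with
  | nil => rfl
  | cons a g ih =>
    rw [List.foldl_cons, ih, List.filter_cons, bind_val, step_val]
    split_ifs <;> simp [step_val]

theorem reverseT_val (g acc : List (Atom n)) :
    (loop (fun g a => step (a :: g)) acc g).val = g.reverse ++ acc := by
  rw [loop_val]
  induction g generalizing acc with
  | nil => rfl
  | cons a g ih =>
    rw [List.foldl_cons, ih]
    simp [step_val]

theorem removeUnresetT_val (r : Fin n → Bool) (σ : List (Transition n)) :
    (removeUnresetT r σ).val = σ.map fun t => ⟨t.guard.filter fun a => r a.clock, t.reset⟩ := by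
  induction σ with
  | nil => rfl
  | cons t σ ih =>
    rw [removeUnresetT, bind_val, bind_val, bind_val, step_val, ih, filterT_val, reverseT_val]
    simp

theorem iterTest_val (σ : List (Transition n)) : (iterTest σ).val = procedure σ := by
  rw [iterTest, bind_val, bind_val, bind_val, resetT_val, procedure]
  by_cases hc : NonIterCondition σ
  · rw [if_pos ((nonIterT_val σ).2 hc), if_pos hc]
    rfl
  · rw [if_neg fun h => hc ((nonIterT_val σ).1 h), if_neg hc]
    by_cases hp : HasPositiveLower σ
    · rw [if_neg (by simpa using (summaryT_posLower σ).2 hp), if_neg (not_not.2 hp), bind_val,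
        bind_val, removeUnresetT_val]
      obtain ⟨t, τ, hσ⟩ := removeUnreset_eq_cons hp
      change (match (seqGraphT (removeUnreset σ)).val with
        | none => step Verdict.notIterable
        | some G => squaringT (n ^ 2 + 1) 1 G).val = _
      rw [hσ, seqGraphT_val]
      have h0 : power (t :: τ) 0 = short (seqGraph t τ) := rfl
      rcases hG : short (seqGraph t τ) with _ | G
      · rw [hG] at h0
        rw [squaring, h0]
        rfl
      · exact squaringT_val (n ^ 2 + 1) 0 (h0.trans hG)
    · rw [if_pos (by
        rw [Bool.not_eq_true', ← Bool.not_eq_true, summaryT_posLower]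
        exact hp), if_pos hp]
      rfl

/-! ### Correctness of the procedure -/

/-- The rounds are not exhausted before the loop gives up, since `2 ^ (n ^ 2) > n ^ 2`. -/
theorem not_omegaIterable_of_squaring {σ : List (Transition n)} (h : ¬ NonIterCondition σ)
    (hpos : HasPositiveLower σ) {fuel k : ℕ} (hk : fuel + k = n ^ 2 + 1)
    (hkn : ∀ j, j + 1 = k → 2 ^ j ≤ n ^ 2)
    (hs : squaring (removeUnreset σ) fuel k = Verdict.notIterable) : ¬ OmegaIterable σ := by
  induction fuel generalizing k with
  | zero => exact absurd (hkn (n ^ 2) (by omega)) (not_le.2 Nat.lt_two_pow_self)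
  | succ fuel ih =>
    obtain ⟨h1, h2⟩ := correct_of_hasPositiveLower h hpos k
    rw [squaring] at hs
    rcases hG : power (removeUnreset σ) k with _ | G
    · exact h1 hG
    · rcases hG' : power (removeUnreset σ) (k + 1) with _ | G'
      · exact (correct_of_hasPositiveLower h hpos (k + 1)).1 hG'
      · simp only [hG, hG'] at hs
        obtain ⟨h3, -⟩ := h2 G G' hG hG'
        split_ifs at hs with g1 g2
        · exact h3 g1 g2
        · refine ih (by omega) (fun j hj => ?_) hs
          obtain rfl : j = k := by omega
          exact not_lt.1 g2

theorem squaring_ne_iterable (σ : List (Transition n)) (fuel k : ℕ) :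
    squaring σ fuel k ≠ Verdict.iterable := by
  induction fuel generalizing k with
  | zero => exact fun h => nomatch h
  | succ fuel ih =>
    rw [squaring]
    rcases power σ k with _ | G
    · exact fun h => nomatch h
    · rcases power σ (k + 1) with _ | G'
      · exact fun h => nomatch h
      · dsimp only
        split_ifs
        · exact fun h => nomatch h
        · exact fun h => nomatch h
        · exact ih _

theorem exists_of_squaring_eq_zone {σ : List (Transition n)} {fuel k : ℕ} {Z : DBM n}
    (h : squaring σ fuel k = Verdict.zone Z) : ∃ j G G', power σ j = some G ∧
      power σ (j + 1) = some G' ∧ Similar G' G ∧ Z = left G := by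
  induction fuel generalizing k with
  | zero => exact nomatch h
  | succ fuel ih =>
    rw [squaring] at h
    rcases hG : power σ k with _ | G
    · rw [hG] at h
      exact nomatch h
    · rcases hG' : power σ (k + 1) with _ | G'
      · rw [hG, hG'] at h
        exact nomatch h
      · simp only [hG, hG'] at h
        split_ifs at h with g1 g2
        · exact ⟨k, G, G', hG, hG', g1, (Verdict.zone.inj h).symm⟩
        · exact ih h

end Values

/-! ### The number of steps -/

section Cost

variable {α β ι : Type} {n k : ℕ}

theorem tabulate_cost_le [Fintype ι] {f : ι → Timed α} {c : ℕ} (h : ∀ i, (f i).cost ≤ c) :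
    (tabulate f).cost ≤ Fintype.card ι * (c + 1) := by
  refine (Finset.sum_le_card_nsmul _ _ (c + 1) fun i _ => by
    have := h i
    omega).trans ?_
  rw [Finset.card_univ, smul_eq_mul]

theorem loop_cost_le {f : β → α → Timed β} {c : ℕ} (l : List α)
    (h : ∀ b, ∀ a ∈ l, (f b a).cost ≤ c) (b : β) :
    (loop f b l).cost ≤ l.length * (c + 1) + 1 := by
  induction l generalizing b with
  | nil => simp [loop, step_cost]
  | cons a l ih =>
    rw [loop, bind_cost, bind_cost, step_cost, step_val, List.length_cons, add_mul]
    have h1 := h b a (by simp)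
    have h2 := ih (fun b a ha => h b a (by simp [ha])) (f b a).val
    omega

theorem anyT_cost_le {p : α → Timed Bool} {c : ℕ} (l : List α) (h : ∀ a, (p a).cost ≤ c) :
    (anyT p l).cost ≤ l.length * (c + 2) + 1 :=
  loop_cost_le l (fun b a _ => by
    rw [bind_cost, step_cost]
    have := h a
    omega) false

theorem length_vertices (n k : ℕ) : (vertices n k).length = (k + 1) * (n + 1) :=
  (List.length_product _ _).trans (by simp)

theorem card_vertex (n k : ℕ) : Fintype.card (Vertex n k) = (k + 1) * (n + 1) := by
  simp

theorem floydWarshall_cost_le (G : TGraph n k) {v : ℕ} (hv : (k + 1) * (n + 1) ≤ v) (h1 : 1 ≤ v) :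
    (floydWarshall G).cost ≤ 10 * v ^ 3 := by
  rw [floydWarshall, bind_cost]
  have e1 := tabulate_cost_le (ι := Vertex n k)
    (f := fun u => tabulate fun v => step (if u = v then min (G u v) (wle 0) else G u v))
    (c := v * 2) fun u => (tabulate_cost_le (c := 1) fun _ => le_rfl).trans (by
      rw [card_vertex]
      exact Nat.mul_le_mul_right _ hv)
  rw [card_vertex] at e1
  have e2 := loop_cost_le (vertices n k) (c := v * (v * 3 + 1))
    (f := fun (D : TGraph n k) w => tabulate fun u => tabulate fun v => do
      let s ← step (wadd (D u w) (D w v))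
      step (min (D u v) s)) (fun D w _ => (tabulate_cost_le (c := v * 3) fun u =>
        (tabulate_cost_le (c := 2) fun _ => le_rfl).trans (by
          rw [card_vertex]
          exact Nat.mul_le_mul_right _ hv)).trans (by
          rw [card_vertex]
          exact Nat.mul_le_mul_right _ hv))
    (tabulate fun u => tabulate fun v => step (if u = v then min (G u v) (wle 0) else G u v)).val
  rw [length_vertices] at e2
  refine (add_le_add e1 e2).trans ?_
  refine (add_le_add (Nat.mul_le_mul_right _ hv)
    (add_le_add (Nat.mul_le_mul_right _ hv) le_rfl)).trans ?_
  have h2 : v ≤ v ^ 2 := by nlinarith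
  have h3 : v ^ 2 ≤ v ^ 3 := by nlinarith
  calc v * (v * 2 + 1) + (v * (v * (v * 3 + 1) + 1) + 1)
      = 3 * v ^ 3 + 3 * v ^ 2 + 2 * v + 1 := by ring
    _ ≤ 10 * v ^ 3 := by omega

/-- The bounds are stated for a number `v` of vertices that is also at least that of the outer
columns. -/
theorem shortT_cost_le (G : TGraph n k) {v : ℕ} (hv : (k + 1) * (n + 1) ≤ v)
    (h2 : 2 * (n + 1) ≤ v) : (shortT G).cost ≤ 20 * v ^ 3 := by
  rw [shortT, bind_cost, bind_cost]
  have h1 : 1 ≤ v := by omega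
  have e1 := floydWarshall_cost_le G hv h1
  have e2 := anyT_cost_le (p := fun u => step (wless ((floydWarshall G).val u u) (wle 0)))
    (vertices n k) (c := 1) fun _ => le_rfl
  rw [length_vertices] at e2
  have e3 := Nat.mul_le_mul_right (1 + 2) hv
  have key : ∀ (b : Bool) (D : TGraph n k), (if b = true then step none else do
      let S ← tabulate fun u => tabulate fun v => step (outer D u v)
      step (some S) : Timed (Option (TGraph n 1))).cost ≤ v * (v * 2 + 1) + 1 := by
    intro b D
    split_ifs
    · rw [step_cost]
      omega
    · rw [bind_cost, step_cost]
      refine add_le_add ((tabulate_cost_le (c := v * 2) fun u =>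
        (tabulate_cost_le (c := 1) fun _ => le_rfl).trans ?_).trans ?_) le_rfl
      · rw [card_vertex]
        exact Nat.mul_le_mul_right _ h2
      · rw [card_vertex]
        exact Nat.mul_le_mul_right _ h2
  have e4 := key (anyT (fun u => step (wless ((floydWarshall G).val u u) (wle 0)))
    (vertices n k)).val (floydWarshall G).val
  refine (add_le_add e1 (add_le_add (e2.trans (add_le_add e3 le_rfl)) e4)).trans ?_
  have h4 : v ≤ v ^ 2 := by nlinarith
  have h5 : v ^ 2 ≤ v ^ 3 := by nlinarith
  calc 10 * v ^ 3 + (v * (1 + 2) + 1 + (v * (v * 2 + 1) + 1))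
      = 10 * v ^ 3 + 2 * v ^ 2 + 4 * v + 2 := by ring
    _ ≤ 20 * v ^ 3 := by omega

/-- The composition of two short graphs has `4 (n + 1) ≤ 8 n` vertices. -/
theorem mulT_cost_le (hn : 1 ≤ n) (G H : TGraph n 1) : (mulT G H).cost ≤ 21 * (8 * n) ^ 3 := by
  rw [mulT, bind_cost]
  have e1 := shortT_cost_le (tabulate fun u => tabulate fun v => step (comp G H u v)).val
    (v := 8 * n) (by omega) (by omega)
  have hv : Fintype.card (Vertex n (1 + 1 + 1)) ≤ 8 * n := by
    rw [card_vertex]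
    omega
  have e2 := tabulate_cost_le (ι := Vertex n (1 + 1 + 1))
    (f := fun u => tabulate fun v => step (comp G H u v)) (c := (8 * n) * 2)
    fun u => (tabulate_cost_le (c := 1) fun _ => le_rfl).trans (Nat.mul_le_mul_right _ hv)
  have e3 := e2.trans (Nat.mul_le_mul_right _ hv)
  refine (add_le_add e3 e1).trans ?_
  have h1 : 8 ≤ 8 * n := by omega
  have h2 : 8 * (8 * n) ≤ (8 * n) ^ 2 := by nlinarith
  have h3 : 8 * (8 * n) ^ 2 ≤ (8 * n) ^ 3 := by nlinarith
  calc 8 * n * (8 * n * 2 + 1) + 20 * (8 * n) ^ 3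
      = 20 * (8 * n) ^ 3 + 2 * (8 * n) ^ 2 + 8 * n := by ring
    _ ≤ 21 * (8 * n) ^ 3 := by omega

theorem noBoundsT_cost (n : ℕ) : (noBoundsT n).cost ≤ 4 * n + 1 := by
  rw [noBoundsT, bind_cost, bind_cost, step_cost]
  have e1 := tabulate_cost_le (ι := Fin n) (f := fun _ => step (⊤ : Weight)) (c := 1)
    fun _ => le_rfl
  rw [Fintype.card_fin] at e1
  omega

theorem boundsT_cost_le (b : (Fin n → Weight) × (Fin n → Weight)) (g : List (Atom n)) :
    (boundsT b g).cost ≤ 6 * g.length + 1 := by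
  refine (loop_cost_le (c := 5) g (fun b a _ => le_rfl) b).trans ?_
  omega

theorem transGraphT_cost_le (hn : 1 ≤ n) (t : Transition n) :
    (transGraphT t).cost ≤ 21 * (8 * n) ^ 3 + 6 * t.guard.length := by
  rw [transGraphT, bind_cost, bind_cost, bind_cost, bind_cost]
  set b := (boundsT (noBoundsT n).val t.guard).val
  have e1 := noBoundsT_cost n
  have e2 := boundsT_cost_le (noBoundsT n).val t.guard
  have hX : Fintype.card (X n) ≤ 2 * n := by
    rw [Fintype.card_fin]
    omega
  have e3 := (tabulate_cost_le (ι := X n) (f := fun x => tabulate fun y =>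
    step (Fin.cases (motive := fun _ => Weight) (Fin.cases ⊤ (fun j => b.1 j) y)
      (fun i => Fin.cases (b.2 i) (fun _ => ⊤) y) x)) (c := 2 * n * 2) fun u =>
      (tabulate_cost_le (c := 1) fun _ => le_rfl).trans (Nat.mul_le_mul_right _ hX)).trans
      (Nat.mul_le_mul_right _ hX)
  set gu := (tabulate fun x => tabulate fun y =>
    step (Fin.cases (motive := fun _ => Weight) (Fin.cases ⊤ (fun j => b.1 j) y)
      (fun i => Fin.cases (b.2 i) (fun _ => ⊤) y) x)).val
  have hv : Fintype.card (Vertex n 2) ≤ 6 * n := by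
    rw [card_vertex]
    omega
  have e4 := (tabulate_cost_le (ι := Vertex n 2) (f := fun u => tabulate fun v =>
    step (transGraphOf gu t.reset u v)) (c := 6 * n * 2) fun u =>
      (tabulate_cost_le (c := 1) fun _ => le_rfl).trans (Nat.mul_le_mul_right _ hv)).trans
      (Nat.mul_le_mul_right _ hv)
  have e5 := shortT_cost_le (tabulate fun u => tabulate fun v =>
    step (transGraphOf gu t.reset u v)).val (v := 8 * n) (by omega) (by omega)
  refine (add_le_add e1 (add_le_add e2 (add_le_add e3 (add_le_add e4 e5)))).trans ?_
  have h2 : 8 * (8 * n) ≤ (8 * n) ^ 2 := by nlinarith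
  have h3 : 8 * (8 * n) ^ 2 ≤ (8 * n) ^ 3 := by nlinarith
  have h4 : 2 * n * (2 * n * 2 + 1) = 8 * n ^ 2 + 2 * n := by ring
  have h5 : 6 * n * (6 * n * 2 + 1) = 72 * n ^ 2 + 6 * n := by ring
  have h6 : (8 * n) ^ 2 = 64 * n ^ 2 := by ring
  omega

theorem seqGraphT_cost_le (hn : 1 ≤ n) (σ : List (Transition n)) :
    (seqGraphT σ).cost ≤ (43 * (8 * n) ^ 3) * σ.length + 6 * atomCount σ + 1 := by
  induction σ with
  | nil => simp [seqGraphT, step_cost]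
  | cons t σ ih =>
    have e1 := transGraphT_cost_le hn t
    have e0 : atomCount (t :: σ) = t.guard.length + atomCount σ := by simp [atomCount]
    cases σ with
    | nil =>
      rw [seqGraphT, e0]
      simp only [List.length_singleton]
      omega
    | cons s σ =>
      rw [seqGraphT, bind_cost, bind_cost, e0, List.length_cons (as := s :: σ), mul_add, mul_one]
      have e2 : (match (transGraphT t).val, (seqGraphT (s :: σ)).val with
          | some G, some H => mulT G H
          | _, _ => step none).cost ≤ 22 * (8 * n) ^ 3 := by
        have h3 : 1 ≤ (8 * n) ^ 3 := Nat.one_le_pow _ _ (by omega)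
        split
        · rename_i G H _ _
          have := mulT_cost_le hn G H
          omega
        · rw [step_cost]
          omega
      refine (add_le_add e1 (add_le_add ih e2)).trans ?_
      omega

theorem similarT_cost_le (hn : 1 ≤ n) (G H : TGraph n 1) :
    (similarT G H).cost ≤ (8 * n) ^ 3 := by
  rw [similarT, bind_cost, step_cost]
  have e1 := anyT_cost_le (c := 2 * n * 5 + 1) (List.finRange (n + 1))
    (p := fun x => anyT (fun y => do
      let l ← step (decide (G (0, x) (0, y) ≠ H (0, x) (0, y)))
      let r ← step (decide (G (1, x) (1, y) ≠ H (1, x) (1, y)))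
      step (l || r)) (List.finRange (n + 1)))
    fun x => (anyT_cost_le (c := 3) _ fun y => le_rfl).trans (by
      rw [List.length_finRange]
      omega)
  rw [List.length_finRange] at e1
  have e2 : (n + 1) * (2 * n * 5 + 1 + 2) ≤ 2 * n * (2 * n * 5 + 1 + 2) :=
    Nat.mul_le_mul_right _ (by omega)
  refine (add_le_add (e1.trans (add_le_add e2 le_rfl)) le_rfl).trans ?_
  have h2 : n ≤ n ^ 2 := by nlinarith
  have h3 : n ^ 2 ≤ n ^ 3 := by nlinarith
  calc 2 * n * (2 * n * 5 + 1 + 2) + 1 + 1 = 20 * n ^ 2 + 6 * n + 2 := by ring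
    _ ≤ 512 * n ^ 3 := by omega
    _ = (8 * n) ^ 3 := by ring

/-- The loop ends as soon as the exponent exceeds `n ^ 2`. -/
theorem squaringT_cost_le (hn : 1 ≤ n) (fuel r p : ℕ) (hr : n * n < p * 2 ^ r) (G : TGraph n 1) :
    (squaringT fuel p G).cost ≤ 24 * (8 * n) ^ 3 * (r + 1) := by
  have hpos : 1 ≤ (8 * n) ^ 3 := Nat.one_le_pow _ _ (by omega)
  induction fuel generalizing r p G with
  | zero =>
    rw [squaringT, step_cost]
    nlinarith
  | succ fuel ih =>
    rw [squaringT, bind_cost]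
    have e1 := mulT_cost_le hn G G
    rcases (mulT G G).val with _ | G'
    · dsimp only
      rw [step_cost]
      nlinarith
    · dsimp only
      rw [bind_cost]
      have e2 := similarT_cost_le hn G' G
      have e3 : (tabulate fun x => tabulate fun y => step (G (0, x) (0, y)) :
          Timed (DBM n)).cost ≤ (8 * n) ^ 3 := by
        have hX : Fintype.card (X n) ≤ 2 * n := by
          rw [Fintype.card_fin]
          omega
        refine ((tabulate_cost_le (c := 2 * n * 2) fun u =>
          (tabulate_cost_le (c := 1) fun _ => le_rfl).trans (Nat.mul_le_mul_right _ hX)).trans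
          (Nat.mul_le_mul_right _ hX)).trans ?_
        have h2 : n ≤ n ^ 2 := by nlinarith
        have h3 : n ^ 2 ≤ n ^ 3 := by nlinarith
        calc 2 * n * (2 * n * 2 + 1) = 8 * n ^ 2 + 2 * n := by ring
          _ ≤ 512 * n ^ 3 := by omega
          _ = (8 * n) ^ 3 := by ring
      have hlow : 24 * (8 * n) ^ 3 ≤ 24 * (8 * n) ^ 3 * (r + 1) :=
        Nat.le_mul_of_pos_right _ (by omega)
      split_ifs
      · rw [bind_cost, step_cost]
        omega
      · rw [bind_cost, step_cost, step_val]
        split_ifs with hbig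
        · rw [step_cost]
          omega
        · rw [bind_cost, step_cost, step_val]
          have hbig' : ¬ n * n < p := by simpa using hbig
          cases r with
          | zero => simp at hr; omega
          | succ r =>
            have := ih r (p + p) (by
              rw [← two_mul, mul_assoc, mul_comm 2, mul_assoc, ← pow_succ]
              exact hr) G'
            rw [mul_add _ (r + 1) 1, mul_one]
            omega

theorem resetT_cost_le (σ : List (Transition n)) :
    (resetT σ).cost ≤ (2 * n + 1) * σ.length + 2 * n + 1 := by
  rw [resetT, bind_cost]
  have h : ∀ f : Fin n → Bool, (tabulate fun x => step (f x)).cost ≤ n * 2 := fun f =>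
    (tabulate_cost_le (c := 1) fun _ => le_rfl).trans (by rw [Fintype.card_fin])
  have e1 := h fun _ => false
  have e2 := loop_cost_le (c := n * 2)
    (f := fun (r : Fin n → Bool) (t : Transition n) =>
      tabulate fun x => step (r x || decide (x ∈ t.reset))) σ (fun r t _ => h _)
    (tabulate fun _ => step false).val
  refine (add_le_add e1 e2).trans ?_
  rw [mul_comm σ.length, mul_comm n 2]
  omega

theorem summaryT_cost_le (r : Fin n → Bool) (σ : List (Transition n)) :
    (summaryT r σ).cost ≤ 4 * n + 2 + 4 * σ.length + 12 * atomCount σ := by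
  rw [summaryT, bind_cost]
  have e1 := noBoundsT_cost n
  have key : ∀ s : Summary n, (loop (fun s t => do
      let s' ← loop (fun (s : Summary n) a => do
        let isReset ← step (r a.clock)
        let p ← step (s.posLower || (isReset && a.rel.isLower && decide (0 < a.const)))
        let q ← step (s.gtZero ||
          (isReset && a.rel.isLower && a.rel.isStrict && decide (a.const = 0)))
        let u ← step (s.upperUnreset || (!isReset && a.rel.isUpper))
        step (⟨p, q, u, s.bounds⟩ : Summary n)) s t.guard
      let b ← boundsT s'.bounds t.guard
      step (⟨s'.posLower, s'.gtZero, s'.upperUnreset, b⟩ : Summary n)) s σ).cost ≤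
      1 + 4 * σ.length + 12 * atomCount σ := by
    induction σ with
    | nil => intro s; simp [loop, step_cost]
    | cons t σ ih =>
      intro s
      rw [loop, bind_cost, bind_cost, step_cost, step_val]
      refine (add_le_add le_rfl (add_le_add ?_ (ih _))).trans
        (b := 1 + ((12 * t.guard.length + 3) + (1 + 4 * σ.length + 12 * atomCount σ))) ?_
      · rw [bind_cost, bind_cost, step_cost]
        refine (add_le_add (loop_cost_le (c := 5) t.guard (fun b a _ => le_rfl) s)
          (add_le_add (boundsT_cost_le _ t.guard) le_rfl)).trans ?_
        omega
      · have e0 : atomCount (t :: σ) = t.guard.length + atomCount σ := by simp [atomCount]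
        rw [e0, List.length_cons]
        omega
  refine (add_le_add e1 (key _)).trans ?_
  omega

theorem nonIterT_cost_le (r : Fin n → Bool) (s : Summary n) : (nonIterT r s).cost ≤ 8 * n + 4 := by
  rw [nonIterT, bind_cost, bind_cost, bind_cost, step_cost, step_cost]
  have h : ∀ f : Weight → Fin n → Bool, (anyT (fun y => do
      let w ← step (wadd (s.bounds.1 y) (s.bounds.2 y))
      step (f w y)) (List.finRange n)).cost ≤ n * 4 + 1 := fun f =>
    (anyT_cost_le (c := 2) _ fun _ => le_rfl).trans (by rw [List.length_finRange])
  have e1 := h fun w y => !(r y) && wless w (wle 0)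
  have e2 := h fun w y => !(r y) && !wless (wle 0) w
  refine (add_le_add e1 (add_le_add le_rfl (add_le_add e2 le_rfl))).trans ?_
  omega

theorem removeUnresetT_cost_le (r : Fin n → Bool) (σ : List (Transition n)) :
    (removeUnresetT r σ).cost ≤ 3 * σ.length + 5 * atomCount σ + 1 := by
  induction σ with
  | nil => simp [removeUnresetT, step_cost]
  | cons t σ ih =>
    rw [removeUnresetT, bind_cost, bind_cost, bind_cost, step_cost, filterT_val]
    have e1 := loop_cost_le (c := 2) (f := fun (g : List (Atom n)) (a : Atom n) =>
      (do
        let isReset ← step (r a.clock)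
        if isReset then step (a :: g) else step g : Timed (List (Atom n)))) t.guard (fun b a _ => by
        rw [bind_cost, step_cost, step_val]
        split_ifs <;> exact le_rfl) ([] : List (Atom n))
    have e2 := loop_cost_le (c := 1) (f := fun (g : List (Atom n)) (a : Atom n) => step (a :: g))
      ((t.guard.filter fun a : Atom n => r a.clock).reverse ++ []) (fun b a _ => le_rfl) []
    have e3 : ((t.guard.filter fun a : Atom n => r a.clock).reverse ++ []).length ≤
        t.guard.length := by
      simpa using List.length_filter_le _ _
    have e0 : atomCount (t :: σ) = t.guard.length + atomCount σ := by simp [atomCount]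
    rw [e0, List.length_cons]
    refine (add_le_add e1 (add_le_add e2 (add_le_add ih le_rfl))).trans ?_
    omega

theorem atomCount_removeUnreset_le (σ : List (Transition n)) :
    atomCount (removeUnreset σ) ≤ atomCount σ := by
  rw [atomCount, atomCount, removeUnreset, List.map_map]
  refine List.sum_le_sum fun t _ => ?_
  exact List.length_filter_le _ _

/-- The squaring loop accounts for the logarithm, and the incremental composition for the length. -/
theorem iterTest_cost_le (hn : 1 ≤ n) {σ : List (Transition n)} (hσ : σ ≠ []) :
    (iterTest σ).cost ≤ 150 * (8 * n) ^ 3 * (σ.length + Nat.log 2 n) + 40 * atomCount σ := by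
  have hs : 1 ≤ σ.length := List.length_pos_iff.2 hσ
  have e1 := resetT_cost_le σ
  have e2 := summaryT_cost_le (resetT σ).val σ
  have e3 := nonIterT_cost_le (resetT σ).val (summaryT (resetT σ).val σ).val
  have e4 := removeUnresetT_cost_le (resetT σ).val σ
  have e5 := seqGraphT_cost_le hn (removeUnreset σ)
  have e6 := atomCount_removeUnreset_le σ
  have e7 : (removeUnreset σ).length = σ.length := by simp [removeUnreset]
  rw [e7] at e5
  -- `2 (log₂ n + 1)` rounds suffice to exceed `n ^ 2`
  have hlog : n * n < 1 * 2 ^ (2 * (Nat.log 2 n + 1)) := by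
    have h := Nat.lt_pow_succ_log_self (b := 2) one_lt_two n
    rw [one_mul, two_mul, pow_add]
    exact Nat.mul_lt_mul'' h h
  have e8 : ∀ G : TGraph n 1, (squaringT (n ^ 2 + 1) 1 G).cost ≤
      24 * (8 * n) ^ 3 * (2 * (Nat.log 2 n + 1) + 1) := squaringT_cost_le hn _ _ 1 hlog
  have hN : 64 * (8 * n) ≤ (8 * n) ^ 3 := by
    have h2 : 8 * (8 * n) ≤ (8 * n) ^ 2 := by nlinarith
    have h3 : 8 * (8 * n) ^ 2 ≤ (8 * n) ^ 3 := by nlinarith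
    omega
  rw [iterTest, bind_cost, bind_cost, bind_cost]
  have key : ∀ b c : Bool, (if b = true then step Verdict.notIterable
      else if c = true then step Verdict.iterable
      else do
        let σ' ← removeUnresetT (resetT σ).val σ
        let G ← seqGraphT σ'
        match G with
        | none => step Verdict.notIterable
        | some G => squaringT (n ^ 2 + 1) 1 G : Timed (Verdict n)).cost ≤
      (3 * σ.length + 5 * atomCount σ + 1) + ((43 * (8 * n) ^ 3 * σ.length + 6 * atomCount σ + 1) +
        (24 * (8 * n) ^ 3 * (2 * (Nat.log 2 n + 1) + 1) + 1)) := by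
    intro b c
    split_ifs
    · rw [step_cost]
      omega
    · rw [step_cost]
      omega
    · rw [bind_cost, bind_cost]
      have h1 : (removeUnresetT (resetT σ).val σ).val = removeUnreset σ := by
        rw [resetT_val, removeUnresetT_val]
        rfl
      rw [h1]
      refine add_le_add e4 (add_le_add (e5.trans (by omega)) ?_)
      rcases (seqGraphT (removeUnreset σ)).val with _ | G
      · dsimp only
        rw [step_cost]
        omega
      · exact (e8 G).trans (by omega)
  refine (add_le_add e1 (add_le_add e2 (add_le_add e3 (key _ _)))).trans ?_
  have h1 : (2 * n + 1) * σ.length ≤ (8 * n) ^ 3 * σ.length := Nat.mul_le_mul_right _ (by omega)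
  have h2 : (8 * n) ^ 3 * 1 ≤ (8 * n) ^ 3 * σ.length := Nat.mul_le_mul_left _ hs
  have h3 : 64 * σ.length ≤ (8 * n) ^ 3 * σ.length := Nat.mul_le_mul_right _ (by omega)
  have h4 : 24 * (8 * n) ^ 3 * (2 * (Nat.log 2 n + 1) + 1) =
    48 * ((8 * n) ^ 3 * Nat.log 2 n) + 72 * (8 * n) ^ 3 := by ring
  have h5 : 150 * (8 * n) ^ 3 * (σ.length + Nat.log 2 n) =
    150 * ((8 * n) ^ 3 * σ.length) + 150 * ((8 * n) ^ 3 * Nat.log 2 n) := by ring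
  have h6 : 43 * (8 * n) ^ 3 * σ.length = 43 * ((8 * n) ^ 3 * σ.length) := by ring
  rw [h4, h5, h6]
  omega

end Cost

end TimedIteration

/-! ### Correctness and complexity -/

theorem mainTheorem1 :
    (∀ (n : ℕ) (σ : List (TimedIteration.Transition n)),
      -- the first step: a report of non-iterability
      (TimedIteration.NonIterCondition σ → ¬ TimedIteration.OmegaIterable σ) ∧
      -- the second step: a report of iterability
      (¬ TimedIteration.NonIterCondition σ → ¬ TimedIteration.HasPositiveLower σ →
        TimedIteration.NoDegenerateUpper σ → TimedIteration.OmegaIterable σ) ∧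
      -- the second step: removal of guards; then the computation of the powers
      (¬ TimedIteration.NonIterCondition σ → TimedIteration.HasPositiveLower σ →
        (TimedIteration.OmegaIterable σ ↔
          TimedIteration.OmegaIterable (TimedIteration.removeUnreset σ)) ∧
        ∀ k : ℕ,
          (TimedIteration.power (TimedIteration.removeUnreset σ) k = none →
            ¬ TimedIteration.OmegaIterable σ) ∧
          ∀ G G' : TimedIteration.TGraph n 1,
            TimedIteration.power (TimedIteration.removeUnreset σ) k = some G →
            TimedIteration.power (TimedIteration.removeUnreset σ) (k + 1) = some G' →
            (¬ TimedIteration.Similar G' G → n ^ 2 < 2 ^ k → ¬ TimedIteration.OmegaIterable σ) ∧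
            (TimedIteration.Similar G' G → TimedIteration.OmegaIterable σ ∧
              (TimedIteration.left G).zone =
                {v | TimedIteration.OmegaIterableFrom (TimedIteration.removeUnreset σ) v})) ∧
      -- the answers of the whole procedure
      (TimedIteration.procedure σ = TimedIteration.Verdict.notIterable →
        ¬ TimedIteration.OmegaIterable σ) ∧
      (TimedIteration.procedure σ = TimedIteration.Verdict.iterable →
        TimedIteration.NoDegenerateUpper σ → TimedIteration.OmegaIterable σ) ∧
      (∀ Z : TimedIteration.DBM n, TimedIteration.procedure σ = TimedIteration.Verdict.zone Z →
        TimedIteration.OmegaIterable σ ∧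
          Z.zone = {v | TimedIteration.OmegaIterableFrom (TimedIteration.removeUnreset σ) v})) ∧
    -- the complexity
    (∃ C : ℝ, ∀ (n : ℕ) (σ : List (TimedIteration.Transition n)),
      (TimedIteration.iterTest σ).val = TimedIteration.procedure σ ∧
      (1 ≤ n → σ ≠ [] →
        ((TimedIteration.iterTest σ).cost : ℝ) ≤
          C * (((σ.length : ℝ) + Real.log n) * (n : ℝ) ^ 3 + TimedIteration.atomCount σ))) := by
  open TimedIteration in
  refine ⟨fun n σ => ⟨not_omegaIterable_of_nonIterCondition, omegaIterable_of_not_hasPositiveLower,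
    fun h hpos => ⟨omegaIterable_removeUnreset_iff h hpos, correct_of_hasPositiveLower h hpos⟩,
    fun hv => ?_, fun hv hdeg => ?_, fun Z hv => ?_⟩, 153600, fun n σ => ⟨iterTest_val σ,
    fun hn hσ => ?_⟩⟩
  · by_cases h : NonIterCondition σ
    · exact not_omegaIterable_of_nonIterCondition h
    · rw [procedure, if_neg h] at hv
      split_ifs at hv with hpos
      exact not_omegaIterable_of_squaring h hpos (add_zero _)
        (fun j hj => absurd hj j.succ_ne_zero) hv
  · rw [procedure] at hv
    split_ifs at hv with h hpos
    · exact absurd hv (squaring_ne_iterable _ _ _)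
    · exact omegaIterable_of_not_hasPositiveLower h hpos hdeg
  · rw [procedure] at hv
    split_ifs at hv with h hpos
    obtain ⟨j, G, G', hG, hG', hs, rfl⟩ := exists_of_squaring_eq_zone hv
    exact ((correct_of_hasPositiveLower h hpos j).2 G G' hG hG').2 hs
  · have hcost : ((iterTest σ).cost : ℝ) ≤
        150 * (8 * n) ^ 3 * (σ.length + Nat.log 2 n) + 40 * atomCount σ := by
      exact_mod_cast iterTest_cost_le hn hσ
    have hlog : (Nat.log 2 n : ℝ) ≤ 2 * Real.log n := by
      have h1 : (Nat.log 2 n : ℝ) * Real.log 2 ≤ Real.log n := by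
        rw [← Real.log_pow]
        refine Real.log_le_log (by positivity) ?_
        exact_mod_cast Nat.pow_log_le_self 2 (by omega)
      have h2 := Real.log_two_gt_d9
      have h3 : (0 : ℝ) ≤ Nat.log 2 n := Nat.cast_nonneg _
      nlinarith
    have h1 : (0 : ℝ) ≤ (n : ℝ) ^ 3 := by positivity
    have h2 : (0 : ℝ) ≤ σ.length := Nat.cast_nonneg _
    have h3 : (0 : ℝ) ≤ atomCount σ := Nat.cast_nonneg _
    have h4 : (0 : ℝ) ≤ σ.length * (n : ℝ) ^ 3 := by positivity
    calc ((iterTest σ).cost : ℝ)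
        ≤ 76800 * ((n : ℝ) ^ 3 * (σ.length + Nat.log 2 n)) + 40 * atomCount σ := by
          refine hcost.trans (le_of_eq ?_)
          ring
      _ ≤ 76800 * ((n : ℝ) ^ 3 * (σ.length + 2 * Real.log n)) + 40 * atomCount σ := by
          gcongr
      _ ≤ 153600 * ((σ.length + Real.log n) * (n : ℝ) ^ 3 + atomCount σ) := by linarith
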